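/- Let $d\ge 2$ and let $\mathcal V\subset\mathbb R^d$ be a parallelepiped (periodic cell) spanned by a basis of $\mathbb R^d$. For matrices put $a:b=\sum_{ij}a_{ij}b_{ij}$, $\|a\|=(a:a)^{1/2}$, $(a\otimes b)_{ijkl}=a_{ij}b_{kl}$; for fourth-order tensors put $A::B=\sum_{ijkl}A_{ijkl}B_{ijkl}$. Let $\mathcal J=\frac1d I\otimes I$ and $\mathcal K=\mathcal I-\mathcal J$ with $\mathcal I_{ijkl}=\frac12(\delta_{ik}\delta_{jl}+\delta_{il}\delta_{jk})$, and let $n_J=1$, $n_K=\frac{d(d+1)}2-1$. Fix reference moduli $\kappa_0,\mu_0>0$ and let $$\lambda_J=\frac1{d\kappa_0+2(d-1)\mu_0},\qquad \lambda_K=\frac{d(d-1)(\kappa_0+2\mu_0)}{2\mu_0\,(d\kappa_0+2(d-1)\mu_0)} .$$ Let $\mathcal P=\mathcal J$ or $\mathcal P=\mathcal K$, and let $\bar\varepsilon^{(i)}$, $i=1,\dots,n_P$, be nonzero symmetric matrices with $$\mathcal P=\sum_{i=1}^{n_P}\frac{\bar\varepsilon^{(i)}\otimes\bar\varepsilon^{(i)}}{\|\bar\varepsilon^{(i)}\|^2},\qquad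 \bar\varepsilon^{(i)}:\bar\varepsilon^{(j)}=\|\bar\varepsilon^{(i)}\|\,\|\bar\varepsilon^{(j)}\|\,\delta_{ij}.$$ For $\mathcal V$-periodic moduli $\kappa,\mu\in L^\infty$ with positive values let $\mathcal L=d\kappa\mathcal J+2\mu\mathcal K$, $\mathcal L_0=d\kappa_0\mathcal J+2\mu_0\mathcal K$, $\delta\mathcal L=\mathcal L-\mathcal L_0$, $\|\delta\mathcal L\|=\sup_{\mathcal V}\max(|d(\kappa-\kappa_0)|,|2(\mu-\mu_0)|)$ (essential supremum) and $\delta p=n_P^{-1}\,\delta\mathcal L::\mathcal P$. Assume that the reference modulus is the mean modulus, i.e. $\int_{\mathcal V}\delta p=0$. Let $\varepsilon^{(i)}$ be strain solutions for the $\bar\varepsilon^{(i)}$: $\varepsilon^{(i)}=\bar\varepsilon^{(i)}+\nabla_s u^{(i)}$ with $u^{(i)}\in H^1$ $\mathcal V$-periodic and $\nabla\cdot(\mathcal L:\varepsilon^{(i)})=0$ weakly against smooth $\mathcal V$-periodic test functions. Put $\varepsilon^{(i)}_\parallel=\varepsilon^{(i)}:\bar\varepsilon^{(i)}/\|\bar\varepsilon^{(i)}\|$.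 Then, as $\|\delta\mathcal L\|\to0$, $$\delta p(x)=\lambda_P^{-1}\sum_{i=1}^{n_P}\Big[1-\frac{\varepsilon^{(i)}_\parallel(x)}{\|\bar\varepsilon^{(i)}\|}\Big]+o(\|\delta\mathcal L\|)\qquad(1)$$ and $$\delta p(x)=\lambda_P^{-1}\sum_{i=1}^{n_P}\Big[1-\Big(\frac{\mathcal P::\varepsilon^{(i)}(x)\otimes\varepsilon^{(i)}(x)}{\mathcal P::\bar\varepsilon^{(i)}\otimes\bar\varepsilon^{(i)}}\Big)^{1/2}\Big]+o(\|\delta\mathcal L\|).\qquad(2)$$ The remainders are understood as follows. (a) The remainder in (1) is $o(\|\delta\mathcal L\|)$ in $L^2(\mathcal V)$, and the one in (2) is $o(\|\delta\mathcal L\|)$ in $L^q(\mathcal V)$ for every $q\in[1,2)$, in both cases uniformly over all such $\kappa,\mu$ and all such solutions. (b) For moduli $\kappa_n=\kappa_0+t_nk$, $\mu_n=\mu_0+t_nm$ as above, with fixed functions $k,m$ and real numbers $t_n\to0$, both remainders are, for almost every $x\in\mathcal V$, $o(\|\delta\mathcal L_n\|)$ pointwise at $x$ as $n\to\infty$. 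-/

import Mathlib

open MeasureTheory Filter Asymptotics
open scoped ENNReal ContDiff

noncomputable section

namespace Elasticity

/-- Points of the physical space `ℝ^d`, with its Euclidean structure. -/
abbrev Space (d : ℕ) := EuclideanSpace ℝ (Fin d)

/-- Second-order tensors. -/
abbrev Tensor2 (d : ℕ) := Matrix (Fin d) (Fin d) ℝ

/-- Fourth-order tensors, given by their components. -/
abbrev Tensor4 (d : ℕ) := Fin d → Fin d → Fin d → Fin d → ℝ

/-- The double inner product `a : b = a_ij b_ij` of second-order tensors. -/
def ddot {d : ℕ} (a b : Tensor2 d) : ℝ := ∑ i, ∑ j, a i j * b i j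

/-- The norm `‖a‖ = (a : a)^{1/2}`. -/
def tnorm {d : ℕ} (a : Tensor2 d) : ℝ := Real.sqrt (ddot a a)

/-- The dyadic product `a ⊗ b`. -/
def dyad {d : ℕ} (a b : Tensor2 d) : Tensor4 d := fun i j k l => a i j * b k l

/-- The action `A : a` of a fourth-order tensor on a second-order one. -/
def act {d : ℕ} (A : Tensor4 d) (a : Tensor2 d) : Tensor2 d :=
  Matrix.of fun i j => ∑ k, ∑ l, A i j k l * a k l

/-- The full contraction `A :: B = A_ijkl B_ijkl` of fourth-order tensors. -/
def qdot {d : ℕ} (A B : Tensor4 d) : ℝ := ∑ i, ∑ j, ∑ k, ∑ l, A i j k l * B i j k l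

/-- The Kronecker symbol. -/
def kron {d : ℕ} (i j : Fin d) : ℝ := if i = j then 1 else 0

/-- The identity on symmetric second-order tensors,
`I_ijkl = (δ_ik δ_jl + δ_il δ_jk) / 2`. -/
def tensorI (d : ℕ) : Tensor4 d :=
  fun i j k l => (kron i k * kron j l + kron i l * kron j k) / 2

/-- The spherical projector `J = (1/d) I ⊗ I`. -/
def tensorJ (d : ℕ) : Tensor4 d := fun i j k l => kron i j * kron k l / d

/-- The deviatoric projector `K = I - J`. -/
def tensorK (d : ℕ) : Tensor4 d := tensorI d - tensorJ d

/-- The choice between the two isotropic projectors. -/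
inductive Proj where
  | J : Proj
  | K : Proj

/-- The projector `P`, equal to `J` or `K`. -/
def Proj.tensor (d : ℕ) : Proj → Tensor4 d
  | .J => tensorJ d
  | .K => tensorK d

/-- `n_J = J :: J = 1` and `n_K = K :: K = d(d+1)/2 - 1`. -/
def Proj.dim (d : ℕ) : Proj → ℕ
  | .J => 1
  | .K => d * (d + 1) / 2 - 1

/-- The coefficient `α₀ = 1 / (4 μ₀)` of the Green's tensor. -/
def alpha (μ₀ : ℝ) : ℝ := 1 / (4 * μ₀)

/-- The coefficient `β₀` of the Green's tensor. -/
def beta (d : ℕ) (κ₀ μ₀ : ℝ) : ℝ :=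
  -(1 / μ₀) * ((d * κ₀ + (d - 2) * μ₀) / (d * κ₀ + 2 * (d - 1) * μ₀))

/-- The constants `λ_J`, `λ_K`: the full contraction with `P` of the Green's tensor
`(α₀/|ξ|²) ∑_m ψ_m ⊗ ψ_m + (β₀/|ξ|⁴) ψ ⊗ ψ`, where `ψ = ξ ⊗ ξ` and `ψ_m = ξ ⊗ e_m + e_m ⊗ ξ`,
which is the same for all `ξ ≠ 0`. Explicitly `λ_J = 1 / (d κ₀ + 2 (d-1) μ₀)` and
`λ_K = d (d-1) (κ₀ + 2 μ₀) / (2 μ₀ (d κ₀ + 2 (d-1) μ₀))`. -/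
def Proj.lam (d : ℕ) (κ₀ μ₀ : ℝ) : Proj → ℝ
  | .J => 1 / d * (4 * alpha μ₀ + beta d κ₀ μ₀)
  | .K => 1 / d * ((2 * d * (d + 1) - 4) * alpha μ₀ + (d - 1) * beta d κ₀ μ₀)

/-- The isotropic elasticity tensor `d κ J + 2 μ K`. -/
def isoTensor (d : ℕ) (κ μ : ℝ) : Tensor4 d := (d * κ) • tensorJ d + (2 * μ) • tensorK d

variable {d : ℕ}

/-- The periodic cell `V`: the parallelepiped spanned by the basis `b`. -/
def cell (b : Module.Basis (Fin d) ℝ (Space d)) : Set (Space d) := ZSpan.fundamentalDomain b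

/-- Lebesgue measure on the periodic cell. -/
def cellMeasure (b : Module.Basis (Fin d) ℝ (Space d)) : Measure (Space d) :=
  volume.restrict (cell b)

/-- `V`-periodicity: invariance under the translations by the basis vectors. -/
def IsPeriodic (b : Module.Basis (Fin d) ℝ (Space d)) {α : Type*} (f : Space d → α) : Prop :=
  ∀ x i, f (x + b i) = f x

/-- Smooth periodic scalar test functions. -/
def IsTest (b : Module.Basis (Fin d) ℝ (Space d)) (φ : Space d → ℝ) : Prop :=
  ContDiff ℝ ∞ φ ∧ IsPeriodic b φ

/-- The partial derivative `∂_j φ` of a smooth function. -/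
def partialD (j : Fin d) (φ : Space d → ℝ) (x : Space d) : ℝ :=
  fderiv ℝ φ x (EuclideanSpace.single j 1)

/-- `u` belongs to the periodic Sobolev space `H¹_per(V; ℝ^d)`, with weak gradient
`G_ij = ∂_j u_i`. -/
structure IsWeakGradient (b : Module.Basis (Fin d) ℝ (Space d))
    (u : Space d → Fin d → ℝ) (G : Space d → Tensor2 d) : Prop where
  periodic : IsPeriodic b u
  periodic_grad : IsPeriodic b G
  memLp : ∀ i, MemLp (fun x => u x i) 2 (cellMeasure b)
  memLp_grad : ∀ i j, MemLp (fun x => G x i j) 2 (cellMeasure b)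
  weak : ∀ i j, ∀ φ, IsTest b φ →
    ∫ x, u x i * partialD j φ x ∂(cellMeasure b) = -∫ x, G x i j * φ x ∂(cellMeasure b)

/-- `κ, μ` are periodic bulk and shear modulus fields in `L^∞_per(V; ]0,∞[)`. -/
structure IsModuliField (b : Module.Basis (Fin d) ℝ (Space d)) (κ μ : Space d → ℝ) : Prop where
  periodic_bulk : IsPeriodic b κ
  periodic_shear : IsPeriodic b μ
  memLp_bulk : MemLp κ ∞ (cellMeasure b)
  memLp_shear : MemLp μ ∞ (cellMeasure b)
  pos_bulk : ∀ᵐ x ∂(cellMeasure b), 0 < κ x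
  pos_shear : ∀ᵐ x ∂(cellMeasure b), 0 < μ x

/-- The stress field `σ = L : ε`. -/
def stress (κ μ : Space d → ℝ) (ε : Space d → Tensor2 d) (x : Space d) : Tensor2 d :=
  act (isoTensor d (κ x) (μ x)) (ε x)

/-- `ε` is the periodic strain field solution associated with the macroscopic strain `E` in the
medium with moduli `κ, μ`: `ε = E + ∇_s u` with `u` a periodic displacement in `H¹`, and the stress
field is divergence free, in the weak sense on the periodic cell. -/
def IsStrainSolution (b : Module.Basis (Fin d) ℝ (Space d)) (κ μ : Space d → ℝ)
    (E : Tensor2 d) (ε : Space d → Tensor2 d) : Prop :=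
  IsPeriodic b ε ∧
  (∃ u G, IsWeakGradient b u G ∧
    ∀ᵐ x ∂(cellMeasure b), ε x = E + (1 / 2 : ℝ) • (G x + (G x).transpose)) ∧
  ∀ i, ∀ φ, IsTest b φ →
    ∫ x, ∑ j, stress κ μ ε x i j * partialD j φ x ∂(cellMeasure b) = 0

/-- The fluctuation `δL(x) = L(x) - L₀` of the elasticity tensor. -/
def deltaL (κ₀ μ₀ : ℝ) (κ μ : Space d → ℝ) (x : Space d) : Tensor4 d :=
  isoTensor d (κ x) (μ x) - isoTensor d κ₀ μ₀

/-- The contrast `‖δL‖`: the (essential) supremum over `V` of `max (|d δκ|, |2 δμ|)`. -/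
def contrast (b : Module.Basis (Fin d) ℝ (Space d)) (κ₀ μ₀ : ℝ) (κ μ : Space d → ℝ) : ℝ :=
  (eLpNorm (fun x => max |d * (κ x - κ₀)| |2 * (μ x - μ₀)|) ∞ (cellMeasure b)).toReal

/-- The modulus `δp(x) = n_P⁻¹ δL(x) :: P`. -/
def deltaP (P : Proj) (κ₀ μ₀ : ℝ) (κ μ : Space d → ℝ) (x : Space d) : ℝ :=
  (P.dim d : ℝ)⁻¹ * qdot (deltaL κ₀ μ₀ κ μ x) (P.tensor d)

/-- The symmetric tensors `E i`, `i = 1, …, n_P`, form an orthogonal eigenbasis of `P`. -/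
structure IsOrthogonalEigenbasis (P : Proj) (E : Fin (P.dim d) → Tensor2 d) : Prop where
  symm : ∀ i, (E i).IsSymm
  ne_zero : ∀ i, E i ≠ 0
  resolution : P.tensor d = ∑ i, (tnorm (E i) ^ 2)⁻¹ • dyad (E i) (E i)
  orthogonal : ∀ i j, ddot (E i) (E j) = tnorm (E i) * tnorm (E j) * (if i = j then 1 else 0)

/-- The component `ε_∥ = (ε : E) / ‖E‖` of a strain parallel to the macroscopic strain `E`. -/
def parallel (E ε : Tensor2 d) : ℝ := ddot ε E / tnorm E

/-- First local formula: `λ_P⁻¹ ∑ᵢ [1 - ε_∥⁽ⁱ⁾(x) / ‖E⁽ⁱ⁾‖]`. -/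
def reconParallel (P : Proj) (κ₀ μ₀ : ℝ) (E : Fin (P.dim d) → Tensor2 d)
    (ε : Fin (P.dim d) → Space d → Tensor2 d) (x : Space d) : ℝ :=
  (P.lam d κ₀ μ₀)⁻¹ * ∑ i, (1 - parallel (E i) (ε i x) / tnorm (E i))

/-- Second local formula:
`λ_P⁻¹ ∑ᵢ [1 - (P :: ε⁽ⁱ⁾(x) ⊗ ε⁽ⁱ⁾(x) / P :: E⁽ⁱ⁾ ⊗ E⁽ⁱ⁾)^{1/2}]`. -/
def reconEnergy (P : Proj) (κ₀ μ₀ : ℝ) (E : Fin (P.dim d) → Tensor2 d)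
    (ε : Fin (P.dim d) → Space d → Tensor2 d) (x : Space d) : ℝ :=
  (P.lam d κ₀ μ₀)⁻¹ * ∑ i,
    (1 - Real.sqrt (qdot (P.tensor d) (dyad (ε i x) (ε i x)) /
      qdot (P.tensor d) (dyad (E i) (E i))))

end Elasticity

end

open MeasureTheory Filter Asymptotics
open scoped ENNReal NNReal ContDiff

namespace Elasticity

/-! ### Fourier analysis on the periodic cell, transported from the unit torus. -/

section FourierCell

-- Write `ε i = E i + e i`. At each nonzero frequency, equilibrium is a linear system for the
-- Fourier coefficients of `e i`, and `green` is the symbol of its solution operator Γ. This gives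
-- the Lippmann-Schwinger equation e = -Γ(δL : ε) (`IsStrainSolution.isGreenImage`), both sides
-- having zero mean. The tensor `E i` is an eigenvector of δL(x) with eigenvalue δp(x), so to first
-- order `e i` is -Γ(δp `E i`). Summing `E i : e i / ‖E i‖²` over the eigenbasis contracts the
-- symbol with P, and that contraction equals λ_P in every direction (`qdot_green`). Since δp has
-- zero mean, the missing zero frequency costs nothing, and the nonlocal operator Γ collapses to
-- multiplication by λ_P: this is why a local formula exists. What is left in the first formula is Γ
-- applied to δL : e, which is of order ‖δL‖² in L² by Parseval, because e is of order ‖δL‖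
-- (`exists_integral_cresidual_le`, `IsStrainSolution.energy_fluctField_le`).
--
-- For the second formula, the square root of the energy ratio is √((1 + s)² + B), with 1 + s the
-- relative parallel component and B the squared transverse components. It differs from 1 + s by at
-- most a multiple of y and by at most a multiple of y², where y is the relative size of e
-- (`sqrt_energy_bounds`). As e is only controlled in L², the square cannot be placed in L^q for q >
-- 1; interpolating to y^(2/q) gives a bound of order ‖δL‖^(2/q) in L^q, which is o(‖δL‖) exactly
-- because q < 2.
--
-- For the pointwise statement δL = t A with A fixed, and e is expanded in a Neumann series in t
-- whose terms do not depend on t. Their energies grow at most geometrically, so a weighted sum of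
-- their squares is finite almost everywhere; this bounds the tail beyond first order by M(x) t²
-- (`exists_pointwise_expansion`). The first-order term has zero residual, again by the contraction
-- identity.

noncomputable local instance : MeasureSpace UnitAddCircle := ⟨AddCircle.haarAddCircle⟩

local instance : Measure.IsAddHaarMeasure (volume : Measure UnitAddCircle) :=
  inferInstanceAs (Measure.IsAddHaarMeasure AddCircle.haarAddCircle)

local instance : IsProbabilityMeasure (volume : Measure UnitAddCircle) :=
  inferInstanceAs (IsProbabilityMeasure AddCircle.haarAddCircle)

variable {d : ℕ} (b : Module.Basis (Fin d) ℝ (Space d))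

/-- The wave vector of index `n` in the dual lattice. -/
noncomputable def wave (n : Fin d → ℤ) (j : Fin d) : ℝ :=
  2 * Real.pi * ∑ k, n k * b.repr (EuclideanSpace.single j 1) k

/-- The phase `ξ · x`, for `ξ` the wave vector of index `n`. -/
noncomputable def phase (n : Fin d → ℤ) (x : Space d) : ℝ := ∑ j, wave b n j * x j

/-- The (unnormalized) Fourier coefficients of a function on the cell. -/
noncomputable def fcoef (f : Space d → ℂ) (n : Fin d → ℤ) : ℂ :=
  ∫ x, f x * Complex.exp (-(phase b n x) * Complex.I) ∂(cellMeasure b)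

lemma phase_eq_repr (n : Fin d → ℤ) (x : Space d) :
    phase b n x = 2 * Real.pi * ∑ k, n k * b.repr x k := by
  have hx : x = ∑ j, x j • EuclideanSpace.single j (1 : ℝ) := by
    ext i; simp [Pi.single_apply]
  have hr : ∀ k, b.repr x k = ∑ j, x j * b.repr (EuclideanSpace.single j 1) k := by
    intro k
    conv_lhs => rw [hx]
    simp [map_sum, Finsupp.finsetSum_apply]
  simp only [phase, wave, hr, Finset.mul_sum, Finset.sum_mul]
  rw [Finset.sum_comm]
  refine Finset.sum_congr rfl fun k _ => Finset.sum_congr rfl fun j _ => by ring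

lemma wave_ne_zero {n : Fin d → ℤ} (hn : n ≠ 0) : wave b n ≠ 0 := by
  intro h
  apply hn
  funext k
  -- The phase at the basis vector `b k` is 2π `n k`, so the wave vector determines the index.
  have h1 : phase b n (b k) = 0 := by simp [phase, h]
  rw [phase_eq_repr] at h1
  simp only [Module.Basis.repr_self, Finsupp.single_apply] at h1
  simpa [Real.pi_ne_zero] using h1

/-- The class in the unit torus of a point, through its lattice coordinates. -/
noncomputable def toTorus (x : Space d) : UnitAddTorus (Fin d) :=
  fun i => ((b.repr x i : ℝ) : UnitAddCircle)

/-- The representative in the cell of a point of the unit torus. -/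
noncomputable def ofTorus (θ : UnitAddTorus (Fin d)) : Space d :=
  b.equivFun.symm (fun i => (UnitAddTorus.measurableEquivPiIoc (fun _ => (0 : ℝ)) θ).1 i)

lemma repr_equivFun_symm (y : Fin d → ℝ) (i : Fin d) : b.repr (b.equivFun.symm y) i = y i :=
  congrFun (b.equivFun.apply_symm_apply y) i

lemma toTorus_ofTorus (θ : UnitAddTorus (Fin d)) : toTorus b (ofTorus b θ) = θ := by
  funext i
  simp only [toTorus, ofTorus]
  rw [repr_equivFun_symm]
  simp

lemma continuous_equivFun_symm : Continuous (b.equivFun.symm : (Fin d → ℝ) → Space d) :=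
  b.equivFun.symm.toLinearMap.continuous_of_finiteDimensional

lemma measurable_toTorus : Measurable (toTorus b) := by
  refine measurable_pi_lambda _ fun i => ?_
  refine AddCircle.measurable_mk'.comp ?_
  have : Continuous (fun x => b.equivFun x) := b.equivFun.toLinearMap.continuous_of_finiteDimensional
  exact ((continuous_apply i).comp this).measurable

lemma measurable_ofTorus : Measurable (ofTorus b) :=
  (continuous_equivFun_symm b).measurable.comp
    (measurable_subtype_coe.comp (UnitAddTorus.measurableEquivPiIoc (fun _ => (0 : ℝ))).measurable)

/-- Lattice coordinates are a linear isomorphism, and the image of Lebesgue measure under one is a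
Haar measure, hence proportional to Lebesgue measure. The constant is the only trace left by the
shape of the cell when results are carried over from the torus. -/
lemma map_ofTorus : ∃ c : ℝ≥0, c ≠ 0 ∧
    Measure.map (ofTorus b) volume = c • cellMeasure b := by
  let A : (Fin d → ℝ) ≃L[ℝ] Space d := b.equivFun.symm.toContinuousLinearEquiv
  have hbox : MeasurableSet {x : Fin d → ℝ | ∀ i, x i ∈ Set.Ioc (0:ℝ) (0 + 1)} :=
    MeasurableSet.univ_pi' fun _ => measurableSet_Ioc
  have h1 : Measure.map (Subtype.val ∘ UnitAddTorus.measurableEquivPiIoc (fun _ : Fin d => (0 : ℝ)))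
      (volume : Measure (UnitAddTorus (Fin d)))
      = volume.restrict {x : Fin d → ℝ | ∀ i, x i ∈ Set.Ioc (0:ℝ) (0 + 1)} := by
    rw [← Measure.map_map measurable_subtype_coe (MeasurableEquiv.measurable _),
      (UnitAddTorus.measurePreserving_equivPiIoc (fun _ : Fin d => (0 : ℝ))).map_eq]
    exact map_comap_subtype_coe hbox volume
  -- Torus representatives lie in half-open boxes closed on the right, the cell is closed on the
  -- left; the two boxes differ by a null set.
  have h2 : (volume : Measure (Fin d → ℝ)).restrict {x : Fin d → ℝ | ∀ i, x i ∈ Set.Ioc (0:ℝ) (0 + 1)}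
      = volume.restrict {x : Fin d → ℝ | ∀ i, x i ∈ Set.Ico (0:ℝ) 1} := by
    have e1 : {x : Fin d → ℝ | ∀ i, x i ∈ Set.Ioc (0:ℝ) (0 + 1)} = Set.pi Set.univ fun _ => Set.Ioc 0 1 := by
      ext; simp
    have e2 : {x : Fin d → ℝ | ∀ i, x i ∈ Set.Ico (0:ℝ) 1} = Set.pi Set.univ fun _ => Set.Ico 0 1 := by
      ext; simp
    rw [e1, e2]
    exact Measure.restrict_congr_set
      (Measure.univ_pi_Ioc_ae_eq_Icc.trans Measure.univ_pi_Ico_ae_eq_Icc.symm)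
  have h3 : Measure.map (ofTorus b) volume
      = Measure.map A (volume.restrict {x : Fin d → ℝ | ∀ i, x i ∈ Set.Ico (0:ℝ) 1}) := by
    rw [← h2, ← h1, Measure.map_map A.continuous.measurable
      (measurable_subtype_coe.comp (MeasurableEquiv.measurable _))]
    rfl
  have h4 : A ⁻¹' (cell b) = {x : Fin d → ℝ | ∀ i, x i ∈ Set.Ico (0:ℝ) 1} := by
    ext y
    have : ∀ i, b.repr (A y) i = y i := repr_equivFun_symm b y
    simp [cell, ZSpan.fundamentalDomain, this]
  have hc : MeasurableSet (cell b) := ZSpan.fundamentalDomain_measurableSet b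
  rw [← h4, ← Measure.restrict_map A.continuous.measurable hc] at h3
  have : (Measure.map A (volume : Measure (Fin d → ℝ))).IsAddHaarMeasure :=
    A.isAddHaarMeasure_map volume
  have h5 := Measure.isAddLeftInvariant_eq_smul (Measure.map A (volume : Measure (Fin d → ℝ)))
    (volume : Measure (Space d))
  refine ⟨(Measure.map A (volume : Measure (Fin d → ℝ))).addHaarScalarFactor volume,
    (Measure.addHaarScalarFactor_pos_of_isAddHaarMeasure _ _).ne', ?_⟩
  rw [h3]
  conv_lhs => rw [h5]
  rw [Measure.restrict_smul]
  rfl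

lemma mFourier_neg_ofTorus (n : Fin d → ℤ) (θ : UnitAddTorus (Fin d)) :
    UnitAddTorus.mFourier (-n) θ = Complex.exp (-(phase b n (ofTorus b θ)) * Complex.I) := by
  conv_lhs => rw [← toTorus_ofTorus b θ]
  rw [phase_eq_repr]
  simp only [UnitAddTorus.mFourier, ContinuousMap.coe_mk, toTorus]
  simp only [fourier_coe_apply, Pi.neg_apply]
  rw [← Complex.exp_sum]
  congr 1
  push_cast
  simp only [Finset.mul_sum, Finset.sum_mul, ← Finset.sum_neg_distrib]
  refine Finset.sum_congr rfl fun k _ => by ring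

variable {b} in
lemma integral_comp_ofTorus {c : ℝ≥0}
    (hmap : Measure.map (ofTorus b) volume = c • cellMeasure b)
    {E : Type*} [NormedAddCommGroup E] [NormedSpace ℝ E] {f : Space d → E}
    (hf : AEStronglyMeasurable f (cellMeasure b)) :
    ∫ θ, f (ofTorus b θ) = (c : ℝ) • ∫ x, f x ∂(cellMeasure b) := by
  have hf' : AEStronglyMeasurable f (Measure.map (ofTorus b) volume) := by
    rw [hmap]; exact hf.smul_measure c
  rw [← integral_map (measurable_ofTorus b).aemeasurable hf', hmap]
  exact integral_smul_nnreal_measure f c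

lemma continuous_phase (n : Fin d → ℤ) : Continuous (phase b n) := by
  unfold phase
  fun_prop

lemma fcoef_torus {c : ℝ≥0} (hmap : Measure.map (ofTorus b) volume = c • cellMeasure b)
    {f : Space d → ℂ} (hf : AEStronglyMeasurable f (cellMeasure b)) (n : Fin d → ℤ) :
    UnitAddTorus.mFourierCoeff (f ∘ ofTorus b) n = (c : ℝ) • fcoef b f n := by
  have hcont : Continuous fun x => Complex.exp (-(phase b n x : ℂ) * Complex.I) := by
    have := continuous_phase b n
    fun_prop
  have h := integral_comp_ofTorus hmap (hf.mul hcont.aestronglyMeasurable)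
  simp only [Pi.mul_apply] at h
  rw [fcoef, ← h]
  simp only [UnitAddTorus.mFourierCoeff, mFourier_neg_ofTorus b, Function.comp, smul_eq_mul]
  congr 1
  funext θ
  ring

lemma memLp_comp_ofTorus {c : ℝ≥0} (hmap : Measure.map (ofTorus b) volume = c • cellMeasure b)
    {f : Space d → ℂ} (hf : MemLp f 2 (cellMeasure b)) : MemLp (f ∘ ofTorus b) 2 volume := by
  have : MemLp f 2 (Measure.map (ofTorus b) volume) := by
    rw [hmap]; exact hf.smul_measure (c := (c : ℝ≥0∞)) (by simp)
  exact this.comp_of_map (measurable_ofTorus b).aemeasurable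

/-- Parseval's identity on the periodic cell. -/
theorem exists_parseval : ∃ v : ℝ, 0 < v ∧ ∀ f : Space d → ℂ, MemLp f 2 (cellMeasure b) →
    HasSum (fun n => ‖fcoef b f n‖ ^ 2) (v * ∫ x, ‖f x‖ ^ 2 ∂(cellMeasure b)) := by
  obtain ⟨c, hc, hmap⟩ := map_ofTorus b
  have hc' : (0:ℝ) < c := by positivity
  -- Torus coefficients are `c` times the cell coefficients and the torus integral is `c` times the
  -- cell integral, so Parseval reads c² ∑ = c ∫.
  refine ⟨(c : ℝ)⁻¹, by positivity, fun f hf => ?_⟩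
  have hg := memLp_comp_ofTorus b hmap hf
  have h := UnitAddTorus.hasSum_sq_mFourierCoeff (hg.toLp _)
  have e1 : ∀ n, UnitAddTorus.mFourierCoeff (hg.toLp _) n = (c : ℝ) • fcoef b f n := fun n => by
    rw [← fcoef_torus b hmap hf.1]
    refine integral_congr_ae ?_
    filter_upwards [hg.coeFn_toLp] with θ hθ
    rw [hθ]
  have e2 : ∫ θ, ‖hg.toLp _ θ‖ ^ 2 = (c : ℝ) * ∫ x, ‖f x‖ ^ 2 ∂(cellMeasure b) := by
    have h := integral_comp_ofTorus hmap (hf.1.norm.pow 2)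
    simp only [Pi.pow_apply] at h
    rw [← smul_eq_mul, ← h]
    refine integral_congr_ae ?_
    filter_upwards [hg.coeFn_toLp] with θ hθ
    rw [hθ]; rfl
  simp only [e1, e2, norm_smul, mul_pow] at h
  have hn : ‖(c : ℝ)‖ = c := Real.norm_of_nonneg hc'.le
  rw [hn] at h
  have h' := h.mul_left ((c : ℝ)⁻¹ ^ 2)
  have e3 : ∀ n, (c : ℝ)⁻¹ ^ 2 * ((c : ℝ) ^ 2 * ‖fcoef b f n‖ ^ 2) = ‖fcoef b f n‖ ^ 2 :=
    fun n => by field_simp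
  simp only [e3] at h'
  have e4 : (c : ℝ)⁻¹ ^ 2 * (c * ∫ x, ‖f x‖ ^ 2 ∂cellMeasure b)
      = (c : ℝ)⁻¹ * ∫ x, ‖f x‖ ^ 2 ∂cellMeasure b := by field_simp
  rwa [e4] at h'

/-- Riesz-Fischer: the sequence, rescaled by `c`, gives the coordinates of an L² function in the
Hilbert basis of characters, which is pulled back to the cell by `toTorus`. It is what allows Γ to
be defined on L² fields. -/
theorem exists_fcoef_eq {a : (Fin d → ℤ) → ℂ} (ha : Summable fun n => ‖a n‖ ^ 2) :
    ∃ f : Space d → ℂ, MemLp f 2 (cellMeasure b) ∧ ∀ n, fcoef b f n = a n := by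
  obtain ⟨c, hc, hmap⟩ := map_ofTorus b
  have hc' : (0:ℝ) < c := by positivity
  have hmem : Memℓp (fun n => (c : ℂ) * a n) 2 := by
    rw [memℓp_gen_iff (by simp)]
    simpa [mul_pow] using ha.mul_left ((c : ℝ) ^ 2)
  let g := UnitAddTorus.mFourierBasis.repr.symm ⟨_, hmem⟩
  have hg : ∀ n, UnitAddTorus.mFourierCoeff g n = c * a n := fun n => by
    rw [← UnitAddTorus.mFourierBasis_repr]
    simp [g]
  have hmap2 : MeasurePreserving (toTorus b) (c • cellMeasure b) volume := by
    refine ⟨measurable_toTorus b, ?_⟩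
    rw [← hmap, Measure.map_map (measurable_toTorus b) (measurable_ofTorus b)]
    have : toTorus b ∘ ofTorus b = id := funext (toTorus_ofTorus b)
    rw [this]
    exact Measure.map_id
  have h1 : MemLp (g ∘ toTorus b) 2 (c • cellMeasure b) := (Lp.memLp g).comp_measurePreserving hmap2
  have h2 : MemLp (g ∘ toTorus b) 2 (cellMeasure b) := by
    have := h1.smul_measure (c := ((c⁻¹ : ℝ≥0) : ℝ≥0∞)) (by simp)
    convert this
    change _ = c⁻¹ • c • cellMeasure b
    rw [smul_smul, inv_mul_cancel₀ hc, one_smul]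
  refine ⟨_, h2, fun n => ?_⟩
  have h3 := fcoef_torus b hmap h2.1 n
  have h4 : (g ∘ toTorus b) ∘ ofTorus b = g := by
    funext θ; simp [toTorus_ofTorus]
  rw [h4, hg] at h3
  have hcC : (c : ℂ) ≠ 0 := by exact_mod_cast hc
  have : (c:ℂ) * a n = c * fcoef b (g ∘ toTorus b) n := by rw [h3]; simp
  exact (mul_left_cancel₀ hcC this).symm

/-- Orthogonality of the characters of index `n` and 0. -/
lemma fcoef_const {n : Fin d → ℤ} (hn : n ≠ 0) (z : ℂ) : fcoef b (fun _ => z) n = 0 := by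
  obtain ⟨c, hc, hmap⟩ := map_ofTorus b
  have h := fcoef_torus b hmap (f := fun _ => z) aestronglyMeasurable_const n
  have h0 : UnitAddTorus.mFourierCoeff (d := Fin d) ((fun _ => z) ∘ ofTorus b) n = 0 := by
    simp only [UnitAddTorus.mFourierCoeff, Function.comp, smul_eq_mul, integral_mul_const]
    have := (orthonormal_iff_ite.mp (UnitAddTorus.orthonormal_mFourier (d := Fin d))) n 0
    rw [if_neg hn, ContinuousMap.inner_toLp] at this
    simp only [UnitAddTorus.mFourier_zero, ContinuousMap.one_apply, one_mul,
      ← UnitAddTorus.mFourier_neg] at this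
    rw [this, zero_mul]
  rw [h0] at h
  simpa [hc] using h.symm

end FourierCell

/-! ### Linearity of Fourier coefficients and bounded Fourier multipliers on L². -/

section FourierEstimates

variable {d : ℕ} (b : Module.Basis (Fin d) ℝ (Space d))

instance : IsFiniteMeasure (cellMeasure b) := by
  refine ⟨?_⟩
  rw [cellMeasure, Measure.restrict_apply_univ]
  exact (ZSpan.fundamentalDomain_isBounded b).measure_lt_top

variable {b}

lemma integrable_mul_phase {f : Space d → ℂ} (hf : MemLp f 2 (cellMeasure b)) (n : Fin d → ℤ) :
    Integrable (fun x => f x * Complex.exp (-(phase b n x) * Complex.I)) (cellMeasure b) := by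
  have hcont : Continuous fun x => Complex.exp (-(phase b n x : ℂ) * Complex.I) := by
    have := continuous_phase b n
    fun_prop
  refine (hf.integrable (by norm_num)).mul_bdd (c := 1) hcont.aestronglyMeasurable
    (ae_of_all _ fun x => ?_)
  rw [← Complex.ofReal_neg, Complex.norm_exp_ofReal_mul_I]

lemma fcoef_congr {f g : Space d → ℂ} (h : f =ᵐ[cellMeasure b] g) (n : Fin d → ℤ) :
    fcoef b f n = fcoef b g n := by
  refine integral_congr_ae ?_
  filter_upwards [h] with x hx
  rw [hx]

lemma fcoef_add {f g : Space d → ℂ} (hf : MemLp f 2 (cellMeasure b))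
    (hg : MemLp g 2 (cellMeasure b)) (n : Fin d → ℤ) :
    fcoef b (fun x => f x + g x) n = fcoef b f n + fcoef b g n := by
  simp only [fcoef, add_mul]
  exact integral_add (integrable_mul_phase hf n) (integrable_mul_phase hg n)

lemma fcoef_sub {f g : Space d → ℂ} (hf : MemLp f 2 (cellMeasure b))
    (hg : MemLp g 2 (cellMeasure b)) (n : Fin d → ℤ) :
    fcoef b (fun x => f x - g x) n = fcoef b f n - fcoef b g n := by
  simp only [fcoef, sub_mul]
  exact integral_sub (integrable_mul_phase hf n) (integrable_mul_phase hg n)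

lemma fcoef_const_mul (c : ℂ) (f : Space d → ℂ) (n : Fin d → ℤ) :
    fcoef b (fun x => c * f x) n = c * fcoef b f n := by
  simp only [fcoef, mul_assoc]
  exact integral_const_mul _ _

lemma fcoef_sum {ι : Type*} (s : Finset ι) {f : ι → Space d → ℂ}
    (hf : ∀ i ∈ s, MemLp (f i) 2 (cellMeasure b)) (n : Fin d → ℤ) :
    fcoef b (fun x => ∑ i ∈ s, f i x) n = ∑ i ∈ s, fcoef b (f i) n := by
  simp only [fcoef, Finset.sum_mul]
  exact integral_finsetSum _ fun i hi => integrable_mul_phase (hf i hi) n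

lemma sq_sum_le {κ : Type*} [Fintype κ] (a : κ → ℝ) :
    (∑ k, a k) ^ 2 ≤ Fintype.card κ * ∑ k, a k ^ 2 := by
  simpa using sq_sum_le_card_mul_sum_sq (s := Finset.univ) (f := a)

/-- Parseval on both sides, with Cauchy-Schwarz for the finite sum. Every L² bound on Γ goes through
this frequency-by-frequency comparison. -/
lemma integral_sq_le_of_fcoef_le {κ : Type*} [Fintype κ] {f : Space d → ℂ} {g : κ → Space d → ℂ}
    (hf : MemLp f 2 (cellMeasure b)) (hg : ∀ k, MemLp (g k) 2 (cellMeasure b)) {K : ℝ}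
    (h : ∀ n, ‖fcoef b f n‖ ≤ K * ∑ k, ‖fcoef b (g k) n‖) :
    ∫ x, ‖f x‖ ^ 2 ∂(cellMeasure b)
      ≤ K ^ 2 * Fintype.card κ * ∑ k, ∫ x, ‖g k x‖ ^ 2 ∂(cellMeasure b) := by
  obtain ⟨v, hv, hP⟩ := exists_parseval b
  have h1 := hP f hf
  have h2 : HasSum (fun n => K ^ 2 * Fintype.card κ * ∑ k, ‖fcoef b (g k) n‖ ^ 2)
      (K ^ 2 * Fintype.card κ * ∑ k, v * ∫ x, ‖g k x‖ ^ 2 ∂(cellMeasure b)) :=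
    (hasSum_sum fun k _ => hP (g k) (hg k)).mul_left _
  have h3 := hasSum_le (fun n => ?_) h1 h2
  · rw [← Finset.mul_sum] at h3
    have : v * ∫ x, ‖f x‖ ^ 2 ∂(cellMeasure b)
        ≤ v * (K ^ 2 * Fintype.card κ * ∑ k, ∫ x, ‖g k x‖ ^ 2 ∂(cellMeasure b)) := by
      linarith
    exact le_of_mul_le_mul_left this hv
  · calc ‖fcoef b f n‖ ^ 2 ≤ (K * ∑ k, ‖fcoef b (g k) n‖) ^ 2 := by gcongr; exact h n
      _ = K ^ 2 * (∑ k, ‖fcoef b (g k) n‖) ^ 2 := by ring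
      _ ≤ K ^ 2 * (Fintype.card κ * ∑ k, ‖fcoef b (g k) n‖ ^ 2) := by
          gcongr; exact sq_sum_le _
      _ = _ := by ring

/-- A bounded symbol keeps the coefficients square summable. -/
lemma exists_fcoef_multiplier {κ : Type*} [Fintype κ] {g : κ → Space d → ℂ}
    (hg : ∀ k, MemLp (g k) 2 (cellMeasure b)) {K : ℝ} {A : (Fin d → ℤ) → κ → ℂ}
    (hA : ∀ n k, ‖A n k‖ ≤ K) :
    ∃ f : Space d → ℂ, MemLp f 2 (cellMeasure b) ∧
      ∀ n, fcoef b f n = ∑ k, A n k * fcoef b (g k) n := by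
  refine exists_fcoef_eq b ?_
  obtain ⟨v, hv, hP⟩ := exists_parseval b
  have h2 : Summable (fun n => Fintype.card κ * ∑ k, K ^ 2 * ‖fcoef b (g k) n‖ ^ 2) :=
    (summable_sum fun k _ => (hP (g k) (hg k)).summable.mul_left _).mul_left _
  refine h2.of_nonneg_of_le (fun n => by positivity) fun n => ?_
  calc ‖∑ k, A n k * fcoef b (g k) n‖ ^ 2 ≤ (∑ k, ‖A n k * fcoef b (g k) n‖) ^ 2 := by
        gcongr; exact norm_sum_le _ _
    _ ≤ _ := sq_sum_le _
    _ ≤ _ := by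
        gcongr with k
        rw [norm_mul, mul_pow]
        gcongr
        exact hA n k

end FourierEstimates

/-! ### The Green symbol: contraction with the projectors and inversion of the reference medium. -/

section Green

variable {d : ℕ}

/-- Pairs of indices, labelling the components of second-order tensors. -/
abbrev Idx (d : ℕ) := Fin d × Fin d

/-- The contraction of a fourth-order tensor with a complex second-order one. -/
def contr (A : Tensor4 d) (T : Idx d → ℂ) (p : Idx d) : ℂ :=
  ∑ q : Idx d, (A p.1 p.2 q.1 q.2 : ℂ) * T q

lemma norm_contr_le {A : Tensor4 d} {K : ℝ} (hA : ∀ i j k l, |A i j k l| ≤ K) (T : Idx d → ℂ)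
    (p : Idx d) : ‖contr A T p‖ ≤ K * ∑ q, ‖T q‖ := by
  rw [Finset.mul_sum]
  refine (norm_sum_le _ _).trans (Finset.sum_le_sum fun q _ => ?_)
  rw [norm_mul, Complex.norm_real]
  gcongr
  exact hA _ _ _ _

lemma contr_add (A : Tensor4 d) (S T : Idx d → ℂ) (p : Idx d) :
    contr A (fun q => S q + T q) p = contr A S p + contr A T p := by
  simp [contr, mul_add, Finset.sum_add_distrib]

lemma contr_sub (A : Tensor4 d) (S T : Idx d → ℂ) (p : Idx d) :
    contr A (fun q => S q - T q) p = contr A S p - contr A T p := by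
  simp [contr, mul_sub, Finset.sum_sub_distrib]

lemma contr_const_mul (A : Tensor4 d) (c : ℂ) (T : Idx d → ℂ) (p : Idx d) :
    contr A (fun q => c * T q) p = c * contr A T p := by
  simp only [contr, Finset.mul_sum]
  exact Finset.sum_congr rfl fun q _ => by ring

/-- The symbol of the Green's operator of the reference medium in the direction `ν`. -/
noncomputable def green (κ₀ μ₀ : ℝ) (ν : Fin d → ℝ) : Tensor4 d := fun i j k l =>
  1 / (2 * μ₀) * (ν i * kron j k * ν l + ν j * kron i k * ν l)
    + beta d κ₀ μ₀ * (ν i * ν j * ν k * ν l)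

lemma sum_kron_mul {R : Type*} [Semiring R] [Algebra ℝ R] (i : Fin d) (f : Fin d → R) :
    ∑ j, algebraMap ℝ R (kron i j) * f j = f i := by
  simp [kron, Finset.sum_ite_eq]

lemma abs_kron_le (i j : Fin d) : |(kron i j : ℝ)| ≤ 1 := by
  unfold kron; split_ifs <;> simp

lemma abs_le_one_of_sum_sq_le {ν : Fin d → ℝ} (hν : ∑ i, ν i ^ 2 ≤ 1) (i : Fin d) : |ν i| ≤ 1 := by
  have : ν i ^ 2 ≤ ∑ i, ν i ^ 2 :=
    Finset.single_le_sum (f := fun i => ν i ^ 2) (fun _ _ => sq_nonneg _) (Finset.mem_univ i)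
  exact abs_le_one_iff_mul_self_le_one.mpr (by nlinarith)

lemma abs_green_le {κ₀ μ₀ : ℝ} (hμ₀ : 0 < μ₀) {ν : Fin d → ℝ} (hν : ∑ i, ν i ^ 2 ≤ 1)
    (i j k l : Fin d) : |green κ₀ μ₀ ν i j k l| ≤ 1 / μ₀ + |beta d κ₀ μ₀| := by
  have h := abs_le_one_of_sum_sq_le hν
  have m3 : ∀ a c e : ℝ, |a| ≤ 1 → |c| ≤ 1 → |e| ≤ 1 → |a * c * e| ≤ 1 := fun a c e ha hc he => by
    rw [abs_mul, abs_mul]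
    exact mul_le_one₀ (mul_le_one₀ ha (abs_nonneg _) hc) (abs_nonneg _) he
  have h1 : |ν i * kron j k * ν l + ν j * kron i k * ν l| ≤ 2 :=
    (abs_add_le _ _).trans (by
      linarith [m3 _ _ _ (h i) (abs_kron_le j k) (h l), m3 _ _ _ (h j) (abs_kron_le i k) (h l)])
  have h2 : |ν i * ν j * ν k * ν l| ≤ 1 := by
    rw [abs_mul]
    exact mul_le_one₀ (m3 _ _ _ (h i) (h j) (h k)) (abs_nonneg _) (h l)
  unfold green
  refine (abs_add_le _ _).trans (add_le_add ?_ ?_)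
  · rw [abs_mul, abs_of_pos (by positivity : 0 < 1 / (2 * μ₀))]
    calc 1 / (2 * μ₀) * _ ≤ 1 / (2 * μ₀) * 2 := by gcongr
      _ = 1 / μ₀ := by field_simp
  · rw [abs_mul]
    exact mul_le_of_le_one_right (abs_nonneg _) h2

lemma isoTensor_apply (κ μ : ℝ) (i j k l : Fin d) :
    isoTensor d κ μ i j k l = d * κ * (kron i j * kron k l / d)
      + 2 * μ * ((kron i k * kron j l + kron i l * kron j k) / 2 - kron i j * kron k l / d) := by
  simp [isoTensor, tensorJ, tensorK, tensorI]

lemma qdot_green_tensorJ {κ₀ μ₀ : ℝ} (hμ₀ : μ₀ ≠ 0) {ν : Fin d → ℝ} (hν : ∑ i, ν i ^ 2 = 1) :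
    qdot (green κ₀ μ₀ ν) (tensorJ d) = 1 / d * (4 * alpha μ₀ + beta d κ₀ μ₀) := by
  have e : ∀ i j : Fin d, ∑ k, ∑ l, green κ₀ μ₀ ν i j k l * tensorJ d i j k l
      = (1 / d) * (kron i j * ∑ k, green κ₀ μ₀ ν i j k k) := by
    intro i j
    simp only [tensorJ, Finset.mul_sum]
    refine Finset.sum_congr rfl fun k _ => ?_
    rw [Finset.sum_eq_single k]
    · simp [kron]
      split_ifs <;> ring
    · intro l _ hl; simp [kron, hl.symm]
    · simp
  simp only [qdot, e]
  have e2 : ∀ i : Fin d, ∑ j, (1 / (d:ℝ)) * (kron i j * ∑ k, green κ₀ μ₀ ν i j k k)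
      = 1 / d * ∑ k, green κ₀ μ₀ ν i i k k := by
    intro i
    rw [Finset.sum_eq_single i]
    · simp [kron]
    · intro l _ hl; simp [kron, hl.symm]
    · simp
  simp only [e2]
  have e3 : ∀ i : Fin d, ∑ k, green κ₀ μ₀ ν i i k k = (1 / μ₀ + beta d κ₀ μ₀) * ν i ^ 2 := by
    intro i
    simp only [green, Finset.sum_add_distrib, ← Finset.mul_sum]
    have h1 : ∑ k, ν i * kron i k * ν k = ν i ^ 2 := by simp [kron]; ring
    have h2 : ∑ k, ν i * ν i * ν k * ν k = ν i ^ 2 := by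
      rw [← mul_one (ν i ^ 2), ← hν, Finset.mul_sum]
      exact Finset.sum_congr rfl fun k _ => by ring
    rw [h1, h2]
    field_simp
    ring
  simp only [e3, ← Finset.mul_sum, hν, alpha]
  field_simp

lemma qdot_green_tensorI {κ₀ μ₀ : ℝ} {ν : Fin d → ℝ} (hν : ∑ i, ν i ^ 2 = 1) :
    qdot (green κ₀ μ₀ ν) (tensorI d) = 1 / (2 * μ₀) * (d + 1) + beta d κ₀ μ₀ := by
  have e : ∀ i j : Fin d, ∑ k, ∑ l, green κ₀ μ₀ ν i j k l * tensorI d i j k l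
      = (green κ₀ μ₀ ν i j i j + green κ₀ μ₀ ν i j j i) / 2 := by
    intro i j
    simp only [tensorI, kron, mul_div_assoc', ← Finset.sum_div, mul_add, Finset.sum_add_distrib]
    congr 2
    · rw [Finset.sum_eq_single i, Finset.sum_eq_single j] <;> simp +contextual [eq_comm]
    · rw [Finset.sum_eq_single j, Finset.sum_eq_single i] <;> simp +contextual [eq_comm]
  have e1 : ∀ i j : Fin d, (green κ₀ μ₀ ν i j i j + green κ₀ μ₀ ν i j j i) / 2
      = (1 / (2 * μ₀)) * (kron i j * ν i * ν j) + 1 / (4 * μ₀) * (ν i ^ 2 + ν j ^ 2)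
        + beta d κ₀ μ₀ * (ν i ^ 2 * ν j ^ 2) := by
    intro i j
    have hk : (kron j i : ℝ) = kron i j := by simp [kron, eq_comm]
    have hk1 : ∀ i : Fin d, (kron i i : ℝ) = 1 := by simp [kron]
    simp only [green, hk, hk1]
    field_simp
    ring
  simp only [qdot, e, e1, Finset.sum_add_distrib, ← Finset.mul_sum, hν]
  have h1 : ∑ i : Fin d, ∑ j, kron i j * ν i * ν j = 1 := by
    rw [← hν]
    refine Finset.sum_congr rfl fun i _ => ?_
    simp [kron]; ring
  simp only [h1, Finset.sum_const, Finset.card_univ, Fintype.card_fin, nsmul_eq_mul,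
    ← Finset.mul_sum, ← Finset.sum_mul, hν]
  field_simp
  ring

lemma qdot_sub_right (A B C : Tensor4 d) : qdot A (B - C) = qdot A B - qdot A C := by
  simp [qdot, mul_sub, Finset.sum_sub_distrib]

/-- After contraction the direction enters only through its squared length, so the result is the
same at every nonzero frequency. The symbol is not symmetrized in its last two indices; this is
harmless because J and K are symmetric in them. -/
lemma qdot_green {κ₀ μ₀ : ℝ} (hd : d ≠ 0) (hμ₀ : μ₀ ≠ 0) (P : Proj) {ν : Fin d → ℝ}
    (hν : ∑ i, ν i ^ 2 = 1) : qdot (green κ₀ μ₀ ν) (P.tensor d) = P.lam d κ₀ μ₀ := by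
  cases P
  · exact qdot_green_tensorJ hμ₀ hν
  · simp only [Proj.tensor, tensorK, qdot_sub_right, qdot_green_tensorJ hμ₀ hν,
      qdot_green_tensorI hν, Proj.lam, alpha]
    have : (d:ℝ) ≠ 0 := by exact_mod_cast hd
    field_simp
    ring

lemma lam_pos {κ₀ μ₀ : ℝ} (hd : 2 ≤ d) (hκ₀ : 0 < κ₀) (hμ₀ : 0 < μ₀) (P : Proj) :
    0 < P.lam d κ₀ μ₀ := by
  have h2 : (2:ℝ) ≤ d := by exact_mod_cast hd
  have h1 : (0:ℝ) < d - 1 := by linarith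
  have h0 : (0:ℝ) < d := by linarith
  have hD : 0 < d * κ₀ + 2 * (d - 1) * μ₀ := by positivity
  cases P
  · have : Proj.lam d κ₀ μ₀ .J = 1 / (d * κ₀ + 2 * (d - 1) * μ₀) := by
      simp only [Proj.lam, alpha, beta]
      field_simp
      ring
    rw [this]; positivity
  · have : Proj.lam d κ₀ μ₀ .K
        = d * (d - 1) * (κ₀ + 2 * μ₀) / (2 * μ₀ * (d * κ₀ + 2 * (d - 1) * μ₀)) := by
      simp only [Proj.lam, alpha, beta]
      field_simp
      ring
    rw [this]; positivity

/-- Inversion of the symbol of the reference elasticity operator. -/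
lemma eq_neg_contr_green {κ₀ μ₀ : ℝ} (hd : 2 ≤ d) (hκ₀ : 0 < κ₀) (hμ₀ : 0 < μ₀) {ν : Fin d → ℝ}
    (hν : ∑ i, ν i ^ 2 = 1) {w : Fin d → ℂ} {e T : Idx d → ℂ}
    (he : ∀ i j, e (i, j) = (ν j * w i + ν i * w j) / 2)
    (h : ∀ i, ∑ j, ν j * (contr (isoTensor d κ₀ μ₀) e (i, j) + T (i, j)) = 0) (p : Idx d) :
    e p = -contr (green κ₀ μ₀ ν) T p := by
  have h2 : (2:ℝ) ≤ d := by exact_mod_cast hd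
  have h1 : (0:ℝ) < d - 1 := by linarith
  have h0 : (0:ℝ) < d := by linarith
  have hD : 0 < d * κ₀ + 2 * (d - 1) * μ₀ := by positivity
  have hνC : ∑ i, (ν i : ℂ) * ν i = 1 := by
    have := congrArg (Complex.ofReal) hν
    simpa [pow_two] using this
  set s : ℂ := ∑ i, ν i * w i with hs
  set t : Fin d → ℂ := fun i => ∑ j, ν j * T (i, j) with ht
  set r : ℂ := ∑ i, ν i * t i with hr
  have htr : ∑ k, e (k, k) = s := by
    refine Finset.sum_congr rfl fun k _ => ?_
    rw [he]; ring
  -- On symmetric `e` the reference stress is (κ₀ - 2μ₀/d) tr(e) I + 2μ₀ e, and tr(e) = ν · w = `s`.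
  have hiso : ∀ i j, contr (isoTensor d κ₀ μ₀) e (i, j)
      = ((κ₀ - 2 * μ₀ / d : ℝ) : ℂ) * (kron i j : ℝ) * s + 2 * μ₀ * e (i, j) := by
    intro i j
    have hsymm : e (j, i) = e (i, j) := by rw [he, he]; ring
    have key : ∀ k l : Fin d, ((isoTensor d κ₀ μ₀ i j k l : ℝ) : ℂ) * e (k, l)
        = ((κ₀ - 2 * μ₀ / d : ℝ) : ℂ) * (kron i j : ℝ) * ((kron k l : ℝ) * e (k, l))
          + μ₀ * ((kron i k : ℝ) * ((kron j l : ℝ) * e (k, l)))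
          + μ₀ * ((kron j k : ℝ) * ((kron i l : ℝ) * e (k, l))) := by
      intro k l
      rw [isoTensor_apply]
      push_cast
      have : (d : ℂ) ≠ 0 := by exact_mod_cast h0.ne'
      field_simp
      ring
    simp only [contr, Fintype.sum_prod_type, key, Finset.sum_add_distrib, ← Finset.mul_sum]
    have k1 := fun (i : Fin d) (f : Fin d → ℂ) => sum_kron_mul (R := ℂ) i f
    simp only [Complex.coe_algebraMap] at k1
    simp only [k1, htr, hsymm]
    ring
  have hw : ∀ i, ((κ₀ - 2 * μ₀ / d : ℝ) : ℂ) * ν i * s + μ₀ * (w i + ν i * s) + t i = 0 := by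
    intro i
    rw [← h i]
    have k1 := sum_kron_mul (R := ℂ) i (fun j => (ν j : ℂ))
    simp only [Complex.coe_algebraMap] at k1
    simp only [hiso, he, mul_add, Finset.sum_add_distrib]
    have e1 : ∑ j, (ν j : ℂ) * (((κ₀ - 2 * μ₀ / d : ℝ) : ℂ) * (kron i j : ℝ) * s)
        = ((κ₀ - 2 * μ₀ / d : ℝ) : ℂ) * ν i * s := by
      calc _ = ∑ j, ((κ₀ - 2 * μ₀ / d : ℝ) : ℂ) * s * ((kron i j : ℝ) * ν j) :=
            Finset.sum_congr rfl fun j _ => by ring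
        _ = _ := by rw [← Finset.mul_sum, k1]; ring
    have e2 : ∑ j, (ν j : ℂ) * (2 * μ₀ * ((ν j * w i + ν i * w j) / 2))
        = μ₀ * w i + μ₀ * (ν i * s) := by
      calc _ = ∑ j, (μ₀ * w i * (ν j * ν j) + μ₀ * ν i * (ν j * w j)) :=
            Finset.sum_congr rfl fun j _ => by ring
        _ = _ := by
            rw [Finset.sum_add_distrib, ← Finset.mul_sum, ← Finset.mul_sum, hνC, ← hs]; ring
    rw [e1, e2]
  -- Contracting the vector equation `hw` with ν leaves one scalar equation for `s`. It is solved
  -- first and substituted back into `hw` to obtain `w`.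
  have hws : ((κ₀ - 2 * μ₀ / d : ℝ) : ℂ) * s + 2 * μ₀ * s + r = 0 := by
    have := congrArg (fun f : Fin d → ℂ => ∑ i, ν i * f i) (funext hw)
    simp only [mul_zero, Finset.sum_const_zero] at this
    rw [← this]
    calc _ = ((κ₀ - 2 * μ₀ / d : ℝ) : ℂ) * s * 1 + μ₀ * s + μ₀ * s * 1 + r := by ring
      _ = ∑ i, (((κ₀ - 2 * μ₀ / d : ℝ) : ℂ) * s * (ν i * ν i) + μ₀ * (ν i * w i)
          + μ₀ * s * (ν i * ν i) + ν i * t i) := by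
          simp only [Finset.sum_add_distrib, ← Finset.mul_sum, hνC, ← hs, ← hr]
      _ = _ := Finset.sum_congr rfl fun i _ => by ring
  have hdC : (d : ℂ) ≠ 0 := by exact_mod_cast h0.ne'
  have hμC : (μ₀ : ℂ) ≠ 0 := by exact_mod_cast hμ₀.ne'
  have hDC : (d * κ₀ + 2 * (d - 1) * μ₀ : ℂ) ≠ 0 := by exact_mod_cast hD.ne'
  have hsr : s = -(d * r) / (d * κ₀ + 2 * (d - 1) * μ₀) := by
    rw [eq_div_iff hDC]
    push_cast at hws
    field_simp at hws
    linear_combination hws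
  have hwi : ∀ i, w i = -(1 / μ₀) * t i - (beta d κ₀ μ₀ : ℝ) * ν i * r := by
    intro i
    have := hw i
    have hwi' : w i = -(1 / μ₀) * (t i + (((κ₀ - 2 * μ₀ / d : ℝ) : ℂ) + μ₀) * ν i * s) := by
      rw [eq_comm, neg_mul, neg_eq_iff_eq_neg, one_div, inv_mul_eq_iff_eq_mul₀ hμC]
      linear_combination this
    rw [hwi', hsr, beta]
    push_cast
    field_simp
    ring
  obtain ⟨i, j⟩ := p
  have hg : contr (green κ₀ μ₀ ν) T (i, j)
      = 1 / (2 * μ₀) * (ν i * t j + ν j * t i) + (beta d κ₀ μ₀ : ℝ) * (ν i * ν j * r) := by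
    have key : ∀ k l : Fin d, ((green κ₀ μ₀ ν i j k l : ℝ) : ℂ) * T (k, l)
        = 1 / (2 * μ₀) * ν i * ((kron j k : ℝ) * (ν l * T (k, l)))
          + 1 / (2 * μ₀) * ν j * ((kron i k : ℝ) * (ν l * T (k, l)))
          + (beta d κ₀ μ₀ : ℝ) * (ν i * ν j) * (ν k * (ν l * T (k, l))) := by
      intro k l
      simp only [green]
      push_cast
      ring
    simp only [contr, Fintype.sum_prod_type, key, Finset.sum_add_distrib, ← Finset.mul_sum]
    have k1 := fun (i : Fin d) (f : Fin d → ℂ) => sum_kron_mul (R := ℂ) i f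
    simp only [Complex.coe_algebraMap] at k1
    simp only [k1]
    change _ * t j + _ * t i + _ * (∑ k, ν k * t k) = _
    rw [← hr]; ring
  rw [he, hg, hwi i, hwi j]
  field_simp
  ring

end Green

/-! ### The Green operator on L² tensor fields and its energy bound. -/

section GreenOperator

variable {d : ℕ} (b : Module.Basis (Fin d) ℝ (Space d))

/-- The direction of the wave vector of index `n` (zero for `n = 0`). -/
noncomputable def dir (n : Fin d → ℤ) (j : Fin d) : ℝ :=
  wave b n j / Real.sqrt (∑ i, wave b n i ^ 2)

variable {b}

lemma sum_wave_sq_pos {n : Fin d → ℤ} (hn : n ≠ 0) : 0 < ∑ i, wave b n i ^ 2 := by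
  obtain ⟨i, hi⟩ := Function.ne_iff.mp (wave_ne_zero b hn)
  exact Finset.sum_pos' (fun _ _ => sq_nonneg _) ⟨i, Finset.mem_univ _, by
    have : wave b n i ≠ 0 := hi
    positivity⟩

lemma sum_dir_sq {n : Fin d → ℤ} (hn : n ≠ 0) : ∑ i, dir b n i ^ 2 = 1 := by
  have h := sum_wave_sq_pos (b := b) hn
  simp only [dir, div_pow, Real.sq_sqrt h.le, ← Finset.sum_div]
  exact div_self h.ne'

lemma wave_zero : wave b 0 = 0 := by
  funext j; simp [wave]

lemma dir_zero : dir b 0 = 0 := by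
  funext j; simp [dir, wave_zero]

lemma sum_dir_sq_le (n : Fin d → ℤ) : ∑ i, dir b n i ^ 2 ≤ 1 := by
  by_cases hn : n = 0
  · simp [hn, dir_zero]
  · exact (sum_dir_sq hn).le

/-- Division by zero makes `dir b 0` vanish, so the zero frequency needs no separate clause in
`IsGreenImage`: a Green image automatically has zero mean. -/
lemma contr_green_zero (κ₀ μ₀ : ℝ) (T : Idx d → ℂ) (p : Idx d) :
    contr (green κ₀ μ₀ (0 : Fin d → ℝ)) T p = 0 := by
  simp [contr, green]

variable (b) in
/-- The strain field `e` is the image of the polarization `τ` under the opposite of the periodic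
Green's operator of the reference medium. -/
def IsGreenImage (κ₀ μ₀ : ℝ) (e τ : Idx d → Space d → ℂ) : Prop :=
  ∀ n p, fcoef b (e p) n = -contr (green κ₀ μ₀ (dir b n)) (fun q => fcoef b (τ q) n) p

variable (b) in
/-- The squared `L²` norm of a tensor field. -/
noncomputable def energy (f : Idx d → Space d → ℂ) : ℝ := ∑ p, ∫ x, ‖f p x‖ ^ 2 ∂(cellMeasure b)

lemma energy_nonneg (f : Idx d → Space d → ℂ) : 0 ≤ energy b f :=
  Finset.sum_nonneg fun _ _ => integral_nonneg fun _ => by positivity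

/-- A bound for the components of the symbol of the Green's operator. -/
noncomputable def greenBound (d : ℕ) (κ₀ μ₀ : ℝ) : ℝ := 1 / μ₀ + |beta d κ₀ μ₀|

/-- A bound for the squared norm of the Green's operator. -/
noncomputable def greenConst (d : ℕ) (κ₀ μ₀ : ℝ) : ℝ :=
  greenBound d κ₀ μ₀ ^ 2 * Fintype.card (Idx d) * Fintype.card (Idx d)

lemma greenConst_nonneg (κ₀ μ₀ : ℝ) : 0 ≤ greenConst d κ₀ μ₀ := by
  unfold greenConst; positivity

lemma norm_contr_green_le {κ₀ μ₀ : ℝ} (hμ₀ : 0 < μ₀) (n : Fin d → ℤ) (T : Idx d → ℂ) (p : Idx d) :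
    ‖contr (green κ₀ μ₀ (dir b n)) T p‖ ≤ greenBound d κ₀ μ₀ * ∑ q, ‖T q‖ :=
  norm_contr_le (abs_green_le hμ₀ (sum_dir_sq_le n)) T p

/-- The symbol depends only on the direction of the wave vector, so its components are bounded
uniformly in the frequency and Γ is bounded on L². -/
lemma IsGreenImage.energy_le {κ₀ μ₀ : ℝ} (hμ₀ : 0 < μ₀) {e τ : Idx d → Space d → ℂ}
    (h : IsGreenImage b κ₀ μ₀ e τ) (he : ∀ p, MemLp (e p) 2 (cellMeasure b))
    (hτ : ∀ p, MemLp (τ p) 2 (cellMeasure b)) :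
    energy b e ≤ greenConst d κ₀ μ₀ * energy b τ := by
  have hp : ∀ p, ∫ x, ‖e p x‖ ^ 2 ∂(cellMeasure b)
      ≤ greenBound d κ₀ μ₀ ^ 2 * Fintype.card (Idx d) * energy b τ := fun p =>
    integral_sq_le_of_fcoef_le (he p) hτ fun n => by
      rw [h n p, norm_neg]
      exact norm_contr_green_le hμ₀ n _ p
  refine (Finset.sum_le_sum fun p _ => hp p).trans ?_
  rw [Finset.sum_const, Finset.card_univ, nsmul_eq_mul, greenConst]
  exact le_of_eq (by ring)

lemma exists_isGreenImage {κ₀ μ₀ : ℝ} (hμ₀ : 0 < μ₀) {τ : Idx d → Space d → ℂ}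
    (hτ : ∀ p, MemLp (τ p) 2 (cellMeasure b)) :
    ∃ e : Idx d → Space d → ℂ, (∀ p, MemLp (e p) 2 (cellMeasure b)) ∧
      IsGreenImage b κ₀ μ₀ e τ := by
  have : ∀ p, ∃ f : Space d → ℂ, MemLp f 2 (cellMeasure b) ∧
      ∀ n, fcoef b f n = -contr (green κ₀ μ₀ (dir b n)) (fun q => fcoef b (τ q) n) p := by
    intro p
    obtain ⟨f, hf, hf'⟩ := exists_fcoef_multiplier (b := b) hτ (K := greenBound d κ₀ μ₀)
      (A := fun n q => ((-green κ₀ μ₀ (dir b n) p.1 p.2 q.1 q.2 : ℝ) : ℂ)) fun n q => by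
        rw [Complex.norm_real, norm_neg]
        exact abs_green_le hμ₀ (sum_dir_sq_le n) _ _ _ _
    refine ⟨f, hf, fun n => ?_⟩
    rw [hf' n]
    simp [contr]
  choose e he he' using this
  exact ⟨e, he, fun n p => he' p n⟩

lemma IsGreenImage.sub {κ₀ μ₀ : ℝ} {e e' τ τ' : Idx d → Space d → ℂ}
    (h : IsGreenImage b κ₀ μ₀ e τ) (h' : IsGreenImage b κ₀ μ₀ e' τ')
    (he : ∀ p, MemLp (e p) 2 (cellMeasure b)) (he' : ∀ p, MemLp (e' p) 2 (cellMeasure b))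
    (hτ : ∀ p, MemLp (τ p) 2 (cellMeasure b)) (hτ' : ∀ p, MemLp (τ' p) 2 (cellMeasure b)) :
    IsGreenImage b κ₀ μ₀ (fun p x => e p x - e' p x) (fun p x => τ p x - τ' p x) := by
  intro n p
  simp only [fcoef_sub (he p) (he' p), fun q => fcoef_sub (hτ q) (hτ' q) n, contr_sub, h n p,
    h' n p]
  ring

lemma IsGreenImage.const_mul {κ₀ μ₀ : ℝ} {e τ : Idx d → Space d → ℂ}
    (h : IsGreenImage b κ₀ μ₀ e τ) (c : ℂ) :
    IsGreenImage b κ₀ μ₀ (fun p x => c * e p x) (fun p x => c * τ p x) := by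
  intro n p
  simp only [fcoef_const_mul, contr_const_mul, h n p]
  ring

/-- The field `A(x) : f(x)`. -/
noncomputable def mulField (A : Space d → Tensor4 d) (f : Idx d → Space d → ℂ) (p : Idx d)
    (x : Space d) : ℂ :=
  contr (A x) (fun q => f q x) p

variable (b) in
/-- Measurable fourth-order tensor fields with components bounded by `m`. -/
structure IsBoundedTensor (A : Space d → Tensor4 d) (m : ℝ) : Prop where
  meas : ∀ i j k l, AEStronglyMeasurable (fun x => A x i j k l) (cellMeasure b)
  bound : ∀ᵐ x ∂(cellMeasure b), ∀ i j k l, |A x i j k l| ≤ m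

lemma IsBoundedTensor.memLp {A : Space d → Tensor4 d} {m : ℝ} (hA : IsBoundedTensor b A m)
    {f : Idx d → Space d → ℂ} (hf : ∀ p, MemLp (f p) 2 (cellMeasure b)) (p : Idx d) :
    MemLp (mulField A f p) 2 (cellMeasure b) := by
  unfold mulField contr
  refine memLp_finsetSum _ fun q _ => ?_
  refine (hf q).of_le_mul (c := m) ?_ ?_
  · exact (Complex.continuous_ofReal.comp_aestronglyMeasurable (hA.meas _ _ _ _)).mul (hf q).1
  · filter_upwards [hA.bound] with x hx
    rw [norm_mul, Complex.norm_real]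
    gcongr
    exact hx _ _ _ _

lemma integrable_sq {f : Space d → ℂ} (hf : MemLp f 2 (cellMeasure b)) :
    Integrable (fun x => ‖f x‖ ^ 2) (cellMeasure b) :=
  (memLp_two_iff_integrable_sq_norm hf.1).mp hf

lemma energy_eq_integral {f : Idx d → Space d → ℂ} (hf : ∀ p, MemLp (f p) 2 (cellMeasure b)) :
    energy b f = ∫ x, ∑ p, ‖f p x‖ ^ 2 ∂(cellMeasure b) :=
  (integral_finsetSum _ fun p _ => integrable_sq (hf p)).symm

lemma IsBoundedTensor.energy_le {A : Space d → Tensor4 d} {m : ℝ} (hA : IsBoundedTensor b A m)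
    {f : Idx d → Space d → ℂ} (hf : ∀ p, MemLp (f p) 2 (cellMeasure b)) :
    energy b (mulField A f) ≤ m ^ 2 * Fintype.card (Idx d) ^ 2 * energy b f := by
  have hp : ∀ p, ∫ x, ‖mulField A f p x‖ ^ 2 ∂(cellMeasure b)
      ≤ m ^ 2 * Fintype.card (Idx d) * energy b f := fun p => by
    rw [energy_eq_integral hf, ← integral_const_mul]
    refine integral_mono_ae (integrable_sq (hA.memLp hf p))
      ((integrable_finsetSum _ fun q _ => integrable_sq (hf q)).const_mul _) ?_
    filter_upwards [hA.bound] with x hx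
    calc ‖mulField A f p x‖ ^ 2 ≤ (m * ∑ q, ‖f q x‖) ^ 2 := by
          gcongr; exact norm_contr_le hx _ p
      _ = m ^ 2 * (∑ q, ‖f q x‖) ^ 2 := by ring
      _ ≤ m ^ 2 * (Fintype.card (Idx d) * ∑ q, ‖f q x‖ ^ 2) := by gcongr; exact sq_sum_le _
      _ = _ := by ring
  refine (Finset.sum_le_sum fun p _ => hp p).trans ?_
  rw [Finset.sum_const, Finset.card_univ, nsmul_eq_mul]
  exact le_of_eq (by ring)

lemma fcoef_contr (A : Tensor4 d) {f : Idx d → Space d → ℂ}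
    (hf : ∀ p, MemLp (f p) 2 (cellMeasure b)) (n : Fin d → ℤ) (p : Idx d) :
    fcoef b (fun x => contr A (fun q => f q x) p) n = contr A (fun q => fcoef b (f q) n) p := by
  unfold contr
  rw [fcoef_sum _ fun q _ => (hf q).const_mul _]
  simp only [fcoef_const_mul]

lemma memLp_contr (A : Tensor4 d) {f : Idx d → Space d → ℂ}
    (hf : ∀ p, MemLp (f p) 2 (cellMeasure b)) (p : Idx d) :
    MemLp (fun x => contr A (fun q => f q x) p) 2 (cellMeasure b) :=
  memLp_finsetSum _ fun q _ => (hf q).const_mul _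

end GreenOperator

/-! ### Bounds on δL by the contrast. -/

section Contrast

variable {d : ℕ} {b : Module.Basis (Fin d) ℝ (Space d)} {κ₀ μ₀ : ℝ} {κ μ : Space d → ℝ}

lemma IsModuliField.memLp_max (h : IsModuliField b κ μ) :
    MemLp (fun x => max |d * (κ x - κ₀)| |2 * (μ x - μ₀)|) ∞ (cellMeasure b) := by
  have h1 : MemLp (fun x => d * (κ x - κ₀)) ∞ (cellMeasure b) :=
    (h.memLp_bulk.sub (memLp_const κ₀)).const_mul _
  have h2 : MemLp (fun x => 2 * (μ x - μ₀)) ∞ (cellMeasure b) :=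
    (h.memLp_shear.sub (memLp_const μ₀)).const_mul _
  exact h1.abs.sup h2.abs

lemma contrast_nonneg : 0 ≤ contrast b κ₀ μ₀ κ μ := ENNReal.toReal_nonneg

lemma IsModuliField.ae_le_contrast (h : IsModuliField b κ μ) :
    ∀ᵐ x ∂(cellMeasure b), max |d * (κ x - κ₀)| |2 * (μ x - μ₀)| ≤ contrast b κ₀ μ₀ κ μ := by
  have hm := h.memLp_max (κ₀ := κ₀) (μ₀ := μ₀)
  filter_upwards [ae_le_eLpNormEssSup (μ := cellMeasure b)
    (f := fun x => max |d * (κ x - κ₀)| |2 * (μ x - μ₀)|)] with x hx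
  rw [← eLpNorm_exponent_top] at hx
  have := (ENNReal.toReal_le_toReal (by simp) hm.2.ne).mpr hx
  rw [toReal_enorm, Real.norm_of_nonneg (le_max_of_le_left (abs_nonneg _))] at this
  exact this

lemma abs_tensorJ_le (hd : 2 ≤ d) (i j k l : Fin d) : |tensorJ d i j k l| ≤ 1 := by
  have h2 : (1:ℝ) ≤ d := by exact_mod_cast (by omega : 1 ≤ d)
  simp only [tensorJ, abs_div, abs_mul, Nat.abs_cast]
  exact div_le_one_of_le₀ ((mul_le_one₀ (abs_kron_le i j) (abs_nonneg _) (abs_kron_le k l)).trans h2)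
    (by positivity)

lemma abs_tensorK_le (hd : 2 ≤ d) (i j k l : Fin d) : |tensorK d i j k l| ≤ 2 := by
  have h1 : |tensorI d i j k l| ≤ 1 := by
    simp only [tensorI, kron]
    split_ifs <;> norm_num
  have h2 := abs_tensorJ_le hd i j k l
  calc |tensorK d i j k l| ≤ |tensorI d i j k l| + |tensorJ d i j k l| := abs_sub _ _
    _ ≤ 2 := by linarith

lemma deltaL_apply (x : Space d) (i j k l : Fin d) : deltaL κ₀ μ₀ κ μ x i j k l
    = d * (κ x - κ₀) * tensorJ d i j k l + 2 * (μ x - μ₀) * tensorK d i j k l := by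
  simp [deltaL, isoTensor]
  ring

/-- The factor 3 is 1 + 2, from the bounds on the components of J and K. -/
lemma IsModuliField.isBoundedTensor (hd : 2 ≤ d) (h : IsModuliField b κ μ) :
    IsBoundedTensor b (deltaL κ₀ μ₀ κ μ) (3 * contrast b κ₀ μ₀ κ μ) := by
  refine ⟨fun i j k l => ?_, ?_⟩
  · simp only [deltaL_apply]
    exact (((h.memLp_bulk.1.sub aestronglyMeasurable_const).const_mul _).mul_const _).add
      (((h.memLp_shear.1.sub aestronglyMeasurable_const).const_mul _).mul_const _)
  · filter_upwards [h.ae_le_contrast (κ₀ := κ₀) (μ₀ := μ₀)] with x hx i j k l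
    rw [deltaL_apply]
    obtain ⟨h1, h2⟩ := max_le_iff.mp hx
    refine (abs_add_le _ _).trans ?_
    rw [abs_mul, abs_mul (2 * (μ x - μ₀))]
    nlinarith [abs_tensorJ_le hd i j k l, abs_tensorK_le hd i j k l, abs_nonneg (d * (κ x - κ₀)),
      abs_nonneg (2 * (μ x - μ₀)), abs_nonneg (tensorJ d i j k l), abs_nonneg (tensorK d i j k l)]

end Contrast

/-! ### From weak equilibrium to the Lippmann-Schwinger equation. -/

section StrainSolution

variable {d : ℕ} {b : Module.Basis (Fin d) ℝ (Space d)}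

lemma phase_add_basis (n : Fin d → ℤ) (x : Space d) (i : Fin d) :
    phase b n (x + b i) = phase b n x + n i * (2 * Real.pi) := by
  simp only [phase_eq_repr, map_add, Finsupp.add_apply, Module.Basis.repr_self, mul_add,
    Finset.sum_add_distrib, Finsupp.single_apply]
  simp
  ring

lemma hasFDerivAt_phase (n : Fin d → ℤ) (x : Space d) :
    HasFDerivAt (phase b n)
      (∑ j, wave b n j • (EuclideanSpace.proj j : Space d →L[ℝ] ℝ)) x := by
  have : phase b n = fun x => (∑ j, wave b n j • (EuclideanSpace.proj j : Space d →L[ℝ] ℝ)) x := by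
    funext y
    simp [phase]
  rw [this]
  exact ContinuousLinearMap.hasFDerivAt _

lemma contDiff_phase (n : Fin d → ℤ) : ContDiff ℝ ∞ (phase b n) := by
  have : phase b n = fun x => (∑ j, wave b n j • (EuclideanSpace.proj j : Space d →L[ℝ] ℝ)) x := by
    funext y
    simp [phase]
  rw [this]
  exact ContinuousLinearMap.contDiff _

lemma isTest_cos (n : Fin d → ℤ) : IsTest b fun x => Real.cos (phase b n x) :=
  ⟨Real.contDiff_cos.comp (contDiff_phase n), fun x i => by
    simp only [phase_add_basis, Real.cos_add_int_mul_two_pi]⟩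

lemma isTest_sin (n : Fin d → ℤ) : IsTest b fun x => Real.sin (phase b n x) :=
  ⟨Real.contDiff_sin.comp (contDiff_phase n), fun x i => by
    simp only [phase_add_basis, Real.sin_add_int_mul_two_pi]⟩

lemma partialD_cos (n : Fin d → ℤ) (j : Fin d) (x : Space d) :
    partialD j (fun x => Real.cos (phase b n x)) x = -(wave b n j * Real.sin (phase b n x)) := by
  rw [partialD, ((hasFDerivAt_phase n x).cos).fderiv]
  simp
  ring

lemma partialD_sin (n : Fin d → ℤ) (j : Fin d) (x : Space d) :
    partialD j (fun x => Real.sin (phase b n x)) x = wave b n j * Real.cos (phase b n x) := by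
  rw [partialD, ((hasFDerivAt_phase n x).sin).fderiv]
  simp
  ring

lemma integrable_mul_cos {f : Space d → ℝ} (hf : MemLp f 2 (cellMeasure b)) (n : Fin d → ℤ) :
    Integrable (fun x => f x * Real.cos (phase b n x)) (cellMeasure b) :=
  (hf.integrable (by norm_num)).mul_bdd (c := 1)
    (Real.continuous_cos.comp (continuous_phase b n)).aestronglyMeasurable
    (ae_of_all _ fun _ => Real.abs_cos_le_one _)

lemma integrable_mul_sin {f : Space d → ℝ} (hf : MemLp f 2 (cellMeasure b)) (n : Fin d → ℤ) :
    Integrable (fun x => f x * Real.sin (phase b n x)) (cellMeasure b) :=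
  (hf.integrable (by norm_num)).mul_bdd (c := 1)
    (Real.continuous_sin.comp (continuous_phase b n)).aestronglyMeasurable
    (ae_of_all _ fun _ => Real.abs_sin_le_one _)

lemma fcoef_ofReal {f : Space d → ℝ} (hf : MemLp f 2 (cellMeasure b)) (n : Fin d → ℤ) :
    fcoef b (fun x => (f x : ℂ)) n
      = ((∫ x, f x * Real.cos (phase b n x) ∂(cellMeasure b) : ℝ) : ℂ)
        - Complex.I * ((∫ x, f x * Real.sin (phase b n x) ∂(cellMeasure b) : ℝ) : ℂ) := by
  rw [← integral_complex_ofReal, ← integral_complex_ofReal, ← integral_const_mul,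
    ← integral_sub ((integrable_mul_cos hf n).ofReal) ((integrable_mul_sin hf n).ofReal.const_mul _)]
  refine integral_congr_ae (ae_of_all _ fun x => ?_)
  simp only
  rw [← Complex.ofReal_neg, Complex.exp_mul_I, ← Complex.ofReal_cos, ← Complex.ofReal_sin,
    Real.cos_neg, Real.sin_neg]
  push_cast
  ring

lemma memLp_ofReal {f : Space d → ℝ} (hf : MemLp f 2 (cellMeasure b)) :
    MemLp (fun x => (f x : ℂ)) 2 (cellMeasure b) := hf.ofReal

/-- Test functions are real, so the exponential is replaced by its cosine and sine, and the two weak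
identities are recombined. -/
lemma IsWeakGradient.fcoef_eq {u : Space d → Fin d → ℝ} {G : Space d → Tensor2 d}
    (h : IsWeakGradient b u G) (n : Fin d → ℤ) (i j : Fin d) :
    fcoef b (fun x => (G x i j : ℂ)) n
      = Complex.I * wave b n j * fcoef b (fun x => (u x i : ℂ)) n := by
  rw [fcoef_ofReal (h.memLp i), fcoef_ofReal (h.memLp_grad i j)]
  have h1 := h.weak i j _ (isTest_cos n)
  have h2 := h.weak i j _ (isTest_sin n)
  simp only [partialD_cos, partialD_sin] at h1 h2
  have e1 : ∀ x, u x i * -(wave b n j * Real.sin (phase b n x))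
      = -wave b n j * (u x i * Real.sin (phase b n x)) := fun x => by ring
  have e2 : ∀ x, u x i * (wave b n j * Real.cos (phase b n x))
      = wave b n j * (u x i * Real.cos (phase b n x)) := fun x => by ring
  simp only [e1, e2, integral_const_mul] at h1 h2
  have h1' := congrArg Complex.ofReal h1
  have h2' := congrArg Complex.ofReal h2
  push_cast at h1' h2' ⊢
  linear_combination h1' - Complex.I * h2' +
    (wave b n j : ℂ) * ((∫ x, u x i * Real.sin (phase b n x) ∂(cellMeasure b) : ℝ) : ℂ) * Complex.I_sq

/-- A strain field as a complex field. -/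
def strainField (ε : Space d → Tensor2 d) (p : Idx d) (x : Space d) : ℂ := (ε x p.1 p.2 : ℂ)

/-- The fluctuation of a strain field. -/
def fluctField (E : Tensor2 d) (ε : Space d → Tensor2 d) (p : Idx d) (x : Space d) : ℂ :=
  ((ε x p.1 p.2 - E p.1 p.2 : ℝ) : ℂ)

variable {κ₀ μ₀ : ℝ} {κ μ : Space d → ℝ} {E : Tensor2 d} {ε : Space d → Tensor2 d}

lemma IsStrainSolution.memLp (h : IsStrainSolution b κ μ E ε) (i j : Fin d) :
    MemLp (fun x => ε x i j) 2 (cellMeasure b) := by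
  obtain ⟨u, G, hG, hε⟩ := h.2.1
  have h1 : MemLp (fun x => (1 / 2 : ℝ) * (G x i j + G x j i)) 2 (cellMeasure b) :=
    ((hG.memLp_grad i j).add (hG.memLp_grad j i)).const_mul _
  have h2 : MemLp (fun x => E i j + (1 / 2 : ℝ) * (G x i j + G x j i)) 2 (cellMeasure b) :=
    (memLp_const (E i j)).add h1
  refine (memLp_congr_ae ?_).mpr h2
  filter_upwards [hε] with x hx
  rw [hx]
  simp only [Matrix.add_apply, Matrix.smul_apply, Matrix.transpose_apply, smul_eq_mul]

lemma IsStrainSolution.memLp_strainField (h : IsStrainSolution b κ μ E ε) (p : Idx d) :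
    MemLp (strainField ε p) 2 (cellMeasure b) := (h.memLp p.1 p.2).ofReal

lemma IsStrainSolution.memLp_fluctField (h : IsStrainSolution b κ μ E ε) (p : Idx d) :
    MemLp (fluctField E ε p) 2 (cellMeasure b) :=
  ((h.memLp p.1 p.2).sub (memLp_const (E p.1 p.2))).ofReal

lemma stress_eq (x : Space d) (i j : Fin d) :
    (stress κ μ ε x i j : ℂ) = contr (isoTensor d κ₀ μ₀) (fun q => strainField ε q x) (i, j)
      + mulField (deltaL κ₀ μ₀ κ μ) (strainField ε) (i, j) x := by
  simp only [mulField, contr, ← Finset.sum_add_distrib, stress, act, Matrix.of_apply,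
    Fintype.sum_prod_type, Complex.ofReal_sum, strainField]
  refine Finset.sum_congr rfl fun k _ => Finset.sum_congr rfl fun l _ => ?_
  simp only [deltaL, Pi.sub_apply]
  push_cast
  ring

/-- Equilibrium is tested against the cosine and sine of each phase. Splitting L = L₀ + δL turns it
into the reference problem with polarization δL : ε, which the symbol inverts one frequency at a
time. -/
theorem IsStrainSolution.isGreenImage (hd : 2 ≤ d) (hκ₀ : 0 < κ₀) (hμ₀ : 0 < μ₀)
    (hm : IsModuliField b κ μ) (h : IsStrainSolution b κ μ E ε) :
    IsGreenImage b κ₀ μ₀ (fluctField E ε) (mulField (deltaL κ₀ μ₀ κ μ) (strainField ε)) := by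
  have hmem := h.memLp_strainField
  have hfl := h.memLp_fluctField
  have hτ := (hm.isBoundedTensor (κ₀ := κ₀) (μ₀ := μ₀) hd).memLp hmem
  have hσC : ∀ i j, MemLp (fun x => (stress κ μ ε x i j : ℂ)) 2 (cellMeasure b) := fun i j => by
    simp only [stress_eq (κ₀ := κ₀) (μ₀ := μ₀)]
    exact (memLp_contr _ hmem (i, j)).add (hτ (i, j))
  have hσ : ∀ i j, MemLp (fun x => stress κ μ ε x i j) 2 (cellMeasure b) := fun i j => (hσC i j).re
  obtain ⟨-, ⟨u, G, hG, hε⟩, hw⟩ := h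
  intro n p
  have he : ∀ i j, fcoef b (fluctField E ε (i, j)) n
      = Complex.I * (wave b n j * fcoef b (fun x => (u x i : ℂ)) n
          + wave b n i * fcoef b (fun x => (u x j : ℂ)) n) / 2 := by
    intro i j
    have : fluctField E ε (i, j) =ᵐ[cellMeasure b]
        fun x => (1 / 2 : ℂ) * ((G x i j : ℂ) + (G x j i : ℂ)) := by
      filter_upwards [hε] with x hx
      simp only [fluctField, hx, Matrix.add_apply, Matrix.smul_apply, Matrix.transpose_apply,
        smul_eq_mul]
      push_cast
      ring
    rw [fcoef_congr this, fcoef_const_mul,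
      fcoef_add (memLp_ofReal (hG.memLp_grad i j)) (memLp_ofReal (hG.memLp_grad j i)),
      hG.fcoef_eq, hG.fcoef_eq]
    ring
  -- At frequency zero the symmetrized gradient has zero mean and the symbol vanishes.
  by_cases hn : n = 0
  · subst hn
    rw [dir_zero, contr_green_zero, neg_zero]
    obtain ⟨i, j⟩ := p
    rw [he]
    simp [wave_zero]
  have hpos := Real.sqrt_pos.mpr (sum_wave_sq_pos (b := b) hn)
  set r := Real.sqrt (∑ i, wave b n i ^ 2) with hr
  have hwave : ∀ j, wave b n j = r * dir b n j := fun j => by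
    simp only [dir, ← hr]; field_simp
  refine eq_neg_contr_green hd hκ₀ hμ₀ (sum_dir_sq hn)
    -- The factor I r |ξ-free| of the gradient, with `r` the length of the wave vector, is absorbed
    -- into `w`, so that only the unit direction remains.
    (w := fun i => Complex.I * r * fcoef b (fun x => (u x i : ℂ)) n)
    (e := fun q => fcoef b (fluctField E ε q) n) (fun i j => ?_) (fun i => ?_) p
  · rw [he, hwave, hwave]
    push_cast
    ring
  have hσe : ∀ j, fcoef b (fun x => (stress κ μ ε x i j : ℂ)) n
      = contr (isoTensor d κ₀ μ₀) (fun q => fcoef b (fluctField E ε q) n) (i, j)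
        + fcoef b (mulField (deltaL κ₀ μ₀ κ μ) (strainField ε) (i, j)) n := by
    intro j
    -- The macroscopic strain is constant and so is invisible at nonzero frequencies.
    have hc : ∀ q, fcoef b (strainField ε q) n = fcoef b (fluctField E ε q) n := by
      intro q
      have : strainField ε q = fun x => fluctField E ε q x + (E q.1 q.2 : ℂ) := by
        funext x; simp [strainField, fluctField]
      rw [this, fcoef_add (hfl q) (memLp_const _), fcoef_const b hn, add_zero]
    simp only [stress_eq (κ₀ := κ₀) (μ₀ := μ₀)]
    rw [fcoef_add (memLp_contr _ hmem (i, j)) (hτ (i, j)), fcoef_contr _ hmem]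
    simp only [hc]
  simp only [← hσe]
  have h1 := hw i _ (isTest_cos n)
  have h2 := hw i _ (isTest_sin n)
  simp only [partialD_cos, partialD_sin] at h1 h2
  have e1 : ∀ x, ∑ j, stress κ μ ε x i j * -(wave b n j * Real.sin (phase b n x))
      = ∑ j, -wave b n j * (stress κ μ ε x i j * Real.sin (phase b n x)) :=
    fun x => Finset.sum_congr rfl fun j _ => by ring
  have e2 : ∀ x, ∑ j, stress κ μ ε x i j * (wave b n j * Real.cos (phase b n x))
      = ∑ j, wave b n j * (stress κ μ ε x i j * Real.cos (phase b n x)) :=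
    fun x => Finset.sum_congr rfl fun j _ => by ring
  simp only [e1, e2] at h1 h2
  rw [integral_finsetSum _ fun j _ => (integrable_mul_sin (hσ i j) n).const_mul _] at h1
  rw [integral_finsetSum _ fun j _ => (integrable_mul_cos (hσ i j) n).const_mul _] at h2
  simp only [integral_const_mul] at h1 h2
  have h1' := congrArg Complex.ofReal h1
  have h2' := congrArg Complex.ofReal h2
  have hrC : (r : ℂ) ≠ 0 := by exact_mod_cast hpos.ne'
  refine (mul_eq_zero.mp (?_ : (r : ℂ) * _ = 0)).resolve_left hrC
  simp only [fcoef_ofReal (hσ i _)]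
  push_cast at h1' h2' ⊢
  rw [Finset.mul_sum]
  calc _ = ∑ j, ((wave b n j : ℂ) *
            ((∫ x, stress κ μ ε x i j * Real.cos (phase b n x) ∂(cellMeasure b) : ℝ) : ℂ)
          + Complex.I * (-(wave b n j : ℂ) *
            ((∫ x, stress κ μ ε x i j * Real.sin (phase b n x) ∂(cellMeasure b) : ℝ) : ℂ))) := by
        refine Finset.sum_congr rfl fun j _ => ?_
        rw [hwave]
        push_cast
        ring
    _ = 0 := by
        rw [Finset.sum_add_distrib, ← Finset.mul_sum, h1', h2']
        simp

end StrainSolution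

/-! ### Algebra of the orthogonal eigenbasis of P. -/

section Eigenbasis

variable {d : ℕ}

lemma ddot_eq_sum (a c : Tensor2 d) : ddot a c = ∑ p : Idx d, a p.1 p.2 * c p.1 p.2 := by
  rw [ddot, Fintype.sum_prod_type]

lemma ddot_comm (a c : Tensor2 d) : ddot a c = ddot c a := by
  simp [ddot, mul_comm]

lemma ddot_smul_right (r : ℝ) (a c : Tensor2 d) : ddot a (r • c) = r * ddot a c := by
  simp only [ddot_eq_sum, Finset.mul_sum, Matrix.smul_apply, smul_eq_mul]
  exact Finset.sum_congr rfl fun _ _ => by ring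

lemma ddot_sub_left (a c e : Tensor2 d) : ddot (a - c) e = ddot a e - ddot c e := by
  simp [ddot_eq_sum, sub_mul, Finset.sum_sub_distrib]

lemma ddot_self_pos {a : Tensor2 d} (ha : a ≠ 0) : 0 < ddot a a := by
  rw [ddot_eq_sum]
  have h0 : ∀ p ∈ (Finset.univ : Finset (Idx d)), 0 ≤ a p.1 p.2 * a p.1 p.2 :=
    fun _ _ => mul_self_nonneg _
  refine (Finset.sum_nonneg h0).lt_of_ne fun h => ha ?_
  ext i j
  have := (Finset.sum_eq_zero_iff_of_nonneg h0).mp h.symm (i, j) (Finset.mem_univ _)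
  simpa using this

lemma ddot_self_nonneg (a : Tensor2 d) : 0 ≤ ddot a a := by
  rw [ddot_eq_sum]
  exact Finset.sum_nonneg fun _ _ => mul_self_nonneg _

lemma tnorm_sq (a : Tensor2 d) : tnorm a ^ 2 = ddot a a := Real.sq_sqrt (ddot_self_nonneg a)

lemma tnorm_pos {a : Tensor2 d} (ha : a ≠ 0) : 0 < tnorm a := Real.sqrt_pos.mpr (ddot_self_pos ha)

lemma act_apply (A : Tensor4 d) (a : Tensor2 d) (i j : Fin d) :
    act A a i j = ∑ q : Idx d, A i j q.1 q.2 * a q.1 q.2 := by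
  rw [act, Matrix.of_apply, Fintype.sum_prod_type]

lemma act_sub (A B : Tensor4 d) (a : Tensor2 d) : act (A - B) a = act A a - act B a := by
  ext i j
  simp [act_apply, sub_mul, Finset.sum_sub_distrib]

lemma qdot_eq_sum (A B : Tensor4 d) :
    qdot A B = ∑ p : Idx d, ∑ q : Idx d, A p.1 p.2 q.1 q.2 * B p.1 p.2 q.1 q.2 := by
  simp only [qdot, Fintype.sum_prod_type]

lemma act_tensorI {a : Tensor2 d} (ha : a.IsSymm) : act (tensorI d) a = a := by
  ext i j
  have hs : a j i = a i j := ha.apply i j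
  simp only [act, Matrix.of_apply, tensorI, add_div, add_mul, Finset.sum_add_distrib]
  have h1 : ∀ k l : Fin d, ∀ i j : Fin d, kron i k * kron j l / 2 * a k l
      = 1 / 2 * (kron i k * (kron j l * a k l)) := fun k l i j => by ring
  have h2 : ∀ k l : Fin d, ∀ i j : Fin d, kron i l * kron j k / 2 * a k l
      = 1 / 2 * (kron j k * (kron i l * a k l)) := fun k l i j => by ring
  have k1 := fun (i : Fin d) (f : Fin d → ℝ) => sum_kron_mul (R := ℝ) i f
  simp only [Algebra.algebraMap_self, RingHom.id_apply] at k1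
  simp only [h1, h2, ← Finset.mul_sum, k1, hs]
  ring

/-- The eigenvalue on the range of `P` of the elasticity tensor fluctuation. -/
def Proj.eig (d : ℕ) (δκ δμ : ℝ) : Proj → ℝ
  | .J => d * δκ
  | .K => 2 * δμ

variable {P : Proj} {E : Fin (P.dim d) → Tensor2 d}

lemma IsOrthogonalEigenbasis.act_tensor (hE : IsOrthogonalEigenbasis P E) (i : Fin (P.dim d)) :
    act (P.tensor d) (E i) = E i := by
  have h : ∀ k l, act (P.tensor d) (E i) k l
      = ∑ j, (tnorm (E j) ^ 2)⁻¹ * ddot (E j) (E i) * E j k l := by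
    intro k l
    rw [act_apply, hE.resolution]
    simp only [Finset.sum_apply, Pi.smul_apply, dyad, smul_eq_mul, Finset.sum_mul, ddot_eq_sum,
      Finset.mul_sum]
    rw [Finset.sum_comm]
    exact Finset.sum_congr rfl fun j _ => Finset.sum_congr rfl fun q _ => by ring
  ext k l
  rw [h, Finset.sum_eq_single i]
  · rw [← tnorm_sq, inv_mul_cancel₀ (pow_ne_zero 2 (tnorm_pos (hE.ne_zero i)).ne'), one_mul]
  · intro j _ hj
    rw [hE.orthogonal, if_neg hj]
    ring
  · simp

lemma IsOrthogonalEigenbasis.qdot_eq (hE : IsOrthogonalEigenbasis P E) (A : Tensor4 d) :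
    qdot A (P.tensor d) = ∑ j, (tnorm (E j) ^ 2)⁻¹ * ddot (E j) (act A (E j)) := by
  rw [hE.resolution]
  simp only [qdot_eq_sum, Finset.sum_apply, Pi.smul_apply, smul_eq_mul, dyad, ddot_eq_sum,
    act_apply, Finset.mul_sum]
  rw [Finset.sum_comm' (t' := Finset.univ) (s' := fun _ => Finset.univ) (by simp)]
  conv_lhs => enter [2, p]; rw [Finset.sum_comm]
  rw [Finset.sum_comm]
  refine Finset.sum_congr rfl fun j _ => ?_
  rw [Finset.sum_comm]
  exact Finset.sum_congr rfl fun p _ => Finset.sum_congr rfl fun q _ => by ring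

/-- The numerator of the second formula is the squared length of the projection of `a` on the span
of the `E j`, which separates parallel and transverse components. -/
lemma IsOrthogonalEigenbasis.qdot_dyad (hE : IsOrthogonalEigenbasis P E) (a : Tensor2 d) :
    qdot (P.tensor d) (dyad a a) = ∑ j, (tnorm (E j) ^ 2)⁻¹ * ddot (E j) a ^ 2 := by
  have hc : qdot (P.tensor d) (dyad a a) = qdot (dyad a a) (P.tensor d) := by
    simp only [qdot_eq_sum, mul_comm]
  rw [hc, hE.qdot_eq]
  refine Finset.sum_congr rfl fun j _ => ?_
  have : act (dyad a a) (E j) = ddot (E j) a • a := by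
    ext k l
    simp only [act_apply, dyad, Matrix.smul_apply, smul_eq_mul, ddot_eq_sum, Finset.sum_mul]
    exact Finset.sum_congr rfl fun q _ => by ring
  rw [this, ddot_smul_right]
  ring

lemma IsOrthogonalEigenbasis.qdot_dyad_self (hE : IsOrthogonalEigenbasis P E)
    (i : Fin (P.dim d)) : qdot (P.tensor d) (dyad (E i) (E i)) = tnorm (E i) ^ 2 := by
  rw [hE.qdot_dyad, Finset.sum_eq_single i]
  · rw [← tnorm_sq]
    have := (tnorm_pos (hE.ne_zero i)).ne'
    field_simp
  · intro j _ hj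
    rw [hE.orthogonal, if_neg hj]
    ring
  · simp

/-- Each `E i` is symmetric and fixed by one of J, K; since J + K is the identity on symmetric
tensors, the other one kills it. -/
lemma IsOrthogonalEigenbasis.act_deltaL (hE : IsOrthogonalEigenbasis P E) (κ₀ μ₀ : ℝ)
    (κ μ : Space d → ℝ) (x : Space d) (i : Fin (P.dim d)) :
    act (deltaL κ₀ μ₀ κ μ x) (E i) = P.eig d (κ x - κ₀) (μ x - μ₀) • E i := by
  have h1 := hE.act_tensor i
  have h2 : act (tensorK d) (E i) = E i - act (tensorJ d) (E i) := by
    rw [tensorK, act_sub, act_tensorI (hE.symm i)]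
  have h3 : act (deltaL κ₀ μ₀ κ μ x) (E i) = (d * (κ x - κ₀)) • act (tensorJ d) (E i)
      + (2 * (μ x - μ₀)) • act (tensorK d) (E i) := by
    ext k l
    simp only [act_apply, deltaL_apply, Matrix.add_apply, Matrix.smul_apply, smul_eq_mul,
      Finset.mul_sum, ← Finset.sum_add_distrib]
    exact Finset.sum_congr rfl fun q _ => by ring
  cases P
  · simp only [Proj.tensor] at h1
    rw [h3, h2, h1, sub_self, smul_zero, add_zero]
    rfl
  · simp only [Proj.tensor] at h1
    have h4 : act (tensorJ d) (E i) = 0 := by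
      rw [h1] at h2
      exact sub_eq_self.mp h2.symm
    rw [h3, h1, h4, smul_zero, zero_add]
    rfl

lemma Proj.dim_pos (hd : 2 ≤ d) (P : Proj) : 0 < P.dim d := by
  cases P
  · simp [Proj.dim]
  · have : 2 * 3 ≤ d * (d + 1) := Nat.mul_le_mul hd (by omega)
    simp only [Proj.dim]
    omega

/-- All `n_P` diagonal terms of the contraction equal the same eigenvalue, so the average over the
eigenbasis returns it. With `act_deltaL` this gives δL : `E i` = δp `E i`. -/
lemma IsOrthogonalEigenbasis.deltaP_eq (hd : 2 ≤ d) (hE : IsOrthogonalEigenbasis P E) (κ₀ μ₀ : ℝ)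
    (κ μ : Space d → ℝ) (x : Space d) :
    deltaP P κ₀ μ₀ κ μ x = P.eig d (κ x - κ₀) (μ x - μ₀) := by
  have hn : (P.dim d : ℝ) ≠ 0 := by exact_mod_cast (P.dim_pos hd).ne'
  rw [deltaP, hE.qdot_eq]
  have : ∀ j, (tnorm (E j) ^ 2)⁻¹ * ddot (E j) (act (deltaL κ₀ μ₀ κ μ x) (E j))
      = P.eig d (κ x - κ₀) (μ x - μ₀) := by
    intro j
    rw [hE.act_deltaL, ddot_smul_right, ← tnorm_sq]
    have := (tnorm_pos (hE.ne_zero j)).ne'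
    field_simp
  simp only [this, Finset.sum_const, Finset.card_univ, Fintype.card_fin, nsmul_eq_mul]
  rw [inv_mul_cancel_left₀ hn]

end Eigenbasis

/-! ### Pointwise algebra of the two remainders. -/

section Remainders

variable {d : ℕ} {P : Proj} {E : Fin (P.dim d) → Tensor2 d}

/-- The linearized residual `∑ᵢ E⁽ⁱ⁾ : f⁽ⁱ⁾ / ‖E⁽ⁱ⁾‖² + λ_P q`. -/
noncomputable def residual (P : Proj) (κ₀ μ₀ : ℝ) (E : Fin (P.dim d) → Tensor2 d)
    (f : Fin (P.dim d) → Tensor2 d) (q : ℝ) : ℝ :=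
  ∑ i, (tnorm (E i) ^ 2)⁻¹ * ddot (E i) (f i) + P.lam d κ₀ μ₀ * q

lemma sub_reconParallel (hE : IsOrthogonalEigenbasis P E) {κ₀ μ₀ : ℝ} (hlam : P.lam d κ₀ μ₀ ≠ 0)
    (ε : Fin (P.dim d) → Space d → Tensor2 d) (x : Space d) (q : ℝ) :
    q - reconParallel P κ₀ μ₀ E ε x
      = (P.lam d κ₀ μ₀)⁻¹ * residual P κ₀ μ₀ E (fun i => ε i x - E i) q := by
  have h : ∀ i, 1 - parallel (E i) (ε i x) / tnorm (E i)
      = -((tnorm (E i) ^ 2)⁻¹ * ddot (E i) (ε i x - E i)) := by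
    intro i
    rw [ddot_comm, ddot_sub_left, ← tnorm_sq, parallel]
    have := (tnorm_pos (hE.ne_zero i)).ne'
    field_simp
    ring
  simp only [reconParallel, residual, h, Finset.sum_neg_distrib]
  field_simp
  ring

/-- Where y ≤ 1/2 one has 1 + s ≥ 1/2, and squaring gives the quadratic bound; where y > 1/2 it
follows from the linear one, as 3y ≤ 6y². The quadratic bound gives the right order in the contrast,
the linear one the integrability. -/
lemma sqrt_sub_bounds {s B y : ℝ} (hs : |s| ≤ y) (hB0 : 0 ≤ B) (hB : B ≤ y ^ 2) :
    0 ≤ Real.sqrt ((1 + s) ^ 2 + B) - (1 + s) ∧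
    Real.sqrt ((1 + s) ^ 2 + B) - (1 + s) ≤ 3 * y ∧
    Real.sqrt ((1 + s) ^ 2 + B) - (1 + s) ≤ 6 * y ^ 2 := by
  have hy : 0 ≤ y := (abs_nonneg s).trans hs
  obtain ⟨hs1, hs2⟩ := abs_le.mp hs
  have h0 : 0 ≤ Real.sqrt ((1 + s) ^ 2 + B) - (1 + s) := by
    rw [sub_nonneg]
    exact Real.le_sqrt_of_sq_le (by linarith)
  have h3 : Real.sqrt ((1 + s) ^ 2 + B) - (1 + s) ≤ 3 * y := by
    rw [sub_le_iff_le_add]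
    have h4 : Real.sqrt ((1 + s) ^ 2 + B) ≤ |1 + s| + y := by
      refine Real.sqrt_le_iff.mpr ⟨by positivity, ?_⟩
      nlinarith [sq_abs (1 + s), mul_nonneg (abs_nonneg (1 + s)) hy]
    rcases abs_cases (1 + s) with ⟨h, _⟩ | ⟨h, _⟩ <;> linarith
  refine ⟨h0, h3, ?_⟩
  rcases le_or_gt y (1 / 2) with h | h
  · rw [sub_le_iff_le_add]
    refine Real.sqrt_le_iff.mpr ⟨by nlinarith, ?_⟩
    nlinarith [sq_nonneg y, mul_nonneg (sq_nonneg y) (by linarith : 0 ≤ 1 + s - 1 / 2),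
      sq_nonneg (y ^ 2)]
  · nlinarith

/-- A scalar dominating the relative size of a perturbation `f` of `E i`. -/
noncomputable def relSize (E : Fin (P.dim d) → Tensor2 d) (i : Fin (P.dim d)) (f : Tensor2 d) : ℝ :=
  ∑ j, |ddot (E j) f / (tnorm (E j) * tnorm (E i))|

lemma relSize_nonneg (i : Fin (P.dim d)) (f : Tensor2 d) : 0 ≤ relSize E i f :=
  Finset.sum_nonneg fun _ _ => abs_nonneg _

/-- With `c j` the relative components of the fluctuation, the energy ratio is (1 + c_i)² plus the
squares of the other `c j`, and the relative parallel component is 1 + c_i. The two formulas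
therefore differ only through the transverse part. -/
lemma sqrt_energy_bounds (hE : IsOrthogonalEigenbasis P E) (i : Fin (P.dim d)) (ε : Tensor2 d) :
    let D := Real.sqrt (qdot (P.tensor d) (dyad ε ε) / qdot (P.tensor d) (dyad (E i) (E i)))
      - parallel (E i) ε / tnorm (E i)
    0 ≤ D ∧ D ≤ 3 * relSize E i (ε - E i) ∧ D ≤ 6 * relSize E i (ε - E i) ^ 2 := by
  intro D
  set c : Fin (P.dim d) → ℝ := fun j => ddot (E j) (ε - E i) / (tnorm (E j) * tnorm (E i)) with hc
  have hi := (tnorm_pos (hE.ne_zero i)).ne'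
  have hcj : ∀ j, ddot (E j) ε = tnorm (E j) * tnorm (E i) * (c j + if j = i then 1 else 0) := by
    intro j
    have hj := (tnorm_pos (hE.ne_zero j)).ne'
    have : ddot (E j) (ε - E i) = ddot (E j) ε - ddot (E j) (E i) := by
      rw [ddot_comm, ddot_sub_left, ddot_comm, ddot_comm (E i)]
    simp only [hc, this, hE.orthogonal]
    field_simp
    ring
  have hpar : parallel (E i) ε / tnorm (E i) = 1 + c i := by
    rw [parallel, ddot_comm, hcj, if_pos rfl]
    field_simp
    ring
  have hratio : qdot (P.tensor d) (dyad ε ε) / qdot (P.tensor d) (dyad (E i) (E i))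
      = (1 + c i) ^ 2 + ∑ j ∈ Finset.univ.erase i, c j ^ 2 := by
    rw [hE.qdot_dyad_self, hE.qdot_dyad, Finset.sum_div,
      ← Finset.add_sum_erase _ _ (Finset.mem_univ i)]
    congr 1
    · rw [hcj, if_pos rfl]
      field_simp
      ring
    · refine Finset.sum_congr rfl fun j hj => ?_
      have hj' := (tnorm_pos (hE.ne_zero j)).ne'
      rw [hcj, if_neg (Finset.ne_of_mem_erase hj)]
      field_simp
      ring
  have hs : |c i| ≤ relSize E i (ε - E i) :=
    Finset.single_le_sum (f := fun j => |c j|) (fun _ _ => abs_nonneg _) (Finset.mem_univ i)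
  have hB0 : 0 ≤ ∑ j ∈ Finset.univ.erase i, c j ^ 2 := Finset.sum_nonneg fun _ _ => sq_nonneg _
  have hB : ∑ j ∈ Finset.univ.erase i, c j ^ 2 ≤ relSize E i (ε - E i) ^ 2 := by
    calc ∑ j ∈ Finset.univ.erase i, c j ^ 2 ≤ ∑ j, c j ^ 2 :=
          Finset.sum_le_sum_of_subset_of_nonneg (Finset.erase_subset _ _)
            fun _ _ _ => sq_nonneg _
      _ = ∑ j, |c j| ^ 2 := by simp only [sq_abs]
      _ ≤ (∑ j, |c j|) ^ 2 := Finset.sum_sq_le_sq_sum_of_nonneg fun _ _ => abs_nonneg _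
  have := sqrt_sub_bounds hs hB0 hB
  rwa [← hratio, ← hpar] at this

/-- The disjunction lets the linear or the quadratic bound be chosen separately for each index and
point. -/
lemma abs_sub_reconEnergy_le (hE : IsOrthogonalEigenbasis P E) {κ₀ μ₀ : ℝ}
    (hlam : 0 < P.lam d κ₀ μ₀) (ε : Fin (P.dim d) → Space d → Tensor2 d) (x : Space d) (q : ℝ)
    {D : Fin (P.dim d) → ℝ}
    (hD : ∀ i, 3 * relSize E i (ε i x - E i) ≤ D i ∨ 6 * relSize E i (ε i x - E i) ^ 2 ≤ D i) :
    |q - reconEnergy P κ₀ μ₀ E ε x| ≤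
      (P.lam d κ₀ μ₀)⁻¹ * (|residual P κ₀ μ₀ E (fun i => ε i x - E i) q| + ∑ i, D i) := by
  have h1 : q - reconEnergy P κ₀ μ₀ E ε x = (q - reconParallel P κ₀ μ₀ E ε x)
      + (P.lam d κ₀ μ₀)⁻¹ * ∑ i, (Real.sqrt (qdot (P.tensor d) (dyad (ε i x) (ε i x)) /
        qdot (P.tensor d) (dyad (E i) (E i))) - parallel (E i) (ε i x) / tnorm (E i)) := by
    simp only [reconEnergy, reconParallel, Finset.sum_sub_distrib]
    ring
  rw [h1, sub_reconParallel hE hlam.ne', ← mul_add, abs_mul, abs_of_pos (inv_pos.mpr hlam)]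
  gcongr
  refine (abs_add_le _ _).trans ?_
  gcongr
  have hb := fun i => sqrt_energy_bounds hE i (ε i x)
  rw [abs_of_nonneg (Finset.sum_nonneg fun i _ => (hb i).1)]
  refine Finset.sum_le_sum fun i _ => ?_
  obtain ⟨-, h2, h3⟩ := hb i
  rcases hD i with h | h
  · exact h2.trans h
  · exact h3.trans h

end Remainders

/-! ### L² estimate of the linearized residual. -/

section ResidualEstimate

variable {d : ℕ} {b : Module.Basis (Fin d) ℝ (Space d)} {P : Proj}
  {E : Fin (P.dim d) → Tensor2 d}

/-- The linearized residual, for complex tensors. -/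
noncomputable def cresidual (P : Proj) (κ₀ μ₀ : ℝ) (E : Fin (P.dim d) → Tensor2 d)
    (f : Fin (P.dim d) → Idx d → ℂ) (q : ℂ) : ℂ :=
  ∑ i, (((tnorm (E i) ^ 2)⁻¹ : ℝ) : ℂ) * ∑ p : Idx d, (E i p.1 p.2 : ℂ) * f i p
    + (P.lam d κ₀ μ₀ : ℂ) * q

lemma ofReal_residual (κ₀ μ₀ : ℝ) (f : Fin (P.dim d) → Tensor2 d) (q : ℝ) :
    (residual P κ₀ μ₀ E f q : ℂ)
      = cresidual P κ₀ μ₀ E (fun i p => (f i p.1 p.2 : ℂ)) q := by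
  simp only [residual, cresidual, ddot_eq_sum]
  push_cast
  rfl

lemma memLp_cresidual (κ₀ μ₀ : ℝ) {e : Fin (P.dim d) → Idx d → Space d → ℂ} {q : Space d → ℂ}
    (he : ∀ i p, MemLp (e i p) 2 (cellMeasure b)) (hq : MemLp q 2 (cellMeasure b)) :
    MemLp (fun x => cresidual P κ₀ μ₀ E (fun i p => e i p x) (q x)) 2 (cellMeasure b) :=
  (memLp_finsetSum _ fun i _ => (memLp_finsetSum _ fun p _ => (he i p).const_mul _).const_mul _).add
    (hq.const_mul _)

lemma fcoef_cresidual (κ₀ μ₀ : ℝ) {e : Fin (P.dim d) → Idx d → Space d → ℂ} {q : Space d → ℂ}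
    (he : ∀ i p, MemLp (e i p) 2 (cellMeasure b)) (hq : MemLp q 2 (cellMeasure b))
    (n : Fin d → ℤ) :
    fcoef b (fun x => cresidual P κ₀ μ₀ E (fun i p => e i p x) (q x)) n
      = cresidual P κ₀ μ₀ E (fun i p => fcoef b (e i p) n) (fcoef b q n) := by
  have h1 : ∀ i, MemLp (fun x => ∑ p : Idx d, (E i p.1 p.2 : ℂ) * e i p x) 2 (cellMeasure b) :=
    fun i => memLp_finsetSum _ fun p _ => (he i p).const_mul _
  unfold cresidual
  rw [fcoef_add (memLp_finsetSum _ fun i _ => (h1 i).const_mul _) (hq.const_mul _),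
    fcoef_const_mul, fcoef_sum _ fun i _ => (h1 i).const_mul _]
  congr 1
  refine Finset.sum_congr rfl fun i _ => ?_
  rw [fcoef_const_mul, fcoef_sum _ fun p _ => (he i p).const_mul _]
  simp only [fcoef_const_mul]

/-- The contraction of `P` with the symbol of the Green's operator is `λ_P`. -/
lemma cresidual_green (hd : d ≠ 0) (hE : IsOrthogonalEigenbasis P E) {κ₀ μ₀ : ℝ} (hμ₀ : μ₀ ≠ 0)
    {ν : Fin d → ℝ} (hν : ∑ i, ν i ^ 2 = 1) (T : Fin (P.dim d) → Idx d → ℂ) (q : ℂ) :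
    cresidual P κ₀ μ₀ E
        (fun i p => -contr (green κ₀ μ₀ ν) (fun r => E i r.1 r.2 * q + T i r) p) q
      = -∑ i, (((tnorm (E i) ^ 2)⁻¹ : ℝ) : ℂ) *
          ∑ p : Idx d, (E i p.1 p.2 : ℂ) * contr (green κ₀ μ₀ ν) (T i) p := by
  have hlam : (P.lam d κ₀ μ₀ : ℂ) = ∑ i, (((tnorm (E i) ^ 2)⁻¹ : ℝ) : ℂ) *
      ∑ p : Idx d, (E i p.1 p.2 : ℂ) *
        contr (green κ₀ μ₀ ν) (fun r => (E i r.1 r.2 : ℂ)) p := by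
    rw [← qdot_green (κ₀ := κ₀) hd hμ₀ P hν, hE.qdot_eq]
    simp only [ddot_eq_sum, act_apply, contr]
    push_cast
    rfl
  have hc : ∀ i p, contr (green κ₀ μ₀ ν) (fun r => E i r.1 r.2 * q + T i r) p
      = q * contr (green κ₀ μ₀ ν) (fun r => (E i r.1 r.2 : ℂ)) p
        + contr (green κ₀ μ₀ ν) (T i) p := by
    intro i p
    rw [contr_add, ← contr_const_mul]
    simp only [mul_comm]
  rw [cresidual, hlam, Finset.sum_mul, ← Finset.sum_add_distrib, ← Finset.sum_neg_distrib]
  refine Finset.sum_congr rfl fun i _ => ?_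
  rw [mul_assoc, ← mul_add, ← mul_neg, Finset.sum_mul, ← Finset.sum_add_distrib,
    ← Finset.sum_neg_distrib]
  congr 1
  refine Finset.sum_congr rfl fun p _ => ?_
  rw [hc]
  ring

/-- The part of the polarization proportional to `E i` contributes exactly -λ_P q at each nonzero
frequency and cancels, so only Γ applied to `τ` survives. The estimate serves twice: with `τ` of
second order for the uniform bounds, and with `τ = 0` for the first-order Neumann term. -/
theorem exists_integral_cresidual_le (hd : 2 ≤ d) (b : Module.Basis (Fin d) ℝ (Space d))
    (hE : IsOrthogonalEigenbasis P E) {κ₀ μ₀ : ℝ} (hμ₀ : 0 < μ₀) :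
    ∃ C : ℝ, 0 ≤ C ∧ ∀ (e τ : Fin (P.dim d) → Idx d → Space d → ℂ) (q : Space d → ℂ),
      (∀ i p, MemLp (e i p) 2 (cellMeasure b)) → (∀ i p, MemLp (τ i p) 2 (cellMeasure b)) →
      MemLp q 2 (cellMeasure b) → fcoef b q 0 = 0 →
      (∀ i, IsGreenImage b κ₀ μ₀ (e i) (fun p x => E i p.1 p.2 * q x + τ i p x)) →
      ∫ x, ‖cresidual P κ₀ μ₀ E (fun i p => e i p x) (q x)‖ ^ 2 ∂(cellMeasure b)
        ≤ C * ∑ i, energy b (τ i) := by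
  set w : Fin (P.dim d) → ℝ := fun i => (tnorm (E i) ^ 2)⁻¹ * ∑ p : Idx d, |E i p.1 p.2| with hw
  have hw0 : ∀ i, 0 ≤ w i := fun i => by positivity
  set K : ℝ := (∑ i, w i) * greenBound d κ₀ μ₀ with hK
  have hg0 : 0 ≤ greenBound d κ₀ μ₀ := by unfold greenBound; positivity
  refine ⟨K ^ 2 * Fintype.card (Fin (P.dim d) × Idx d), by positivity,
    fun e τ q he hτ hq hq0 h => ?_⟩
  have hsum : ∑ i, energy b (τ i)
      = ∑ k : Fin (P.dim d) × Idx d, ∫ x, ‖τ k.1 k.2 x‖ ^ 2 ∂(cellMeasure b) := by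
    rw [Fintype.sum_prod_type]; rfl
  rw [hsum]
  refine integral_sq_le_of_fcoef_le (memLp_cresidual κ₀ μ₀ he hq)
    (g := fun k : Fin (P.dim d) × Idx d => τ k.1 k.2) (fun k => hτ _ _) fun n => ?_
  rw [fcoef_cresidual κ₀ μ₀ he hq]
  have hi : ∀ i p, fcoef b (e i p) n = -contr (green κ₀ μ₀ (dir b n))
      (fun r => E i r.1 r.2 * fcoef b q n + fcoef b (τ i r) n) p := by
    intro i p
    rw [h i n p]
    congr 2
    funext r
    rw [fcoef_add (hq.const_mul _) (hτ i r), fcoef_const_mul]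
  simp only [hi]
  -- The zero mode of λ_P q has nothing to cancel against; the mean modulus hypothesis removes it.
  by_cases hn : n = 0
  · subst hn
    simp only [dir_zero, contr_green_zero, hq0, cresidual]
    simp only [neg_zero, mul_zero, Finset.sum_const_zero, add_zero, norm_zero]
    positivity
  rw [cresidual_green (by omega) hE hμ₀.ne' (sum_dir_sq hn), norm_neg, hK, mul_assoc,
    Finset.sum_mul]
  refine (norm_sum_le _ _).trans (Finset.sum_le_sum fun i _ => ?_)
  rw [norm_mul, Complex.norm_real, Real.norm_of_nonneg (by positivity), hw]
  simp only [mul_assoc]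
  gcongr
  rw [Finset.sum_mul]
  refine (norm_sum_le _ _).trans (Finset.sum_le_sum fun p _ => ?_)
  rw [norm_mul, Complex.norm_real, Real.norm_eq_abs]
  gcongr
  refine (norm_contr_green_le hμ₀ n _ p).trans ?_
  gcongr
  rw [Fintype.sum_prod_type (fun k : Fin (P.dim d) × Idx d => ‖fcoef b (τ k.1 k.2) n‖)]
  exact Finset.single_le_sum (f := fun i => ∑ r, ‖fcoef b (τ i r) n‖)
    (fun _ _ => Finset.sum_nonneg fun _ _ => norm_nonneg _) (Finset.mem_univ i)

/-- A tensor, as a constant complex field. -/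
def constField (a : Tensor2 d) (p : Idx d) (_ : Space d) : ℂ := (a p.1 p.2 : ℂ)

lemma energy_add_le {f g : Idx d → Space d → ℂ} (hf : ∀ p, MemLp (f p) 2 (cellMeasure b))
    (hg : ∀ p, MemLp (g p) 2 (cellMeasure b)) :
    energy b (fun p x => f p x + g p x) ≤ 2 * (energy b f + energy b g) := by
  rw [energy, energy, energy, ← Finset.sum_add_distrib, Finset.mul_sum]
  refine Finset.sum_le_sum fun p _ => ?_
  rw [← integral_add (integrable_sq (hf p)) (integrable_sq (hg p)), ← integral_const_mul]
  refine integral_mono (integrable_sq ((hf p).add (hg p)))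
    (((integrable_sq (hf p)).add (integrable_sq (hg p))).const_mul 2) fun x => ?_
  have := norm_add_le (f p x) (g p x)
  nlinarith [sq_nonneg (‖f p x‖ - ‖g p x‖), norm_nonneg (f p x + g p x)]

variable {κ₀ μ₀ : ℝ} {κ μ : Space d → ℝ}

/-- The constant in the energy estimate for the fluctuations. -/
noncomputable def contrastConst (d : ℕ) (κ₀ μ₀ : ℝ) : ℝ :=
  greenConst d κ₀ μ₀ * (9 * Fintype.card (Idx d) ^ 2)

lemma contrastConst_nonneg : 0 ≤ contrastConst d κ₀ μ₀ :=
  mul_nonneg (greenConst_nonneg _ _) (by positivity)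

/-- The fluctuation e appears on both sides of the Lippmann-Schwinger equation: its energy is at
most 2Cδ² times the sum of the energies of `a` and e. For 4Cδ² ≤ 1 the last term has factor at most
1/2 and is absorbed on the left. -/
lemma IsStrainSolution.energy_fluctField_le (hd : 2 ≤ d) (hκ₀ : 0 < κ₀) (hμ₀ : 0 < μ₀)
    (hm : IsModuliField b κ μ) {a : Tensor2 d} {ε : Space d → Tensor2 d}
    (h : IsStrainSolution b κ μ a ε)
    (hr : 4 * contrastConst d κ₀ μ₀ * contrast b κ₀ μ₀ κ μ ^ 2 ≤ 1) :
    energy b (fluctField a ε)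
      ≤ 4 * contrastConst d κ₀ μ₀ * contrast b κ₀ μ₀ κ μ ^ 2 * energy b (constField a) := by
  have hA := hm.isBoundedTensor (κ₀ := κ₀) (μ₀ := μ₀) hd
  have h1 := (h.isGreenImage hd hκ₀ hμ₀ hm).energy_le hμ₀ h.memLp_fluctField
    (hA.memLp h.memLp_strainField)
  have h2 := hA.energy_le h.memLp_strainField
  have hconst : ∀ p, MemLp (constField a p) 2 (cellMeasure b) := fun p => memLp_const _
  have h3 : energy b (strainField ε) ≤ 2 * (energy b (constField a) + energy b (fluctField a ε)) := by
    have := energy_add_le hconst h.memLp_fluctField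
    convert this using 3 with p x
    simp only [constField, fluctField, Complex.ofReal_sub, add_sub_cancel]
    rfl
  have h0 := energy_nonneg (b := b) (fluctField a ε)
  have h5 : energy b (fluctField a ε) ≤ contrastConst d κ₀ μ₀ * contrast b κ₀ μ₀ κ μ ^ 2 *
      (2 * (energy b (constField a) + energy b (fluctField a ε))) := by
    calc _ ≤ _ := h1
      _ ≤ greenConst d κ₀ μ₀ * ((3 * contrast b κ₀ μ₀ κ μ) ^ 2 * Fintype.card (Idx d) ^ 2 *
          (2 * (energy b (constField a) + energy b (fluctField a ε)))) := by
        refine mul_le_mul_of_nonneg_left (h2.trans ?_) (greenConst_nonneg _ _)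
        gcongr
      _ = _ := by rw [contrastConst]; ring
  nlinarith

lemma contr_ofReal_eq (A : Tensor4 d) (a : Tensor2 d) (p : Idx d) :
    contr A (fun r => (a r.1 r.2 : ℂ)) p = (act A a p.1 p.2 : ℂ) := by
  simp [contr, act_apply]

lemma memLp_deltaP (hd : 2 ≤ d) (hE : IsOrthogonalEigenbasis P E) (hm : IsModuliField b κ μ) :
    MemLp (deltaP P κ₀ μ₀ κ μ) 2 (cellMeasure b) := by
  have : deltaP P κ₀ μ₀ κ μ = fun x => P.eig d (κ x - κ₀) (μ x - μ₀) :=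
    funext fun x => hE.deltaP_eq hd κ₀ μ₀ κ μ x
  rw [this]
  cases P
  · exact ((hm.memLp_bulk.sub (memLp_const κ₀)).const_mul _).mono_exponent le_top
  · exact ((hm.memLp_shear.sub (memLp_const μ₀)).const_mul _).mono_exponent le_top

lemma fcoef_zero_ofReal (f : Space d → ℝ) (h : ∫ x, f x ∂(cellMeasure b) = 0) :
    fcoef b (fun x => (f x : ℂ)) 0 = 0 := by
  have : ∀ x, phase b 0 x = 0 := fun x => by simp [phase, wave_zero]
  simp only [fcoef, this, Complex.ofReal_zero, neg_zero, zero_mul, Complex.exp_zero, mul_one]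
  rw [integral_complex_ofReal, h, Complex.ofReal_zero]

/-- Splits the polarization into its first-order part, proportional to `E i` and cancelled in the
residual, and δL : e, a product of two small factors. -/
lemma mulField_strainField (hd : 2 ≤ d) (hE : IsOrthogonalEigenbasis P E) (i : Fin (P.dim d))
    (ε : Space d → Tensor2 d) (p : Idx d) (x : Space d) :
    mulField (deltaL κ₀ μ₀ κ μ) (strainField ε) p x
      = E i p.1 p.2 * (deltaP P κ₀ μ₀ κ μ x : ℂ)
        + mulField (deltaL κ₀ μ₀ κ μ) (fluctField (E i) ε) p x := by
  have h1 : (fun q => strainField ε q x)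
      = fun q => ((E i q.1 q.2 : ℂ)) + fluctField (E i) ε q x := by
    funext q; simp [strainField, fluctField]
  rw [mulField, h1, contr_add, contr_ofReal_eq, hE.act_deltaL, hE.deltaP_eq hd]
  simp only [Matrix.smul_apply, smul_eq_mul]
  push_cast
  rw [mul_comm]
  rfl

/-- The residual of the strain solutions is of second order in the contrast. -/
theorem exists_integral_residual_le (hd : 2 ≤ d) (b : Module.Basis (Fin d) ℝ (Space d))
    (hκ₀ : 0 < κ₀) (hμ₀ : 0 < μ₀) (hE : IsOrthogonalEigenbasis P E) :
    ∃ C : ℝ, 0 ≤ C ∧ ∀ κ μ : Space d → ℝ, IsModuliField b κ μ →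
      ∫ x, deltaP P κ₀ μ₀ κ μ x ∂(cellMeasure b) = 0 →
      4 * contrastConst d κ₀ μ₀ * contrast b κ₀ μ₀ κ μ ^ 2 ≤ 1 →
      ∀ ε : Fin (P.dim d) → Space d → Tensor2 d, (∀ i, IsStrainSolution b κ μ (E i) (ε i)) →
        ∫ x, ‖residual P κ₀ μ₀ E (fun i => ε i x - E i) (deltaP P κ₀ μ₀ κ μ x)‖ ^ 2
            ∂(cellMeasure b) ≤ C * contrast b κ₀ μ₀ κ μ ^ 4 := by
  obtain ⟨C, hC, h⟩ := exists_integral_cresidual_le hd b hE (κ₀ := κ₀) hμ₀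
  refine ⟨C * ∑ i, 9 * Fintype.card (Idx d) ^ 2 *
    (4 * contrastConst d κ₀ μ₀ * energy b (constField (E i))), ?_, ?_⟩
  · refine mul_nonneg hC (Finset.sum_nonneg fun i _ => ?_)
    have := energy_nonneg (b := b) (constField (E i))
    have := contrastConst_nonneg (d := d) (κ₀ := κ₀) (μ₀ := μ₀)
    positivity
  intro κ μ hm hmean hr ε hε
  have hA := hm.isBoundedTensor (κ₀ := κ₀) (μ₀ := μ₀) hd
  -- Here `τ` is δL : e. Two powers of the contrast come from δL and two from the energy of e, hence
  -- the fourth power.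
  have h1 := h (fun i => fluctField (E i) (ε i))
    (fun i => mulField (deltaL κ₀ μ₀ κ μ) (fluctField (E i) (ε i)))
    (fun x => (deltaP P κ₀ μ₀ κ μ x : ℂ)) (fun i => (hε i).memLp_fluctField)
    (fun i => hA.memLp (hε i).memLp_fluctField) (memLp_deltaP hd hE hm).ofReal
    (fcoef_zero_ofReal _ hmean) fun i => by
      have := (hε i).isGreenImage hd hκ₀ hμ₀ hm
      convert this using 1
      funext p x
      exact (mulField_strainField hd hE i (ε i) p x).symm
  calc ∫ x, ‖residual P κ₀ μ₀ E (fun i => ε i x - E i) (deltaP P κ₀ μ₀ κ μ x)‖ ^ 2 ∂(cellMeasure b)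
      = ∫ x, ‖cresidual P κ₀ μ₀ E (fun i p => fluctField (E i) (ε i) p x)
          (deltaP P κ₀ μ₀ κ μ x : ℂ)‖ ^ 2 ∂(cellMeasure b) := by
        refine integral_congr_ae (ae_of_all _ fun x => ?_)
        simp only
        rw [← Complex.norm_real, ofReal_residual]
        rfl
    _ ≤ _ := h1
    _ ≤ C * ∑ i, 9 * Fintype.card (Idx d) ^ 2 * (4 * contrastConst d κ₀ μ₀ *
          energy b (constField (E i))) * contrast b κ₀ μ₀ κ μ ^ 4 := by
        gcongr with i
        have h2 := hA.energy_le (hε i).memLp_fluctField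
        have h3 := (hε i).energy_fluctField_le hd hκ₀ hμ₀ hm hr
        calc _ ≤ _ := h2
          _ ≤ (3 * contrast b κ₀ μ₀ κ μ) ^ 2 * Fintype.card (Idx d) ^ 2 *
            (4 * contrastConst d κ₀ μ₀ * contrast b κ₀ μ₀ κ μ ^ 2 * energy b (constField (E i))) := by
              gcongr
          _ = _ := by ring
    _ = _ := by rw [← Finset.sum_mul, mul_assoc]

end ResidualEstimate

/-! ### Estimates uniform in the moduli. -/

section UniformEstimates

variable {d : ℕ} {b : Module.Basis (Fin d) ℝ (Space d)} {P : Proj}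
  {E : Fin (P.dim d) → Tensor2 d} {κ₀ μ₀ : ℝ} {κ μ : Space d → ℝ}

lemma eLpNorm_two_le {α : Type*} [MeasurableSpace α] {ν : Measure α} {f : α → ℝ}
    (hf : MemLp f 2 ν) {c : ℝ} (hc : 0 ≤ c) (h : ∫ x, ‖f x‖ ^ 2 ∂ν ≤ c ^ 2) :
    eLpNorm f 2 ν ≤ ENNReal.ofReal c := by
  rw [hf.eLpNorm_eq_integral_rpow_norm (by norm_num) (by norm_num)]
  refine ENNReal.ofReal_le_ofReal ?_
  simp only [ENNReal.toReal_ofNat, Real.rpow_ofNat]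
  rw [← one_div, ← Real.sqrt_eq_rpow]
  exact Real.sqrt_le_iff.mpr ⟨hc, h⟩

lemma memLp_residual (hd : 2 ≤ d) (hE : IsOrthogonalEigenbasis P E) (hm : IsModuliField b κ μ)
    {ε : Fin (P.dim d) → Space d → Tensor2 d} (hε : ∀ i, IsStrainSolution b κ μ (E i) (ε i)) :
    MemLp (fun x => residual P κ₀ μ₀ E (fun i => ε i x - E i) (deltaP P κ₀ μ₀ κ μ x)) 2
      (cellMeasure b) := by
  have h := (memLp_cresidual (E := E) κ₀ μ₀ (fun i => (hε i).memLp_fluctField)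
    (memLp_deltaP (κ₀ := κ₀) (μ₀ := μ₀) hd hE hm).ofReal).re
  convert h using 1
  funext x
  have := ofReal_residual (E := E) κ₀ μ₀ (fun i => ε i x - E i) (deltaP P κ₀ μ₀ κ μ x)
  exact congrArg Complex.re this

lemma exists_eLpNorm_residual_le (hd : 2 ≤ d) (b : Module.Basis (Fin d) ℝ (Space d))
    (hκ₀ : 0 < κ₀) (hμ₀ : 0 < μ₀) (hE : IsOrthogonalEigenbasis P E) :
    ∃ C : ℝ, 0 ≤ C ∧ ∀ κ μ : Space d → ℝ, IsModuliField b κ μ →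
      ∫ x, deltaP P κ₀ μ₀ κ μ x ∂(cellMeasure b) = 0 →
      4 * contrastConst d κ₀ μ₀ * contrast b κ₀ μ₀ κ μ ^ 2 ≤ 1 →
      ∀ ε : Fin (P.dim d) → Space d → Tensor2 d, (∀ i, IsStrainSolution b κ μ (E i) (ε i)) →
        eLpNorm (fun x => residual P κ₀ μ₀ E (fun i => ε i x - E i) (deltaP P κ₀ μ₀ κ μ x)) 2
            (cellMeasure b) ≤ ENNReal.ofReal (C * contrast b κ₀ μ₀ κ μ ^ 2) := by
  obtain ⟨C, hC, h⟩ := exists_integral_residual_le hd b hκ₀ hμ₀ hE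
  refine ⟨Real.sqrt C, Real.sqrt_nonneg _, fun κ μ hm hmean hr ε hε => ?_⟩
  refine eLpNorm_two_le (memLp_residual hd hE hm hε) (by positivity) ?_
  refine (h κ μ hm hmean hr ε hε).trans (le_of_eq ?_)
  rw [mul_pow, Real.sq_sqrt hC]
  ring

/-- One radius serves two purposes: it makes every power above the first at most η δ, and it grants
the smallness needed to absorb the fluctuation energy. -/
lemma exists_small_radius (A B c : ℝ) {θ η : ℝ} (hθ : 1 < θ) (hη : 0 < η) :
    ∃ r : ℝ, 0 < r ∧ ∀ δ : ℝ, 0 ≤ δ → δ ≤ r →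
      A * δ ^ 2 + B * δ ^ θ ≤ η * δ ∧ c * δ ^ 2 ≤ 1 := by
  have hθ' : 0 < θ - 1 := by linarith
  have hcont : Tendsto (fun δ : ℝ => A * δ + B * δ ^ (θ - 1)) (nhds 0) (nhds 0) := by
    have h1 : Tendsto (fun δ : ℝ => δ ^ (θ - 1)) (nhds 0) (nhds (0 ^ (θ - 1))) :=
      (Real.continuousAt_rpow_const 0 (θ - 1) (Or.inr hθ'.le)).tendsto
    rw [Real.zero_rpow hθ'.ne'] at h1
    simpa using (tendsto_id.const_mul A).add (h1.const_mul B)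
  have hcont2 : Tendsto (fun δ : ℝ => c * δ ^ 2) (nhds 0) (nhds 0) := by
    have : Continuous fun δ : ℝ => c * δ ^ 2 := by fun_prop
    simpa using this.tendsto 0
  have hev := (hcont.eventually (gt_mem_nhds hη)).and (hcont2.eventually (gt_mem_nhds one_pos))
  obtain ⟨ρ, hρ, hρ'⟩ := Metric.eventually_nhds_iff.mp hev
  refine ⟨ρ / 2, by positivity, fun δ h0 hδ => ?_⟩
  have hlt : dist δ 0 < ρ := by
    rw [Real.dist_eq, sub_zero, abs_of_nonneg h0]; linarith
  obtain ⟨h1, h2⟩ := hρ' hlt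
  refine ⟨?_, h2.le⟩
  rcases h0.eq_or_lt with h | h
  · subst h
    rw [Real.zero_rpow (by linarith)]
    simp
  · have : δ ^ θ = δ * δ ^ (θ - 1) := by
      rw [← Real.rpow_one_add' h0 (by linarith)]
      congr 1; ring
    rw [this]
    nlinarith

lemma exists_relSize_le (E : Fin (P.dim d) → Tensor2 d) :
    ∃ M : ℝ, 0 ≤ M ∧ ∀ i f, relSize E i f ≤ M * ∑ p : Idx d, |f p.1 p.2| := by
  set m : Fin (P.dim d) → ℝ :=
    fun i => ∑ j, (∑ p : Idx d, |E j p.1 p.2|) / |tnorm (E j) * tnorm (E i)| with hm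
  have hm0 : ∀ i, 0 ≤ m i := fun i => by positivity
  refine ⟨∑ i, m i, by positivity, fun i f => ?_⟩
  calc relSize E i f ≤ m i * ∑ p : Idx d, |f p.1 p.2| := by
        rw [relSize, hm]
        simp only [Finset.sum_mul (s := Finset.univ (α := Fin (P.dim d)))]
        refine Finset.sum_le_sum fun j _ => ?_
        rw [abs_div, div_mul_eq_mul_div]
        gcongr
        rw [ddot_eq_sum, Finset.sum_mul]
        refine (Finset.abs_sum_le_sum_abs _ _).trans (Finset.sum_le_sum fun p _ => ?_)
        rw [abs_mul]
        gcongr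
        exact Finset.single_le_sum (f := fun p : Idx d => |f p.1 p.2|) (fun _ _ => abs_nonneg _)
          (Finset.mem_univ p)
    _ ≤ _ := by
        gcongr
        exact Finset.single_le_sum (fun i _ => hm0 i) (Finset.mem_univ i)

/-- The sum of the moduli of the components of the fluctuations of a strain field. -/
noncomputable def fluctSize (a : Tensor2 d) (ε : Space d → Tensor2 d) (x : Space d) : ℝ :=
  ∑ p : Idx d, ‖fluctField a ε p x‖

lemma fluctSize_nonneg (a : Tensor2 d) (ε : Space d → Tensor2 d) (x : Space d) :
    0 ≤ fluctSize a ε x := Finset.sum_nonneg fun _ _ => norm_nonneg _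

lemma fluctSize_eq (a : Tensor2 d) (ε : Space d → Tensor2 d) (x : Space d) :
    fluctSize a ε x = ∑ p : Idx d, |(ε x - a) p.1 p.2| := by
  simp only [fluctSize, fluctField, Complex.norm_real, Real.norm_eq_abs, Matrix.sub_apply]

lemma IsStrainSolution.memLp_fluctSize {a : Tensor2 d} {ε : Space d → Tensor2 d}
    (h : IsStrainSolution b κ μ a ε) : MemLp (fluctSize a ε) 2 (cellMeasure b) :=
  memLp_finsetSum _ fun p _ => (h.memLp_fluctField p).norm

lemma exists_eLpNorm_fluctSize_le (hd : 2 ≤ d) (hκ₀ : 0 < κ₀) (hμ₀ : 0 < μ₀)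
    (b : Module.Basis (Fin d) ℝ (Space d)) (a : Tensor2 d) :
    ∃ C : ℝ, 0 ≤ C ∧ ∀ κ μ : Space d → ℝ, IsModuliField b κ μ →
      4 * contrastConst d κ₀ μ₀ * contrast b κ₀ μ₀ κ μ ^ 2 ≤ 1 →
      ∀ ε : Space d → Tensor2 d, IsStrainSolution b κ μ a ε →
        eLpNorm (fluctSize a ε) 2 (cellMeasure b)
          ≤ ENNReal.ofReal (C * contrast b κ₀ μ₀ κ μ) := by
  have hc := contrastConst_nonneg (d := d) (κ₀ := κ₀) (μ₀ := μ₀)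
  have he := energy_nonneg (b := b) (constField a)
  set C2 := Fintype.card (Idx d) * (4 * contrastConst d κ₀ μ₀ * energy b (constField a)) with hC2
  have hC20 : 0 ≤ C2 := by positivity
  refine ⟨Real.sqrt C2, Real.sqrt_nonneg _, fun κ μ hm hr ε hε => ?_⟩
  refine eLpNorm_two_le hε.memLp_fluctSize
    (mul_nonneg (Real.sqrt_nonneg _) contrast_nonneg) ?_
  have h1 := hε.energy_fluctField_le hd hκ₀ hμ₀ hm hr
  rw [mul_pow, Real.sq_sqrt hC20]
  calc ∫ x, ‖fluctSize a ε x‖ ^ 2 ∂(cellMeasure b)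
      ≤ ∫ x, Fintype.card (Idx d) * ∑ p, ‖fluctField a ε p x‖ ^ 2 ∂(cellMeasure b) := by
        refine integral_mono ((memLp_two_iff_integrable_sq_norm hε.memLp_fluctSize.1).mp
          hε.memLp_fluctSize) ((integrable_finsetSum _ fun p _ =>
            integrable_sq (hε.memLp_fluctField p)).const_mul _) fun x => ?_
        simp only
        rw [Real.norm_of_nonneg (fluctSize_nonneg _ _ _)]
        exact sq_sum_le _
    _ = Fintype.card (Idx d) * energy b (fluctField a ε) := by
        rw [integral_const_mul, energy_eq_integral hε.memLp_fluctField]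
    _ ≤ Fintype.card (Idx d) * (4 * contrastConst d κ₀ μ₀ * contrast b κ₀ μ₀ κ μ ^ 2 *
          energy b (constField a)) := by gcongr
    _ = _ := by rw [hC2]; ring

/-- Interpolation between the linear and quadratic bounds: Y^θ dominates Y² when Y ≤ 1 and Y when Y
> 1. -/
lemma error_alternative {y Y θ : ℝ} (hy : 0 ≤ y) (hyY : y ≤ Y) (h1 : 1 ≤ θ) (h2 : θ ≤ 2) :
    3 * y ≤ 6 * Y ^ θ ∨ 6 * y ^ 2 ≤ 6 * Y ^ θ := by
  have hY : 0 ≤ Y := hy.trans hyY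
  rcases le_or_gt Y 1 with h | h
  · right
    have : Y ^ (2:ℝ) ≤ Y ^ θ := Real.rpow_le_rpow_of_exponent_ge' hY h (by linarith) h2
    rw [Real.rpow_two] at this
    nlinarith
  · left
    have : Y ^ (1:ℝ) ≤ Y ^ θ := Real.rpow_le_rpow_of_exponent_le h.le h1
    rw [Real.rpow_one] at this
    linarith

theorem uniform_reconParallel (hd : 2 ≤ d) (b : Module.Basis (Fin d) ℝ (Space d))
    (hκ₀ : 0 < κ₀) (hμ₀ : 0 < μ₀) (hE : IsOrthogonalEigenbasis P E) {η : ℝ} (hη : 0 < η) :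
    ∃ r : ℝ, 0 < r ∧ ∀ κ μ : Space d → ℝ, IsModuliField b κ μ →
      ∫ x, deltaP P κ₀ μ₀ κ μ x ∂(cellMeasure b) = 0 →
      contrast b κ₀ μ₀ κ μ ≤ r →
      ∀ ε : Fin (P.dim d) → Space d → Tensor2 d, (∀ i, IsStrainSolution b κ μ (E i) (ε i)) →
        eLpNorm (fun x => deltaP P κ₀ μ₀ κ μ x - reconParallel P κ₀ μ₀ E ε x) 2 (cellMeasure b)
          ≤ ENNReal.ofReal (η * contrast b κ₀ μ₀ κ μ) := by
  have hlam := lam_pos hd hκ₀ hμ₀ P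
  obtain ⟨C, hC, h⟩ := exists_eLpNorm_residual_le hd b hκ₀ hμ₀ hE
  obtain ⟨r, hr, hr'⟩ := exists_small_radius ((P.lam d κ₀ μ₀)⁻¹ * C) 0
    (4 * contrastConst d κ₀ μ₀) one_lt_two hη
  refine ⟨r, hr, fun κ μ hm hmean hcr ε hε => ?_⟩
  obtain ⟨h1, h2⟩ := hr' _ contrast_nonneg hcr
  simp only [sub_reconParallel hE hlam.ne']
  refine (eLpNorm_const_smul_le (c := (P.lam d κ₀ μ₀)⁻¹) (f := fun x =>
    residual P κ₀ μ₀ E (fun i => ε i x - E i) (deltaP P κ₀ μ₀ κ μ x))).trans ?_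
  rw [Real.enorm_eq_ofReal (by positivity)]
  calc _ ≤ ENNReal.ofReal (P.lam d κ₀ μ₀)⁻¹ * ENNReal.ofReal (C * contrast b κ₀ μ₀ κ μ ^ 2) := by
        gcongr; exact h κ μ hm hmean h2 ε hε
    _ = ENNReal.ofReal ((P.lam d κ₀ μ₀)⁻¹ * (C * contrast b κ₀ μ₀ κ μ ^ 2)) :=
        (ENNReal.ofReal_mul (by positivity)).symm
    _ ≤ _ := ENNReal.ofReal_le_ofReal (by linarith)

theorem uniform_reconEnergy (hd : 2 ≤ d) (b : Module.Basis (Fin d) ℝ (Space d))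
    (hκ₀ : 0 < κ₀) (hμ₀ : 0 < μ₀) (hE : IsOrthogonalEigenbasis P E) {q : ℝ≥0∞} (hq1 : 1 ≤ q)
    (hq2 : q < 2) {η : ℝ} (hη : 0 < η) :
    ∃ r : ℝ, 0 < r ∧ ∀ κ μ : Space d → ℝ, IsModuliField b κ μ →
      ∫ x, deltaP P κ₀ μ₀ κ μ x ∂(cellMeasure b) = 0 →
      contrast b κ₀ μ₀ κ μ ≤ r →
      ∀ ε : Fin (P.dim d) → Space d → Tensor2 d, (∀ i, IsStrainSolution b κ μ (E i) (ε i)) →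
        eLpNorm (fun x => deltaP P κ₀ μ₀ κ μ x - reconEnergy P κ₀ μ₀ E ε x) q (cellMeasure b)
          ≤ ENNReal.ofReal (η * contrast b κ₀ μ₀ κ μ) := by
  have hlam := lam_pos hd hκ₀ hμ₀ P
  set L := (P.lam d κ₀ μ₀)⁻¹ with hL
  have hL0 : 0 < L := inv_pos.mpr hlam
  have hqtop : q ≠ ⊤ := hq2.ne_top
  lift q to ℝ≥0 using hqtop
  have hq1' : (1:ℝ) ≤ q := by exact_mod_cast hq1
  have hq2' : (q:ℝ) < 2 := by exact_mod_cast hq2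
  -- With this exponent the L^q norm of Y^θ is the L² norm of Y to the power θ. The condition q < 2
  -- is θ > 1, and q ≥ 1 is θ ≤ 2.
  set θ : ℝ := 2 / q with hθ
  have hθ1 : 1 < θ := by rw [hθ, lt_div_iff₀ (by linarith)]; linarith
  have hθ2 : θ ≤ 2 := by rw [hθ, div_le_iff₀ (by linarith)]; linarith
  obtain ⟨C, hC, h⟩ := exists_eLpNorm_residual_le hd b hκ₀ hμ₀ hE
  choose D hD0 hD using fun i => exists_eLpNorm_fluctSize_le hd hκ₀ hμ₀ b (E i)
  obtain ⟨M, hM0, hM⟩ := exists_relSize_le E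
  -- The Hölder factor from L² to L^q on the cell, used for the residual part.
  set v : ℝ := (cellMeasure b Set.univ ^ (1 / (q : ℝ≥0∞).toReal - 1 / (2 : ℝ≥0∞).toReal)).toReal
    with hv
  have hexp : 0 ≤ 1 / (q : ℝ≥0∞).toReal - 1 / (2 : ℝ≥0∞).toReal := by
    rw [sub_nonneg]
    simp only [ENNReal.coe_toReal, ENNReal.toReal_ofNat]
    gcongr
  have hv' : cellMeasure b Set.univ ^ (1 / (q : ℝ≥0∞).toReal - 1 / (2 : ℝ≥0∞).toReal)
      = ENNReal.ofReal v :=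
    (ENNReal.ofReal_toReal (ENNReal.rpow_ne_top_of_nonneg hexp (measure_ne_top _ _))).symm
  have hv0 : 0 ≤ v := ENNReal.toReal_nonneg
  obtain ⟨r, hr, hr'⟩ := exists_small_radius (L * (C * v)) (L * ∑ i, 6 * (M * D i) ^ θ)
    (4 * contrastConst d κ₀ μ₀) hθ1 hη
  refine ⟨r, hr, fun κ μ hm hmean hcr ε hε => ?_⟩
  obtain ⟨h1, h2⟩ := hr' _ contrast_nonneg hcr
  set δ := contrast b κ₀ μ₀ κ μ with hδ
  have hδ0 : 0 ≤ δ := contrast_nonneg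
  set R : Space d → ℝ :=
    fun x => residual P κ₀ μ₀ E (fun i => ε i x - E i) (deltaP P κ₀ μ₀ κ μ x) with hR
  have hRm : MemLp R 2 (cellMeasure b) := memLp_residual hd hE hm hε
  set F : Fin (P.dim d) → Space d → ℝ := fun i x => 6 * (M * fluctSize (E i) (ε i) x) ^ θ with hF
  have hFm : ∀ i, AEStronglyMeasurable (F i) (cellMeasure b) := fun i => by
    have h3 : AEMeasurable (fluctSize (E i) (ε i)) (cellMeasure b) :=
      (hε i).memLp_fluctSize.1.aemeasurable
    exact (((h3.const_mul M).pow_const θ).const_mul 6).aestronglyMeasurable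
  have hpt : ∀ x, ‖deltaP P κ₀ μ₀ κ μ x - reconEnergy P κ₀ μ₀ E ε x‖
      ≤ ‖(L • (fun x => |R x| + ∑ i, F i x)) x‖ := by
    intro x
    have h3 := abs_sub_reconEnergy_le hE hlam ε x (deltaP P κ₀ μ₀ κ μ x) (D := fun i => F i x)
      fun i => error_alternative (relSize_nonneg _ _)
        ((hM i (ε i x - E i)).trans_eq (by rw [← fluctSize_eq])) hθ1.le hθ2
    refine h3.trans (le_abs_self _)
  have hY : ∀ i, eLpNorm (F i) q (cellMeasure b) ≤ ENNReal.ofReal (6 * (M * D i) ^ θ * δ ^ θ) := by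
    intro i
    have e1 : F i = (6:ℝ) • fun x => ‖M * fluctSize (E i) (ε i) x‖ ^ θ := by
      funext x
      have : 0 ≤ M * fluctSize (E i) (ε i) x := mul_nonneg hM0 (fluctSize_nonneg _ _ _)
      simp only [hF, Pi.smul_apply, smul_eq_mul, Real.norm_of_nonneg this]
    have e2 : (q : ℝ≥0∞) * ENNReal.ofReal θ = 2 := by
      have hq0 : (0:ℝ) < q := by linarith
      rw [← ENNReal.ofReal_coe_nnreal, ← ENNReal.ofReal_mul (by positivity), hθ,
        mul_div_cancel₀ _ hq0.ne']
      simp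
    rw [e1]
    refine (eLpNorm_const_smul_le).trans ?_
    rw [eLpNorm_norm_rpow _ (by linarith), e2, Real.enorm_eq_ofReal (by norm_num)]
    have e3 : eLpNorm (fun x => M * fluctSize (E i) (ε i) x) 2 (cellMeasure b)
        ≤ ENNReal.ofReal (M * (D i * δ)) := by
      refine (eLpNorm_const_smul_le (c := M) (f := fluctSize (E i) (ε i))).trans ?_
      rw [Real.enorm_eq_ofReal hM0, ENNReal.ofReal_mul hM0]
      gcongr
      exact hD i κ μ hm h2 (ε i) (hε i)
    calc _ ≤ ENNReal.ofReal 6 * ENNReal.ofReal (M * (D i * δ)) ^ θ := by gcongr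
      _ = _ := by
        have hMD : 0 ≤ M * D i := mul_nonneg hM0 (hD0 i)
        rw [ENNReal.ofReal_rpow_of_nonneg (by rw [← mul_assoc]; positivity) (by linarith),
          ← ENNReal.ofReal_mul (by norm_num), ← mul_assoc, Real.mul_rpow hMD hδ0]
        ring_nf
  calc eLpNorm (fun x => deltaP P κ₀ μ₀ κ μ x - reconEnergy P κ₀ μ₀ E ε x) q (cellMeasure b)
      ≤ eLpNorm (L • (fun x => |R x| + ∑ i, F i x)) q (cellMeasure b) := eLpNorm_mono hpt
    _ ≤ ENNReal.ofReal L * eLpNorm (fun x => |R x| + ∑ i, F i x) q (cellMeasure b) := by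
        rw [← Real.enorm_eq_ofReal hL0.le]
        exact eLpNorm_const_smul_le
    _ ≤ ENNReal.ofReal L * (eLpNorm (fun x => |R x|) q (cellMeasure b)
          + eLpNorm (fun x => ∑ i, F i x) q (cellMeasure b)) := by
        gcongr
        exact eLpNorm_add_le hRm.1.norm
          (Finset.aestronglyMeasurable_fun_sum _ fun i _ => hFm i) hq1
    _ ≤ ENNReal.ofReal L * (ENNReal.ofReal (C * δ ^ 2 * v)
          + ENNReal.ofReal (∑ i, 6 * (M * D i) ^ θ * δ ^ θ)) := by
        gcongr
        · calc eLpNorm (fun x => |R x|) q (cellMeasure b)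
              = eLpNorm R q (cellMeasure b) := eLpNorm_norm R
            _ ≤ _ := eLpNorm_le_eLpNorm_mul_rpow_measure_univ hq2.le hRm.1
            _ ≤ ENNReal.ofReal (C * δ ^ 2) * ENNReal.ofReal v := by
                rw [hv']
                gcongr
                exact h κ μ hm hmean h2 ε hε
            _ = _ := (ENNReal.ofReal_mul (by positivity)).symm
        · have h4 : eLpNorm (∑ i, F i) q (cellMeasure b) ≤ ∑ i, eLpNorm (F i) q (cellMeasure b) :=
            eLpNorm_sum_le (fun i _ => hFm i) hq1
          have h5 : (fun x => ∑ i, F i x) = ∑ i, F i := by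
            funext x; simp
          rw [h5]
          refine h4.trans ?_
          rw [ENNReal.ofReal_sum_of_nonneg]
          · exact Finset.sum_le_sum fun i _ => hY i
          · intro i _
            have := hD0 i
            positivity
    _ = ENNReal.ofReal (L * (C * v) * δ ^ 2 + (L * ∑ i, 6 * (M * D i) ^ θ) * δ ^ θ) := by
        rw [← ENNReal.ofReal_add, ← ENNReal.ofReal_mul hL0.le, ← Finset.sum_mul]
        · congr 1; ring
        · positivity
        · refine Finset.sum_nonneg fun i _ => ?_
          have := hD0 i
          positivity
    _ ≤ ENNReal.ofReal (η * δ) := ENNReal.ofReal_le_ofReal h1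

end UniformEstimates

/-! ### Neumann series and pointwise second-order expansion. -/

section Neumann

variable {d : ℕ} {b : Module.Basis (Fin d) ℝ (Space d)} {κ₀ μ₀ : ℝ}

/-- By Tonelli the sum has finite integral, hence is finite almost everywhere. This is the passage
from energy bounds to pointwise ones. -/
lemma ae_summable_of_summable_integral {α : Type*} [MeasurableSpace α] {ν : Measure α}
    {f : ℕ → α → ℝ} (hf : ∀ N, Integrable (f N) ν) (h0 : ∀ N x, 0 ≤ f N x)
    (h : Summable fun N => ∫ x, f N x ∂ν) : ∀ᵐ x ∂ν, Summable fun N => f N x := by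
  have h1 : ∫⁻ x, ∑' N, ENNReal.ofReal (f N x) ∂ν ≠ ⊤ := by
    rw [lintegral_tsum fun N => (hf N).1.aemeasurable.ennreal_ofReal]
    have : ∀ N, ∫⁻ x, ENNReal.ofReal (f N x) ∂ν = ENNReal.ofReal (∫ x, f N x ∂ν) := fun N =>
      (ofReal_integral_eq_lintegral_ofReal (hf N) (ae_of_all _ (h0 N))).symm
    simp only [this]
    exact h.tsum_ofReal_ne_top
  filter_upwards [ae_lt_top' (AEMeasurable.tsum fun N =>
    (hf N).1.aemeasurable.ennreal_ofReal) h1] with x hx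
  have := ENNReal.summable_toReal hx.ne
  simpa only [ENNReal.toReal_ofReal (h0 _ x)] using this

lemma energy_const_mul (c : ℂ) (f : Idx d → Space d → ℂ) :
    energy b (fun p x => c * f p x) = ‖c‖ ^ 2 * energy b f := by
  simp only [energy, norm_mul, mul_pow, integral_const_mul, Finset.mul_sum]

lemma energy_summand_le (f : Idx d → Space d → ℂ) (p : Idx d) :
    ∫ x, ‖f p x‖ ^ 2 ∂(cellMeasure b) ≤ energy b f :=
  Finset.single_le_sum (f := fun p => ∫ x, ‖f p x‖ ^ 2 ∂(cellMeasure b))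
    (fun _ _ => integral_nonneg fun _ => by positivity) (Finset.mem_univ p)

/-- The terms of the Neumann series of the Lippmann-Schwinger equation. -/
lemma exists_neumann_terms (hμ₀ : 0 < μ₀) {A : Space d → Tensor4 d} {m : ℝ}
    (hA : IsBoundedTensor b A m) {f : Idx d → Space d → ℂ}
    (hf : ∀ p, MemLp (f p) 2 (cellMeasure b)) :
    ∃ a : ℕ → Idx d → Space d → ℂ, a 0 = f ∧ (∀ N p, MemLp (a N p) 2 (cellMeasure b)) ∧
      ∀ N, IsGreenImage b κ₀ μ₀ (a (N + 1)) (mulField A (a N)) := by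
  let S := {g : Idx d → Space d → ℂ // ∀ p, MemLp (g p) 2 (cellMeasure b)}
  have hstep : ∀ g : S, ∃ g' : S, IsGreenImage b κ₀ μ₀ g'.1 (mulField A g.1) := fun g => by
    obtain ⟨e, he, he'⟩ := exists_isGreenImage (κ₀ := κ₀) hμ₀ (hA.memLp g.2)
    exact ⟨⟨e, he⟩, he'⟩
  choose F hF using hstep
  let a : ℕ → S := fun N => Nat.rec ⟨f, hf⟩ (fun _ g => F g) N
  exact ⟨fun N => (a N).1, rfl, fun N => (a N).2, fun N => hF (a N)⟩

lemma IsGreenImage.energy_mulField_le (hμ₀ : 0 < μ₀) {A : Space d → Tensor4 d} {m : ℝ}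
    (hA : IsBoundedTensor b A m) {e f : Idx d → Space d → ℂ}
    (he : ∀ p, MemLp (e p) 2 (cellMeasure b)) (hf : ∀ p, MemLp (f p) 2 (cellMeasure b))
    (c : ℂ) (h : IsGreenImage b κ₀ μ₀ e (fun p x => c * mulField A f p x)) :
    energy b e ≤ greenConst d κ₀ μ₀ * (m ^ 2 * Fintype.card (Idx d) ^ 2) * ‖c‖ ^ 2 * energy b f := by
  have h1 := h.energy_le hμ₀ he fun p => (hA.memLp hf p).const_mul c
  rw [energy_const_mul] at h1
  calc _ ≤ _ := h1
    _ ≤ greenConst d κ₀ μ₀ * (‖c‖ ^ 2 * (m ^ 2 * Fintype.card (Idx d) ^ 2 * energy b f)) := by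
        refine mul_le_mul_of_nonneg_left ?_ (greenConst_nonneg _ _)
        gcongr
        exact hA.energy_le hf
    _ = _ := by ring

/-- The remainder of the Neumann series. -/
noncomputable def neumannRem (e : Idx d → Space d → ℂ) (t : ℝ) (a : ℕ → Idx d → Space d → ℂ)
    (N : ℕ) (p : Idx d) (x : Space d) : ℂ :=
  e p x - ∑ k ∈ Finset.range N, (t : ℂ) ^ (k + 1) * a (k + 1) p x

lemma neumannRem_succ (e : Idx d → Space d → ℂ) (t : ℝ) (a : ℕ → Idx d → Space d → ℂ)
    (N : ℕ) (p : Idx d) (x : Space d) : neumannRem e t a (N + 1) p x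
      = neumannRem e t a N p x - (t : ℂ) ^ (N + 1) * a (N + 1) p x := by
  rw [neumannRem, neumannRem, Finset.sum_range_succ]
  ring

lemma memLp_neumannRem {e : Idx d → Space d → ℂ} (t : ℝ) {a : ℕ → Idx d → Space d → ℂ}
    (he : ∀ p, MemLp (e p) 2 (cellMeasure b)) (ha : ∀ N p, MemLp (a N p) 2 (cellMeasure b))
    (N : ℕ) (p : Idx d) : MemLp (neumannRem e t a N p) 2 (cellMeasure b) :=
  (he p).sub (memLp_finsetSum _ fun k _ => (ha (k + 1) p).const_mul _)

lemma mulField_sub_const_mul (A : Space d → Tensor4 d) (f g : Idx d → Space d → ℂ) (c : ℂ)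
    (p : Idx d) (x : Space d) : mulField A (fun q y => f q y - c * g q y) p x
      = mulField A f p x - c * mulField A g p x := by
  simp only [mulField, contr_sub, contr_const_mul]

/-- Subtracting the next term of the series cancels the source, so each remainder is -tΓA of the
previous one and the remainders contract for small t. -/
lemma isGreenImage_neumannRem {A : Space d → Tensor4 d} {m : ℝ}
    (hA : IsBoundedTensor b A m) {a : ℕ → Idx d → Space d → ℂ}
    (ha : ∀ N p, MemLp (a N p) 2 (cellMeasure b))
    (hstep : ∀ N, IsGreenImage b κ₀ μ₀ (a (N + 1)) (mulField A (a N)))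
    {t : ℝ} {e : Idx d → Space d → ℂ} (he : ∀ p, MemLp (e p) 2 (cellMeasure b))
    (hG : IsGreenImage b κ₀ μ₀ e
      (fun p x => (t : ℂ) * mulField A (fun q y => a 0 q y + e q y) p x)) (N : ℕ) :
    IsGreenImage b κ₀ μ₀ (neumannRem e t a (N + 1))
      (fun p x => (t : ℂ) * mulField A (neumannRem e t a N) p x) := by
  have hs : ∀ N, neumannRem e t a (N + 1) = fun p x =>
      neumannRem e t a N p x - (t : ℂ) ^ (N + 1) * a (N + 1) p x := fun N => by
    funext p x; exact neumannRem_succ e t a N p x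
  induction N with
  | zero =>
    -- The sum starts at `a 1`: the unperturbed field `a 0` is not part of `e`, and subtracting `t a
    -- 1` removes it from the right-hand side.
    have h0 : neumannRem e t a 0 = e := by
      funext p x; simp [neumannRem]
    have h1 := hG.sub ((hstep 0).const_mul (t : ℂ)) he (fun p => (ha 1 p).const_mul _)
      (fun p => (hA.memLp (fun q => (ha 0 q).add (he q)) p).const_mul _)
      (fun p => (hA.memLp (ha 0) p).const_mul _)
    rw [hs 0, h0]
    convert h1 using 3 with p x p x
    · simp
    · rw [mulField, mulField, mulField, contr_add]
      ring
  | succ N ih =>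
    have h1 := ih.sub ((hstep (N + 1)).const_mul ((t : ℂ) ^ (N + 2)))
      (memLp_neumannRem t he ha (N + 1)) (fun p => (ha (N + 2) p).const_mul _)
      (fun p => (hA.memLp (memLp_neumannRem t he ha N) p).const_mul _)
      (fun p => (hA.memLp (ha (N + 1)) p).const_mul _)
    rw [hs (N + 1)]
    convert h1 using 3 with p x
    rw [hs N, mulField_sub_const_mul]
    ring

/-- The tail starts at t², and its ratio |t|/s is at most 1/2, whence the factor 2. -/
lemma norm_sum_geometric_le {a : ℕ → ℂ} {B s : ℝ} {t : ℝ} (hs : 0 < s) (hB : 0 ≤ B)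
    (ha : ∀ N, ‖a N‖ ≤ B / s ^ N) (ht : |t| ≤ s / 2) (N : ℕ) :
    ‖∑ k ∈ Finset.range N, (t : ℂ) ^ (k + 2) * a (k + 2)‖ ≤ 2 * B / s ^ 2 * t ^ 2 := by
  have hq : |t| / s ≤ 1 / 2 := by rw [div_le_iff₀ hs]; linarith
  calc _ ≤ ∑ k ∈ Finset.range N, ‖(t : ℂ) ^ (k + 2) * a (k + 2)‖ := norm_sum_le _ _
    _ ≤ ∑ k ∈ Finset.range N, B / s ^ 2 * t ^ 2 * (1 / 2) ^ k := by
        refine Finset.sum_le_sum fun k _ => ?_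
        rw [norm_mul, norm_pow, Complex.norm_real, Real.norm_eq_abs]
        calc |t| ^ (k + 2) * ‖a (k + 2)‖ ≤ |t| ^ (k + 2) * (B / s ^ (k + 2)) := by
              gcongr; exact ha _
          _ = B / s ^ 2 * |t| ^ 2 * (|t| / s) ^ k := by
              rw [div_pow]; field_simp; ring
          _ ≤ B / s ^ 2 * t ^ 2 * (1 / 2) ^ k := by
              rw [sq_abs]; gcongr
    _ = B / s ^ 2 * t ^ 2 * ∑ k ∈ Finset.range N, (1 / 2 : ℝ) ^ k := by rw [Finset.mul_sum]
    _ ≤ B / s ^ 2 * t ^ 2 * 2 := by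
        gcongr
        exact sum_geometric_two_le N
    _ = _ := by ring

/-- First-order expansion, with a pointwise remainder of second order, of the solutions of the
Lippmann-Schwinger equation with a small parameter. -/
theorem exists_pointwise_expansion (hμ₀ : 0 < μ₀) {A : Space d → Tensor4 d} {m : ℝ}
    (hA : IsBoundedTensor b A m) {f : Idx d → Space d → ℂ}
    (hf : ∀ p, MemLp (f p) 2 (cellMeasure b)) :
    ∃ s : ℝ, 0 < s ∧ ∃ g : Idx d → Space d → ℂ, (∀ p, MemLp (g p) 2 (cellMeasure b)) ∧
      IsGreenImage b κ₀ μ₀ g (mulField A f) ∧ ∃ M : Space d → ℝ, (∀ x, 0 ≤ M x) ∧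
      ∀ t : ℝ, |t| ≤ s → ∀ e : Idx d → Space d → ℂ, (∀ p, MemLp (e p) 2 (cellMeasure b)) →
        IsGreenImage b κ₀ μ₀ e
          (fun p x => (t : ℂ) * mulField A (fun q y => f q y + e q y) p x) →
        ∀ᵐ x ∂(cellMeasure b), ∀ p, ‖e p x - t * g p x‖ ≤ M x * t ^ 2 := by
  obtain ⟨a, ha0, ha, hstep⟩ := exists_neumann_terms (κ₀ := κ₀) hμ₀ hA hf
  subst ha0
  set C := greenConst d κ₀ μ₀ * (m ^ 2 * Fintype.card (Idx d) ^ 2) with hC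
  have hC0 : 0 ≤ C := mul_nonneg (greenConst_nonneg _ _) (by positivity)
  -- Weights chosen so that Cρ ≤ 1/2: the weighted energies of the terms then sum like a geometric
  -- series.
  set ρ : ℝ := 1 / (2 * (C + 1)) with hρ
  have hρ0 : 0 < ρ := by positivity
  have hρC : C * ρ ≤ 1 / 2 := by
    rw [hρ, mul_one_div, div_le_iff₀ (by positivity)]; linarith
  set s := Real.sqrt ρ with hs
  have hs0 : 0 < s := Real.sqrt_pos.mpr hρ0
  have hs2 : s ^ 2 = ρ := Real.sq_sqrt hρ0.le
  have hen : ∀ N, energy b (a N) ≤ C ^ N * energy b (a 0) := by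
    intro N
    induction N with
    | zero => simp
    | succ N ih =>
      have h1 := IsGreenImage.energy_mulField_le hμ₀ hA (ha (N + 1)) (ha N) 1
        (by simpa only [one_mul] using hstep N)
      rw [norm_one, one_pow, mul_one, ← hC] at h1
      calc _ ≤ C * energy b (a N) := h1
        _ ≤ C * (C ^ N * energy b (a 0)) := by gcongr
        _ = _ := by ring
  have hE0 := energy_nonneg (b := b) (a 0)
  have hsum : ∀ᵐ x ∂(cellMeasure b), ∀ p, Summable fun N => ρ ^ N * ‖a N p x‖ ^ 2 := by
    rw [ae_all_iff]
    intro p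
    refine ae_summable_of_summable_integral (fun N => (integrable_sq (ha N p)).const_mul _)
      (fun N x => by positivity) ?_
    simp only [integral_const_mul]
    refine Summable.of_nonneg_of_le (fun N => mul_nonneg (by positivity)
      (integral_nonneg fun _ => by positivity)) (fun N => ?_)
      ((summable_geometric_two).mul_right (energy b (a 0)))
    calc ρ ^ N * ∫ x, ‖a N p x‖ ^ 2 ∂(cellMeasure b) ≤ ρ ^ N * (C ^ N * energy b (a 0)) := by
          gcongr
          exact (energy_summand_le (a N) p).trans (hen N)
      _ = (C * ρ) ^ N * energy b (a 0) := by rw [mul_pow]; ring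
      _ ≤ (1 / 2) ^ N * energy b (a 0) := by gcongr
  -- Independent of `t` and of the solution. At points where a series diverges the value is a
  -- default, but such points form a null set by `hsum`.
  set B : Space d → ℝ := fun x => Real.sqrt (∑ p, ∑' N, ρ ^ N * ‖a N p x‖ ^ 2) with hB
  -- The bound `B x / s ^ N` on the terms makes the series converge for |t| < s; halving the radius
  -- fixes the ratio at 1/2 or less.
  refine ⟨s / 2, by positivity, a 1, ha 1, hstep 0, fun x => 2 * B x / s ^ 2,
    fun x => by positivity, fun t ht e he hG => ?_⟩
  have ht2 : C * t ^ 2 ≤ 1 / 2 := by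
    have : t ^ 2 ≤ ρ := by
      rw [← hs2, ← sq_abs t]
      gcongr
      linarith
    exact (mul_le_mul_of_nonneg_left this hC0).trans hρC
  have hrem : ∀ N, energy b (neumannRem e t a N) ≤ (1 / 2) ^ N * energy b e := by
    intro N
    induction N with
    | zero =>
      have h0 : neumannRem e t a 0 = e := by
        funext p x; simp [neumannRem]
      simp [h0]
    | succ N ih =>
      have h1 := IsGreenImage.energy_mulField_le hμ₀ hA (memLp_neumannRem t he ha (N + 1))
        (memLp_neumannRem t he ha N) t (isGreenImage_neumannRem hA ha hstep he hG N)
      rw [← hC, Complex.norm_real, Real.norm_eq_abs, sq_abs] at h1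
      calc _ ≤ _ := h1
        _ ≤ 1 / 2 * ((1 / 2) ^ N * energy b e) := by
            have := energy_nonneg (b := b) (neumannRem e t a N)
            gcongr
        _ = _ := by ring
  -- This null set depends on `t` and `e`, but the bound finally obtained does not, since the
  -- remainder tends to zero here.
  have hsum2 : ∀ᵐ x ∂(cellMeasure b), ∀ p, Summable fun N => ‖neumannRem e t a N p x‖ ^ 2 := by
    rw [ae_all_iff]
    intro p
    refine ae_summable_of_summable_integral
      (fun N => integrable_sq (memLp_neumannRem t he ha N p)) (fun N x => by positivity) ?_
    exact Summable.of_nonneg_of_le (fun N => integral_nonneg fun _ => by positivity)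
      (fun N => (energy_summand_le _ p).trans (hrem N)) ((summable_geometric_two).mul_right _)
  filter_upwards [hsum, hsum2] with x hx hx2 p
  have hBx : ∀ N, ‖a N p x‖ ≤ B x / s ^ N := by
    intro N
    rw [le_div_iff₀ (by positivity)]
    refine Real.le_sqrt_of_sq_le ?_
    have e1 : (‖a N p x‖ * s ^ N) ^ 2 = ρ ^ N * ‖a N p x‖ ^ 2 := by
      rw [← hs2]; ring
    rw [e1]
    refine ((hx p).le_tsum N fun _ _ => by positivity).trans ?_
    exact Finset.single_le_sum (f := fun p => ∑' N, ρ ^ N * ‖a N p x‖ ^ 2)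
      (fun _ _ => tsum_nonneg fun _ => by positivity) (Finset.mem_univ p)
  have hlim : Tendsto (fun N => ‖neumannRem e t a (N + 1) p x‖) atTop (nhds 0) := by
    have h1 : Tendsto (fun N => ‖neumannRem e t a N p x‖) atTop (nhds 0) := by
      have := ((hx2 p).tendsto_atTop_zero).sqrt
      simpa [Real.sqrt_sq (norm_nonneg _)] using this
    exact h1.comp (tendsto_add_atTop_nat 1)
  have hbd : ∀ N, ‖e p x - t * a 1 p x‖ ≤ ‖neumannRem e t a (N + 1) p x‖
      + 2 * B x / s ^ 2 * t ^ 2 := by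
    intro N
    have e1 : e p x - t * a 1 p x = neumannRem e t a (N + 1) p x
        + ∑ k ∈ Finset.range N, (t : ℂ) ^ (k + 2) * a (k + 2) p x := by
      rw [neumannRem, Finset.sum_range_succ']
      simp only [zero_add, pow_one, add_assoc, Nat.reduceAdd]
      ring
    rw [e1]
    refine (norm_add_le _ _).trans ?_
    gcongr
    exact norm_sum_geometric_le hs0 (Real.sqrt_nonneg _) hBx ht N
  have := le_of_tendsto_of_tendsto' tendsto_const_nhds (hlim.add_const _) hbd
  simpa using this

end Neumann

/-! ### Pointwise remainders for a fluctuation of fixed shape. -/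

section Pointwise

variable {d : ℕ} {b : Module.Basis (Fin d) ℝ (Space d)} {P : Proj}
  {E : Fin (P.dim d) → Tensor2 d} {κ₀ μ₀ : ℝ}

/-- The contrast is |t| times a positive constant, so t² is negligible before it; indices with `t n
= 0` are covered, as both sides vanish there. -/
lemma isLittleO_of_sq_bound {R δ t : ℕ → ℝ} {Z c s : ℝ} (ht : Tendsto t atTop (nhds 0))
    (hc : 0 < c) (hδ : ∀ n, δ n = |t n| * c) (hs : 0 < s)
    (h : ∀ n, |t n| ≤ s → |R n| ≤ Z * t n ^ 2) : R =o[atTop] δ := by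
  rw [isLittleO_iff]
  intro η hη
  have ht' : Tendsto (fun n => |t n|) atTop (nhds 0) := by simpa using ht.abs
  have hZ : Tendsto (fun n => Z * |t n|) atTop (nhds 0) := by simpa using ht'.const_mul Z
  filter_upwards [ht'.eventually (gt_mem_nhds hs),
    hZ.eventually (gt_mem_nhds (mul_pos hη hc))] with n h1 h2
  rw [hδ, Real.norm_eq_abs, Real.norm_of_nonneg (by positivity)]
  calc |R n| ≤ Z * t n ^ 2 := h n h1.le
    _ = Z * |t n| * |t n| := by rw [← sq_abs]; ring
    _ ≤ η * c * |t n| := by gcongr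
    _ = _ := by ring

lemma IsBoundedTensor.const_mul {A : Space d → Tensor4 d} {m : ℝ} (hA : IsBoundedTensor b A m)
    (c : ℝ) : IsBoundedTensor b (fun x => c • A x) (|c| * m) := by
  refine ⟨fun i j k l => ?_, ?_⟩
  · simpa only [Pi.smul_apply, smul_eq_mul] using (hA.meas i j k l).const_mul c
  · filter_upwards [hA.bound] with x hx i j k l
    rw [Pi.smul_apply, Pi.smul_apply, Pi.smul_apply, Pi.smul_apply, smul_eq_mul, abs_mul]
    gcongr
    exact hx i j k l

lemma contrast_smul (k m : Space d → ℝ) (t : ℝ) (κ μ : Space d → ℝ)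
    (hκ : ∀ x, κ x = κ₀ + t * k x) (hμ : ∀ x, μ x = μ₀ + t * m x) :
    contrast b κ₀ μ₀ κ μ
      = |t| * (eLpNorm (fun x => max |d * k x| |2 * m x|) ∞ (cellMeasure b)).toReal := by
  have : (fun x => max |d * (κ x - κ₀)| |2 * (μ x - μ₀)|)
      = |t| • fun x => max |d * k x| |2 * m x| := by
    funext x
    rw [Pi.smul_apply, smul_eq_mul, mul_max_of_nonneg _ _ (abs_nonneg t), ← abs_mul, ← abs_mul,
      hκ, hμ]
    congr 2 <;> ring
  rw [contrast, this, eLpNorm_const_smul, ENNReal.toReal_mul]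
  simp

/-- If the contrast vanishes, both remainders vanish almost everywhere. -/
lemma ae_eq_zero_of_contrast_eq_zero (hd : 2 ≤ d) (hκ₀ : 0 < κ₀) (hμ₀ : 0 < μ₀)
    (hE : IsOrthogonalEigenbasis P E) {κ μ : Space d → ℝ} (hm : IsModuliField b κ μ)
    (hmean : ∫ x, deltaP P κ₀ μ₀ κ μ x ∂(cellMeasure b) = 0)
    (hc : contrast b κ₀ μ₀ κ μ = 0) {ε : Fin (P.dim d) → Space d → Tensor2 d}
    (hε : ∀ i, IsStrainSolution b κ μ (E i) (ε i)) :
    ∀ᵐ x ∂(cellMeasure b), deltaP P κ₀ μ₀ κ μ x - reconParallel P κ₀ μ₀ E ε x = 0 ∧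
      deltaP P κ₀ μ₀ κ μ x - reconEnergy P κ₀ μ₀ E ε x = 0 := by
  have hlam := lam_pos hd hκ₀ hμ₀ P
  obtain ⟨C, -, h⟩ := exists_eLpNorm_residual_le hd b hκ₀ hμ₀ hE
  choose D _ hD using fun i => exists_eLpNorm_fluctSize_le hd hκ₀ hμ₀ b (E i)
  obtain ⟨M, hM0, hM⟩ := exists_relSize_le E
  have hr : 4 * contrastConst d κ₀ μ₀ * contrast b κ₀ μ₀ κ μ ^ 2 ≤ 1 := by simp [hc]
  have h1 := h κ μ hm hmean hr ε hε
  have h2 := fun i => hD i κ μ hm hr (ε i) (hε i)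
  simp only [hc, ne_eq, OfNat.ofNat_ne_zero, not_false_eq_true, zero_pow, mul_zero,
    ENNReal.ofReal_zero, nonpos_iff_eq_zero] at h1 h2
  rw [eLpNorm_eq_zero_iff (memLp_residual hd hE hm hε).1 (by norm_num)] at h1
  have h3 : ∀ᵐ x ∂(cellMeasure b), ∀ i, fluctSize (E i) (ε i) x = 0 := by
    rw [ae_all_iff]
    exact fun i => (eLpNorm_eq_zero_iff (hε i).memLp_fluctSize.1 (by norm_num)).mp (h2 i)
  filter_upwards [h1, h3] with x hx hx2
  simp only [Pi.zero_apply] at hx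
  refine ⟨by rw [sub_reconParallel hE hlam.ne', hx, mul_zero], ?_⟩
  have h4 := abs_sub_reconEnergy_le hE hlam ε x (deltaP P κ₀ μ₀ κ μ x) (D := 0) fun i => by
    left
    have := hM i (ε i x - E i)
    rw [← fluctSize_eq, hx2, mul_zero] at this
    simp only [Pi.zero_apply]
    linarith
  rw [hx] at h4
  simpa using h4

lemma norm_cresidual_zero_le (κ₀ μ₀ : ℝ) (E : Fin (P.dim d) → Tensor2 d)
    (f : Fin (P.dim d) → Idx d → ℂ) {B : Fin (P.dim d) → ℝ} (hB : ∀ i p, ‖f i p‖ ≤ B i) :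
    ‖cresidual P κ₀ μ₀ E f 0‖
      ≤ ∑ i, (tnorm (E i) ^ 2)⁻¹ * ((∑ p : Idx d, |E i p.1 p.2|) * B i) := by
  rw [cresidual, mul_zero, add_zero]
  refine (norm_sum_le _ _).trans (Finset.sum_le_sum fun i _ => ?_)
  rw [norm_mul, Complex.norm_real, Real.norm_of_nonneg (by positivity)]
  gcongr
  rw [Finset.sum_mul]
  refine (norm_sum_le _ _).trans (Finset.sum_le_sum fun p _ => ?_)
  rw [norm_mul, Complex.norm_real, Real.norm_eq_abs]
  gcongr
  exact hB i p

/-- Isolates the residual of the first-order term `g`, which vanishes almost everywhere, from the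
second-order error `f - t g`. -/
lemma cresidual_sub_mul (κ₀ μ₀ : ℝ) (f g : Fin (P.dim d) → Idx d → ℂ) (t q : ℂ) :
    cresidual P κ₀ μ₀ E f (t * q)
      = cresidual P κ₀ μ₀ E (fun i p => f i p - t * g i p) 0 + t * cresidual P κ₀ μ₀ E g q := by
  simp only [cresidual, mul_sub, Finset.sum_sub_distrib, mul_zero, add_zero, mul_add]
  have : ∀ i, ∑ p : Idx d, (E i p.1 p.2 : ℂ) * (t * g i p)
      = t * ∑ p : Idx d, (E i p.1 p.2 : ℂ) * g i p := fun i => by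
    rw [Finset.mul_sum]
    exact Finset.sum_congr rfl fun p _ => by ring
  simp only [this]
  have h2 : ∑ i, (((tnorm (E i) ^ 2)⁻¹ : ℝ) : ℂ) * (t * ∑ p : Idx d, (E i p.1 p.2 : ℂ) * g i p)
      = t * ∑ i, (((tnorm (E i) ^ 2)⁻¹ : ℝ) : ℂ) * ∑ p : Idx d, (E i p.1 p.2 : ℂ) * g i p := by
    rw [Finset.mul_sum]
    exact Finset.sum_congr rfl fun i _ => by ring
  rw [h2]
  ring

/-- Pointwise second-order bound of both remainders, for moduli fluctuations of a given shape. -/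
theorem exists_pointwise_bound (hd : 2 ≤ d) (hκ₀ : 0 < κ₀) (hμ₀ : 0 < μ₀)
    (hE : IsOrthogonalEigenbasis P E) {A : Space d → Tensor4 d} {m : ℝ}
    (hA : IsBoundedTensor b A m) {p₁ : Space d → ℝ} (hp₁ : MemLp p₁ 2 (cellMeasure b))
    (hmean : ∫ x, p₁ x ∂(cellMeasure b) = 0) (hAE : ∀ i x, act (A x) (E i) = p₁ x • E i) :
    ∃ s : ℝ, 0 < s ∧ ∃ Z : Space d → ℝ, ∀ (t : ℝ) (κ μ : Space d → ℝ), |t| ≤ s →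
      IsModuliField b κ μ → (∀ x, deltaL κ₀ μ₀ κ μ x = t • A x) →
      (∀ x, deltaP P κ₀ μ₀ κ μ x = t * p₁ x) →
      ∀ ε : Fin (P.dim d) → Space d → Tensor2 d, (∀ i, IsStrainSolution b κ μ (E i) (ε i)) →
        ∀ᵐ x ∂(cellMeasure b),
          |deltaP P κ₀ μ₀ κ μ x - reconParallel P κ₀ μ₀ E ε x| ≤ Z x * t ^ 2 ∧
          |deltaP P κ₀ μ₀ κ μ x - reconEnergy P κ₀ μ₀ E ε x| ≤ Z x * t ^ 2 := by
  have hlam := lam_pos hd hκ₀ hμ₀ P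
  have hconst : ∀ i p, MemLp (constField (E i) p) 2 (cellMeasure b) := fun i p => memLp_const _
  choose s hs g hg hgG M hM0 hM using fun i =>
    exists_pointwise_expansion (κ₀ := κ₀) hμ₀ hA (hconst i)
  obtain ⟨N, hN0, hN⟩ := exists_relSize_le E
  have hne : (Finset.univ : Finset (Fin (P.dim d))).Nonempty :=
    ⟨⟨0, P.dim_pos hd⟩, Finset.mem_univ _⟩
  -- The smallest of the finitely many radii; the cap at 1 serves to bound t² by |t|.
  set s₀ := min 1 (Finset.univ.inf' hne s) with hs₀
  have hs₀0 : 0 < s₀ := lt_min one_pos ((Finset.lt_inf'_iff hne).mpr fun i _ => hs i)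
  -- the first-order term has no residual
  have hres : ∀ᵐ x ∂(cellMeasure b),
      cresidual P κ₀ μ₀ E (fun i p => g i p x) (p₁ x : ℂ) = 0 := by
    -- The first-order term is the Green image of `p₁ E i` with nothing left over, so the residual
    -- estimate holds with `τ = 0` and its right side is 0.
    obtain ⟨C, -, hC⟩ := exists_integral_cresidual_le hd b hE (κ₀ := κ₀) hμ₀
    have h1 := hC g (fun _ _ _ => 0) (fun x => (p₁ x : ℂ)) hg (fun _ _ => memLp_const 0) hp₁.ofReal
      (fcoef_zero_ofReal _ hmean) fun i => by
        convert hgG i using 1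
        funext p x
        have : mulField A (constField (E i)) p x = contr (A x) (fun r => (E i r.1 r.2 : ℂ)) p := rfl
        rw [this, contr_ofReal_eq, hAE, add_zero, Matrix.smul_apply, smul_eq_mul]
        push_cast
        ring
    have h0 : energy b (fun (_ : Idx d) (_ : Space d) => (0 : ℂ)) = 0 := by simp [energy]
    simp only [h0, Finset.sum_const_zero, mul_zero] at h1
    have hmem := memLp_cresidual (E := E) κ₀ μ₀ hg hp₁.ofReal
    have h2 := (integral_eq_zero_iff_of_nonneg (fun _ => by positivity) (integrable_sq hmem)).mp
      (le_antisymm h1 (integral_nonneg fun _ => by positivity))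
    filter_upwards [h2] with x hx
    simpa using hx
  set Q : Fin (P.dim d) → Space d → ℝ := fun i x => ∑ p, (‖g i p x‖ + M i x) with hQ
  set W : Space d → ℝ := fun x =>
    ∑ i, (tnorm (E i) ^ 2)⁻¹ * ((∑ p : Idx d, |E i p.1 p.2|) * M i x) with hW
  refine ⟨s₀, hs₀0, fun x => (P.lam d κ₀ μ₀)⁻¹ * (W x + ∑ i, 6 * (N * Q i x) ^ 2),
    fun t κ μ ht hm hL hP ε hε => ?_⟩
  have ht1 : |t| ≤ 1 := ht.trans (min_le_left _ _)
  have hti : ∀ i, |t| ≤ s i := fun i =>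
    ht.trans ((min_le_right _ _).trans (Finset.inf'_le _ (Finset.mem_univ i)))
  have hexp : ∀ᵐ x ∂(cellMeasure b), ∀ i p,
      ‖fluctField (E i) (ε i) p x - t * g i p x‖ ≤ M i x * t ^ 2 := by
    rw [ae_all_iff]
    intro i
    refine hM i t (hti i) _ (hε i).memLp_fluctField ?_
    have h1 := (hε i).isGreenImage hd hκ₀ hμ₀ hm
    convert h1 using 1
    funext p x
    rw [mulField, mulField, hL, ← contr_const_mul]
    simp only [contr]
    refine Finset.sum_congr rfl fun r _ => ?_
    simp only [Pi.smul_apply, smul_eq_mul, constField, fluctField, strainField]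
    push_cast
    ring
  filter_upwards [hres, hexp] with x hx hx2
  have hR : |residual P κ₀ μ₀ E (fun i => ε i x - E i) (deltaP P κ₀ μ₀ κ μ x)| ≤ W x * t ^ 2 := by
    rw [← Real.norm_eq_abs, ← Complex.norm_real, ofReal_residual, hP, Complex.ofReal_mul,
      cresidual_sub_mul κ₀ μ₀ _ (fun i p => g i p x), hx, mul_zero, add_zero]
    refine (norm_cresidual_zero_le κ₀ μ₀ E _ (B := fun i => M i x * t ^ 2) fun i p => hx2 i p).trans
      (le_of_eq ?_)
    rw [hW]
    simp only [Finset.sum_mul (s := Finset.univ (α := Fin (P.dim d)))]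
    exact Finset.sum_congr rfl fun i _ => by ring
  have hF : ∀ i, fluctSize (E i) (ε i) x ≤ Q i x * |t| := by
    intro i
    rw [fluctSize, hQ, Finset.sum_mul]
    refine Finset.sum_le_sum fun p _ => ?_
    calc ‖fluctField (E i) (ε i) p x‖
        = ‖t * g i p x + (fluctField (E i) (ε i) p x - t * g i p x)‖ := by congr 1; ring
      _ ≤ ‖(t : ℂ) * g i p x‖ + ‖fluctField (E i) (ε i) p x - t * g i p x‖ := norm_add_le _ _
      _ ≤ |t| * ‖g i p x‖ + M i x * t ^ 2 := by
          rw [norm_mul, Complex.norm_real, Real.norm_eq_abs]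
          gcongr
          exact hx2 i p
      _ ≤ |t| * ‖g i p x‖ + M i x * |t| := by
          gcongr
          · exact hM0 i x
          · rw [← sq_abs]
            nlinarith [abs_nonneg t]
      _ = _ := by ring
  have hS : ∀ i, 6 * relSize E i (ε i x - E i) ^ 2 ≤ 6 * (N * Q i x) ^ 2 * t ^ 2 := by
    intro i
    have h1 : relSize E i (ε i x - E i) ≤ N * (Q i x * |t|) := by
      refine (hN i (ε i x - E i)).trans ?_
      rw [← fluctSize_eq]
      exact mul_le_mul_of_nonneg_left (hF i) hN0
    calc 6 * relSize E i (ε i x - E i) ^ 2 ≤ 6 * (N * (Q i x * |t|)) ^ 2 := by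
          have := relSize_nonneg (E := E) i (ε i x - E i)
          gcongr
      _ = _ := by rw [← sq_abs t]; ring
  have hsq : 0 ≤ (∑ i, 6 * (N * Q i x) ^ 2) * t ^ 2 := by positivity
  constructor
  · rw [sub_reconParallel hE hlam.ne', abs_mul, abs_of_pos (inv_pos.mpr hlam), mul_assoc]
    gcongr
    linarith
  · refine (abs_sub_reconEnergy_le hE hlam ε x _ fun i => Or.inr (hS i)).trans ?_
    rw [mul_assoc, add_mul, ← Finset.sum_mul]
    gcongr

/-- Boundedness and zero mean are known for the moduli fields, not for `k` and `m`. The fixed shape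
is therefore read off from one index with nonzero contrast; if there is none, both remainders vanish
almost everywhere. -/
theorem pointwise_isLittleO (hd : 2 ≤ d) (hκ₀ : 0 < κ₀) (hμ₀ : 0 < μ₀)
    (hE : IsOrthogonalEigenbasis P E) (k m : Space d → ℝ) (t : ℕ → ℝ)
    (ht : Tendsto t atTop (nhds 0)) (κ μ : ℕ → Space d → ℝ)
    (hκ : ∀ n x, κ n x = κ₀ + t n * k x) (hμ : ∀ n x, μ n x = μ₀ + t n * m x)
    (hm : ∀ n, IsModuliField b (κ n) (μ n))
    (hmean : ∀ n, ∫ x, deltaP P κ₀ μ₀ (κ n) (μ n) x ∂(cellMeasure b) = 0)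
    (ε : ℕ → Fin (P.dim d) → Space d → Tensor2 d)
    (hε : ∀ n i, IsStrainSolution b (κ n) (μ n) (E i) (ε n i)) :
    ∀ᵐ x ∂(cellMeasure b),
      ((fun n => deltaP P κ₀ μ₀ (κ n) (μ n) x - reconParallel P κ₀ μ₀ E (ε n) x)
        =o[atTop] fun n => contrast b κ₀ μ₀ (κ n) (μ n)) ∧
      ((fun n => deltaP P κ₀ μ₀ (κ n) (μ n) x - reconEnergy P κ₀ μ₀ E (ε n) x)
        =o[atTop] fun n => contrast b κ₀ μ₀ (κ n) (μ n)) := by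
  by_cases hall : ∀ n, contrast b κ₀ μ₀ (κ n) (μ n) = 0
  · have h := ae_all_iff.mpr fun n => ae_eq_zero_of_contrast_eq_zero hd hκ₀ hμ₀ hE (hm n) (hmean n)
      (hall n) (hε n)
    filter_upwards [h] with x hx
    simp only [fun n => (hx n).1, fun n => (hx n).2]
    exact ⟨isLittleO_zero _ _, isLittleO_zero _ _⟩
  push Not at hall
  obtain ⟨n₀, hn₀⟩ := hall
  set c := (eLpNorm (fun x => max |d * k x| |2 * m x|) ∞ (cellMeasure b)).toReal with hc
  have hcontr : ∀ n, contrast b κ₀ μ₀ (κ n) (μ n) = |t n| * c := fun n =>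
    contrast_smul k m (t n) _ _ (hκ n) (hμ n)
  rw [hcontr] at hn₀
  have htn₀ : t n₀ ≠ 0 := fun h => hn₀ (by rw [h, abs_zero, zero_mul])
  have hc0 : 0 < c := lt_of_le_of_ne ENNReal.toReal_nonneg (Ne.symm (right_ne_zero_of_mul hn₀))
  -- Rescaling δL at the index `n₀` recovers the common shape, and this `A` inherits the bound of an
  -- actual moduli field.
  set A : Space d → Tensor4 d := fun x => (t n₀)⁻¹ • deltaL κ₀ μ₀ (κ n₀) (μ n₀) x with hAdef
  have hA := ((hm n₀).isBoundedTensor (κ₀ := κ₀) (μ₀ := μ₀) hd).const_mul (t n₀)⁻¹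
  set p₁ : Space d → ℝ := fun x => (t n₀)⁻¹ * deltaP P κ₀ μ₀ (κ n₀) (μ n₀) x with hp₁
  have hL : ∀ n x, deltaL κ₀ μ₀ (κ n) (μ n) x = t n • A x := by
    intro n x
    funext i j r l
    simp only [hAdef, Pi.smul_apply, smul_eq_mul, deltaL_apply, hκ, hμ]
    field_simp
    ring
  have hP : ∀ n x, deltaP P κ₀ μ₀ (κ n) (μ n) x = t n * p₁ x := by
    intro n x
    simp only [hp₁, hE.deltaP_eq hd, hκ, hμ]
    cases P <;> simp only [Proj.eig] <;> field_simp <;> ring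
  obtain ⟨s, hs, Z, hZ⟩ := exists_pointwise_bound hd hκ₀ hμ₀ hE hA (p₁ := p₁)
    ((memLp_deltaP hd hE (hm n₀)).const_mul _)
    (by rw [hp₁, integral_const_mul, hmean, mul_zero]) fun i x => by
      ext r l
      have := congrFun (congrFun (hE.act_deltaL κ₀ μ₀ (κ n₀) (μ n₀) x i) r) l
      rw [← hE.deltaP_eq hd, act_apply, Matrix.smul_apply, smul_eq_mul] at this
      simp only [act_apply, hp₁, Matrix.smul_apply, Pi.smul_apply, smul_eq_mul, mul_assoc,
        ← Finset.mul_sum, this]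
  -- The exceptional sets depend on `n`, and countably many of them are joined into one null set.
  have h : ∀ᵐ x ∂(cellMeasure b), ∀ n, |t n| ≤ s →
      |deltaP P κ₀ μ₀ (κ n) (μ n) x - reconParallel P κ₀ μ₀ E (ε n) x| ≤ Z x * t n ^ 2 ∧
      |deltaP P κ₀ μ₀ (κ n) (μ n) x - reconEnergy P κ₀ μ₀ E (ε n) x| ≤ Z x * t n ^ 2 := by
    rw [ae_all_iff]
    intro n
    by_cases hn : |t n| ≤ s
    · filter_upwards [hZ (t n) _ _ hn (hm n) (hL n) (hP n) (ε n) (hε n)] with x hx _ using hx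
    · exact ae_of_all _ fun x h => absurd h hn
  filter_upwards [h] with x hx
  exact ⟨isLittleO_of_sq_bound ht hc0 hcontr hs fun n hn => (hx n hn).1,
    isLittleO_of_sq_bound ht hc0 hcontr hs fun n hn => (hx n hn).2⟩

end Pointwise

end Elasticity

open Elasticity in
theorem lemma3 {d : ℕ} (hd : 2 ≤ d) (b : Module.Basis (Fin d) ℝ (Space d))
    (κ₀ μ₀ : ℝ) (hκ₀ : 0 < κ₀) (hμ₀ : 0 < μ₀)
    (P : Proj) (E : Fin (P.dim d) → Tensor2 d) (hE : IsOrthogonalEigenbasis P E) :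
    -- first formula, uniformly in the moduli
    (∀ η : ℝ, 0 < η → ∃ r : ℝ, 0 < r ∧
      ∀ (κ μ : Space d → ℝ), IsModuliField b κ μ →
      ∫ x, deltaP P κ₀ μ₀ κ μ x ∂(cellMeasure b) = 0 →
      contrast b κ₀ μ₀ κ μ ≤ r →
      ∀ ε : Fin (P.dim d) → Space d → Tensor2 d, (∀ i, IsStrainSolution b κ μ (E i) (ε i)) →
        eLpNorm (fun x => deltaP P κ₀ μ₀ κ μ x - reconParallel P κ₀ μ₀ E ε x) 2 (cellMeasure b)
          ≤ ENNReal.ofReal (η * contrast b κ₀ μ₀ κ μ)) ∧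
    -- second formula, uniformly in the moduli
    (∀ q : ℝ≥0∞, 1 ≤ q → q < 2 → ∀ η : ℝ, 0 < η → ∃ r : ℝ, 0 < r ∧
      ∀ (κ μ : Space d → ℝ), IsModuliField b κ μ →
      ∫ x, deltaP P κ₀ μ₀ κ μ x ∂(cellMeasure b) = 0 →
      contrast b κ₀ μ₀ κ μ ≤ r →
      ∀ ε : Fin (P.dim d) → Space d → Tensor2 d, (∀ i, IsStrainSolution b κ μ (E i) (ε i)) →
        eLpNorm (fun x => deltaP P κ₀ μ₀ κ μ x - reconEnergy P κ₀ μ₀ E ε x) q (cellMeasure b)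
          ≤ ENNReal.ofReal (η * contrast b κ₀ μ₀ κ μ)) ∧
    -- both formulas, pointwise almost everywhere, for a given fluctuation of vanishing amplitude
    (∀ (k m : Space d → ℝ) (t : ℕ → ℝ), Tendsto t atTop (nhds 0) →
      ∀ (κ μ : ℕ → Space d → ℝ), (∀ n x, κ n x = κ₀ + t n * k x) →
      (∀ n x, μ n x = μ₀ + t n * m x) → (∀ n, IsModuliField b (κ n) (μ n)) →
      (∀ n, ∫ x, deltaP P κ₀ μ₀ (κ n) (μ n) x ∂(cellMeasure b) = 0) →
      ∀ ε : ℕ → Fin (P.dim d) → Space d → Tensor2 d,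
      (∀ n i, IsStrainSolution b (κ n) (μ n) (E i) (ε n i)) →
      ∀ᵐ x ∂(cellMeasure b),
        ((fun n => deltaP P κ₀ μ₀ (κ n) (μ n) x - reconParallel P κ₀ μ₀ E (ε n) x)
          =o[atTop] fun n => contrast b κ₀ μ₀ (κ n) (μ n)) ∧
        ((fun n => deltaP P κ₀ μ₀ (κ n) (μ n) x - reconEnergy P κ₀ μ₀ E (ε n) x)
          =o[atTop] fun n => contrast b κ₀ μ₀ (κ n) (μ n))) := by
  exact ⟨fun η hη => uniform_reconParallel hd b hκ₀ hμ₀ hE hη,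
    fun q hq1 hq2 η hη => uniform_reconEnergy hd b hκ₀ hμ₀ hE hq1 hq2 hη,
    fun k m t ht κ μ hκ hμ hm hmean ε hε =>
      pointwise_isLittleO hd hκ₀ hμ₀ hE k m t ht κ μ hκ hμ hm hmean ε hε⟩
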